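/- An instance of Bilevel Independent Set consists of a finite simple graph $G=(V,E)$ with $V\neq\emptyset$, a partition $V=V_\ell\,\dot\cup\,V_f$ into leader and follower vertices, and weight functions $w_\ell,w_f\colon V\to\mathbb{R}_{\ge 0}$. For $S\subseteq V$ let $c_s(S)=\sum_{v\in S}w_\ell(v)$ and $d_b(S)=\min_{v\in S}w_f(v)$. For $L\subseteq V_\ell$ let $\Omega(L)$ be the set of all $F\subseteq V_f$ such that $L\cup F$ is a nonempty independent set of $G$; $L$ is a feasible action if $\Omega(L)\neq\emptyset$. The follower's possible reactions to a feasible action $L$ are the $F\in\Omega(L)$ that maximize $d_b(L\cup F)$; an optimistic follower answers with a possible reaction $F_L$ that maximizes $c_s(L\cup F_L)$ among all possible reactions. The leader looks for a feasible action $L\subseteq V_\ell$ that maximizes $c_s(L\cup F_L)$. **Theorem.** On bipartite graphs this problem is solvable in polynomial time. Precisely, there are a random access program, whose only operations are reading and writing array cells at computed positions, addition, subtraction and comparison of natural numbers (used for counting and addressing, with truncated subtraction) and of weights, and a polynomial $p$ with the following properties. Given the number $n=|V|\ge 1$, the adjacency matrix of $G$ (but no bipartition of $G$), the set $V_\ell$,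 and the weights, for any bipartite $G$ with vertex set $\{0,\dots,n-1\}$, the program halts and outputs an optimal action $L$ of the leader, an optimistic reaction $F_L$ of the follower, and the optimal value $c_s(L\cup F_L)$; 1. for real weights it needs at most $p(n)$ elementary operations; 2. for rational weights its logarithmic cost, in which every operand and result is charged with its length in binary, is at most $p(N)$, where $N$ is the length of the instance in binary. -/

import Mathlib

/-! # The bilevel independent set problem -/

/-- An instance of Bilevel Independent Set with vertex set `V` and weights in `K`: a simple graph,
the set of vertices controlled by the leader (all other vertices are controlled by the follower),
and the nonnegative weight functions of the leader and of the follower. -/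
structure BISInstance (V K : Type) [LinearOrder K] [AddCommGroup K] where
  /-- the underlying simple graph -/
  graph : SimpleGraph V
  /-- the vertices controlled by the leader -/
  leaderVertices : Finset V
  /-- the weight function of the leader -/
  wLeader : V → K
  /-- the weight function of the follower -/
  wFollower : V → K
  wLeader_nonneg : ∀ v, 0 ≤ wLeader v
  wFollower_nonneg : ∀ v, 0 ≤ wFollower v

/-- The sum objective `∑ v ∈ S, w v`. -/
def sumObjective {V K : Type} [AddCommGroup K] (w : V → K) (S : Finset V) : K :=
  ∑ v ∈ S, w v

/-- The bottleneck objective `min v ∈ S, w v`; the minimum over the empty set is `∞`. -/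
def bottleneckObjective {V K : Type} [LinearOrder K] (w : V → K) (S : Finset V) : WithTop K :=
  S.inf (fun v => (w v : WithTop K))

namespace BISInstance

variable {V K : Type} [Fintype V] [DecidableEq V] [LinearOrder K] [AddCommGroup K]

/-- The vertices controlled by the follower. -/
def followerVertices (I : BISInstance V K) : Finset V :=
  I.leaderVerticesᶜ

/-- `F` is a suitable reaction of the follower to the action `L` of the leader: `L ∪ F` is a
nonempty independent set, where `L` consists of leader vertices and `F` of follower vertices. -/
def IsReaction (I : BISInstance V K) (L F : Finset V) : Prop :=
  L ⊆ I.leaderVertices ∧ F ⊆ I.followerVertices ∧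
    I.graph.IsIndepSet ((L ∪ F : Finset V) : Set V) ∧ (L ∪ F).Nonempty

/-- `F` is a possible reaction to `L`: among the suitable reactions to `L` it maximizes the
bottleneck objective of the follower. -/
def IsPossibleReaction (I : BISInstance V K) (L F : Finset V) : Prop :=
  I.IsReaction L F ∧ ∀ F', I.IsReaction L F' →
    bottleneckObjective I.wFollower (L ∪ F') ≤ bottleneckObjective I.wFollower (L ∪ F)

/-- `F` is an optimal reaction of the optimistic follower to `L`: among the possible reactions
to `L` it maximizes the sum objective of the leader. -/
def IsOptimisticReaction (I : BISInstance V K) (L F : Finset V) : Prop :=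
  I.IsPossibleReaction L F ∧ ∀ F', I.IsPossibleReaction L F' →
    sumObjective I.wLeader (L ∪ F') ≤ sumObjective I.wLeader (L ∪ F)

/-- `(L, F)` is an optimal solution of the bilevel problem with sum objective for the leader,
bottleneck objective for the optimistic follower: `F` is the follower's optimal reaction to `L`,
and no action of the leader, answered optimally by the follower, is better for the leader. -/
def IsOptimalSolution (I : BISInstance V K) (L F : Finset V) : Prop :=
  I.IsOptimisticReaction L F ∧ ∀ L' F', I.IsOptimisticReaction L' F' →
    sumObjective I.wLeader (L' ∪ F') ≤ sumObjective I.wLeader (L ∪ F)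

end BISInstance

/-! # Random access programs

Programs work on finitely many arrays of natural numbers (for counting and addressing) and on
finitely many arrays of numbers from an ordered group `K`. The only operations are reading and
writing array cells at computed positions, addition, subtraction and comparison. -/

namespace RandomAccess

/-- Expressions for natural numbers; `get a i` is the cell at position `i` of the natural number
array `a`, and `sub` is truncated subtraction. -/
inductive NatExpr where
  | const (c : ℕ)
  | get (a : ℕ) (i : NatExpr)
  | add (e f : NatExpr)
  | sub (e f : NatExpr)

/-- Expressions for elements of `K`; `get a i` is the cell at position `i` of the array `a` of
elements of `K`. -/
inductive NumExpr where
  | get (a : ℕ) (i : NatExpr)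
  | add (x y : NumExpr)
  | sub (x y : NumExpr)

/-- Tests: strict comparisons of natural numbers, of elements of `K`, and negations. -/
inductive Test where
  | natLt (e f : NatExpr)
  | numLt (x y : NumExpr)
  | neg (b : Test)

/-- Programs: assignments to array cells, sequences, case distinctions and `while` loops. -/
inductive Prog where
  | skip
  | setNat (a : ℕ) (i e : NatExpr)
  | setNum (a : ℕ) (i : NatExpr) (x : NumExpr)
  | seq (P Q : Prog)
  | branch (b : Test) (P Q : Prog)
  | loop (b : Test) (P : Prog)

/-- The contents of the memory: `nat a i` and `num a i` are the cells at position `i` of the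
arrays with name `a`. -/
structure Memory (K : Type) where
  /-- the arrays of natural numbers -/
  nat : ℕ → ℕ → ℕ
  /-- the arrays of elements of `K` -/
  num : ℕ → ℕ → K

/-- The price of handling a natural number and of handling an element of `K`. -/
structure CostModel (K : Type) where
  /-- price of handling a natural number -/
  natCost : ℕ → ℕ
  /-- price of handling an element of `K` -/
  numCost : K → ℕ

/-- The uniform cost model: every elementary operation has cost one. -/
def unitCost (K : Type) : CostModel K where
  natCost _ := 1
  numCost _ := 1

/-- The number of bits of the numerator and the denominator of a rational number. -/
def ratSize (q : ℚ) : ℕ :=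
  Nat.size q.num.natAbs + Nat.size q.den

/-- The logarithmic cost model over the rational numbers: every operand and every result is
charged with its length in binary. -/
def bitCost : CostModel ℚ where
  natCost m := Nat.size m + 1
  numCost q := ratSize q + 1

section Semantics

variable {K : Type} [LinearOrder K] [AddCommGroup K]

/-- The value of an expression. -/
def NatExpr.eval (s : Memory K) : NatExpr → ℕ
  | .const c => c
  | .get a i => s.nat a (i.eval s)
  | .add e f => e.eval s + f.eval s
  | .sub e f => e.eval s - f.eval s

/-- The value of an expression. -/
def NumExpr.eval (s : Memory K) : NumExpr → K
  | .get a i => s.num a (i.eval s)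
  | .add x y => x.eval s + y.eval s
  | .sub x y => x.eval s - y.eval s

/-- The truth of a test. -/
def Test.Holds (s : Memory K) : Test → Prop
  | .natLt e f => e.eval s < f.eval s
  | .numLt x y => x.eval s < y.eval s
  | .neg b => ¬ b.Holds s

/-- The cost of evaluating an expression: the values of all its subexpressions are charged. -/
def NatExpr.cost (c : CostModel K) (s : Memory K) : NatExpr → ℕ
  | .const m => c.natCost m
  | .get a i => i.cost c s + c.natCost (s.nat a (i.eval s))
  | .add e f => e.cost c s + f.cost c s + c.natCost (e.eval s + f.eval s)
  | .sub e f => e.cost c s + f.cost c s + c.natCost (e.eval s - f.eval s)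

/-- The cost of evaluating an expression: the values of all its subexpressions are charged. -/
def NumExpr.cost (c : CostModel K) (s : Memory K) : NumExpr → ℕ
  | .get a i => i.cost c s + c.numCost (s.num a (i.eval s))
  | .add x y => x.cost c s + y.cost c s + c.numCost (x.eval s + y.eval s)
  | .sub x y => x.cost c s + y.cost c s + c.numCost (x.eval s - y.eval s)

/-- The cost of evaluating a test. -/
def Test.cost (c : CostModel K) (s : Memory K) : Test → ℕ
  | .natLt e f => e.cost c s + f.cost c s + 1
  | .numLt x y => x.cost c s + y.cost c s + 1
  | .neg b => b.cost c s + 1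

/-- The memory after writing `m` into the cell at position `i` of the natural number array `a`. -/
def Memory.writeNat (s : Memory K) (a i m : ℕ) : Memory K where
  nat := Function.update s.nat a (Function.update (s.nat a) i m)
  num := s.num

/-- The memory after writing `x` into the cell at position `i` of the array `a` of elements
of `K`. -/
def Memory.writeNum (s : Memory K) (a i : ℕ) (x : K) : Memory K where
  nat := s.nat
  num := Function.update s.num a (Function.update (s.num a) i x)

/-- `Run c P s s' t` says that the program `P`, started with memory contents `s`, halts with memory
contents `s'`, and that the cost of this computation is `t`. -/
inductive Run (c : CostModel K) : Prog → Memory K → Memory K → ℕ → Prop where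
  | skip (s : Memory K) : Run c .skip s s 1
  | setNat (a : ℕ) (i e : NatExpr) (s : Memory K) :
      Run c (.setNat a i e) s (s.writeNat a (i.eval s) (e.eval s)) (i.cost c s + e.cost c s + 1)
  | setNum (a : ℕ) (i : NatExpr) (x : NumExpr) (s : Memory K) :
      Run c (.setNum a i x) s (s.writeNum a (i.eval s) (x.eval s)) (i.cost c s + x.cost c s + 1)
  | seq {P Q : Prog} {s s₁ s₂ : Memory K} {t₁ t₂ : ℕ} :
      Run c P s s₁ t₁ → Run c Q s₁ s₂ t₂ → Run c (.seq P Q) s s₂ (t₁ + t₂ + 1)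
  | branch_true {b : Test} {P Q : Prog} {s s₁ : Memory K} {t : ℕ} :
      b.Holds s → Run c P s s₁ t → Run c (.branch b P Q) s s₁ (b.cost c s + t + 1)
  | branch_false {b : Test} {P Q : Prog} {s s₁ : Memory K} {t : ℕ} :
      ¬ b.Holds s → Run c Q s s₁ t → Run c (.branch b P Q) s s₁ (b.cost c s + t + 1)
  | loop_true {b : Test} {P : Prog} {s s₁ s₂ : Memory K} {t₁ t₂ : ℕ} :
      b.Holds s → Run c P s s₁ t₁ → Run c (.loop b P) s₁ s₂ t₂ →
        Run c (.loop b P) s s₂ (b.cost c s + t₁ + t₂ + 1)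
  | loop_false {b : Test} {P : Prog} {s : Memory K} :
      ¬ b.Holds s → Run c (.loop b P) s s (b.cost c s + 1)

/-- Computations are deterministic: the result and the cost are determined by the program and the
initial memory contents. -/
theorem Run.deterministic {c : CostModel K} {P : Prog} {s s₁ s₂ : Memory K} {t₁ t₂ : ℕ}
    (h₁ : Run c P s s₁ t₁) (h₂ : Run c P s s₂ t₂) : s₁ = s₂ ∧ t₁ = t₂ := by
  induction h₁ generalizing s₂ t₂ with
  | skip s => cases h₂; exact ⟨rfl, rfl⟩
  | setNat a i e s => cases h₂; exact ⟨rfl, rfl⟩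
  | setNum a i x s => cases h₂; exact ⟨rfl, rfl⟩
  | seq _ _ ihP ihQ =>
    cases h₂ with
    | seq hP hQ =>
      obtain ⟨rfl, rfl⟩ := ihP hP
      obtain ⟨rfl, rfl⟩ := ihQ hQ
      exact ⟨rfl, rfl⟩
  | branch_true hb _ ih =>
    cases h₂ with
    | branch_true _ h => obtain ⟨rfl, rfl⟩ := ih h; exact ⟨rfl, rfl⟩
    | branch_false hb' _ => exact absurd hb hb'
  | branch_false hb _ ih =>
    cases h₂ with
    | branch_true hb' _ => exact absurd hb' hb
    | branch_false _ h => obtain ⟨rfl, rfl⟩ := ih h; exact ⟨rfl, rfl⟩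
  | loop_true hb _ _ ihP ihL =>
    cases h₂ with
    | loop_true _ hP hL =>
      obtain ⟨rfl, rfl⟩ := ihP hP
      obtain ⟨rfl, rfl⟩ := ihL hL
      exact ⟨rfl, rfl⟩
    | loop_false hb' => exact absurd hb hb'
  | loop_false hb =>
    cases h₂ with
    | loop_true hb' _ _ => exact absurd hb' hb
    | loop_false _ => exact ⟨rfl, rfl⟩

end Semantics

end RandomAccess

/-! # Input, output and size of instances -/

namespace BISInstance

open RandomAccess

section InputOutput

variable {n : ℕ} {K : Type} [LinearOrder K] [AddCommGroup K]

open Classical in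
/-- The initial memory contents for an instance with vertex set `{0, …, n - 1}`. The natural number
array `0` holds `n` at position `0`, array `1` holds the adjacency matrix row by row, array `2`
holds the indicator function of the set of leader vertices. The arrays `0` and `1` of elements of
`K` hold the weights of the leader and of the follower. All other cells hold zero. -/
noncomputable def initialMemory (I : BISInstance (Fin n) K) : Memory K where
  nat a i :=
    if a = 0 then (if i = 0 then n else 0)
    else if a = 1 then (if ∃ u v : Fin n, I.graph.Adj u v ∧ i = u * n + v then 1 else 0)
    else if a = 2 then (if ∃ v ∈ I.leaderVertices, i = (v : ℕ) then 1 else 0)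
    else 0
  num a i :=
    if h : i < n then
      (if a = 0 then I.wLeader ⟨i, h⟩ else if a = 1 then I.wFollower ⟨i, h⟩ else 0)
    else 0

/-- The final memory contents `s` describe an optimal solution of `I`: the natural number arrays
`3` and `4` hold the indicator functions of the action `L` of the leader and of the reaction `F` of
the follower, and the array `2` of elements of `K` holds the optimal value at position `0`. -/
def IsSolvedBy (I : BISInstance (Fin n) K) (s : Memory K) : Prop :=
  ∃ L F : Finset (Fin n), I.IsOptimalSolution L F ∧
    (∀ v : Fin n, s.nat 3 v = if v ∈ L then 1 else 0) ∧
    (∀ v : Fin n, s.nat 4 v = if v ∈ F then 1 else 0) ∧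
    s.num 2 0 = sumObjective I.wLeader (L ∪ F)

end InputOutput

/-- The length of an instance with rational weights in binary. -/
def bitSize {n : ℕ} (I : BISInstance (Fin n) ℚ) : ℕ :=
  n * n + n + ∑ v, (ratSize (I.wLeader v) + ratSize (I.wFollower v))

end BISInstance

/-! The bilevel problem becomes a one-level problem once a vertex `u` of minimum follower weight in
`S = L ∪ F` is guessed. If `L` is nonempty, the reaction `∅` is available, so the best bottleneck is
the minimum over `L`, and the possible reactions are those that do not go below it. If `L` is empty,
the follower may take single vertices, so a possible reaction consists of follower vertices of
maximum follower weight. Hence the unions `L ∪ F` with a possible reaction `F` are exactly the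
independent sets that contain a valid minimum `u` and lie in an explicit set of allowed vertices
(`IsCandidate.isPossibleReaction`, `IsPossibleReaction.exists_isCandidate`). The follower is
optimistic, so it remains to maximize the leader's weight over these sets. Since allowed vertices
are not adjacent to `u`, this is one maximum weight independent set problem in an induced bipartite
subgraph for each `u`.

No bipartition is given, so the network for this problem is built on the bipartite double cover. Its
relevant cuts are pairs `T₁`, `T₂` without edges between them. If the graph is bipartite, the
maximum of the joint weight of such a pair is twice the maximum weight of an independent set
(`sum_add_sum_le`, `sum_sub_excess`). A maximum set itself is obtained by deleting vertices as long
as this maximum does not drop (`RemoveInvariant`).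

The maximum flow comes from a preflow push method with supplies in place of a source, which only
adds, subtracts and compares. Each round of pushing and relabelling raises the sum of the labels
unless no node is active any more, so `N * D` rounds suffice; an unused label then exhibits a
minimum cut (`IsPreflow.exists_cut`).

All loops have bounds linear in `n`, so the number of steps is polynomial (`Cmd.exists_run`). One
unit of cost at most doubles the numbers, and all rational numbers keep one common denominator, so
the operands have polynomial length and the logarithmic cost is polynomial as well
(`Run.exists_bitCost`). -/

namespace RandomAccess

/-! # Unit cost computations have small logarithmic cost -/

/-- The sum of all constants in an expression. -/
def NatExpr.consts : NatExpr → ℕ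
  | .const c => c
  | .get _ i => i.consts
  | .add e f => e.consts + f.consts
  | .sub e f => e.consts + f.consts

/-- The sum of all constants in an expression. -/
def NumExpr.consts : NumExpr → ℕ
  | .get _ i => i.consts
  | .add x y => x.consts + y.consts
  | .sub x y => x.consts + y.consts

/-- The sum of all constants in a test. -/
def Test.consts : Test → ℕ
  | .natLt e f => e.consts + f.consts
  | .numLt x y => x.consts + y.consts
  | .neg b => b.consts

/-- The sum of all constants in a program. -/
def Prog.consts : Prog → ℕ
  | .skip => 0
  | .setNat _ i e => i.consts + e.consts
  | .setNum _ i x => i.consts + x.consts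
  | .seq P Q => P.consts + Q.consts
  | .branch b P Q => b.consts + P.consts + Q.consts
  | .loop b P => b.consts + P.consts

/-- `x` is a fraction with denominator `d` and a numerator of absolute value at most `m`. -/
def IsFractionLe (d m : ℕ) (x : ℚ) : Prop :=
  ∃ z : ℤ, x * d = z ∧ z.natAbs ≤ m

theorem IsFractionLe.mono {d m m' : ℕ} {x : ℚ} (h : IsFractionLe d m x) (hm : m ≤ m') :
    IsFractionLe d m' x :=
  let ⟨z, h1, h2⟩ := h
  ⟨z, h1, h2.trans hm⟩

theorem IsFractionLe.add {d m m' : ℕ} {x y : ℚ} (hx : IsFractionLe d m x)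
    (hy : IsFractionLe d m' y) : IsFractionLe d (m + m') (x + y) := by
  obtain ⟨z, h1, h2⟩ := hx
  obtain ⟨z', h1', h2'⟩ := hy
  refine ⟨z + z', by push_cast; rw [add_mul, h1, h1'], by omega⟩

theorem IsFractionLe.sub {d m m' : ℕ} {x y : ℚ} (hx : IsFractionLe d m x)
    (hy : IsFractionLe d m' y) : IsFractionLe d (m + m') (x - y) := by
  obtain ⟨z, h1, h2⟩ := hx
  obtain ⟨z', h1', h2'⟩ := hy
  refine ⟨z - z', by push_cast; rw [sub_mul, h1, h1'], by omega⟩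

/-- In lowest terms the denominator divides `d` and the numerator divides `z`, so reducing the
fraction does not make it longer. The extra `1` is there because `2 ^ k` itself has `k + 1` bits. -/
theorem IsFractionLe.ratSize_le {d k : ℕ} {x : ℚ} (hd : 0 < d) (h : IsFractionLe d (2 ^ k) x) :
    ratSize x ≤ k + 1 + Nat.size d := by
  obtain ⟨z, h1, h2⟩ := h
  have hd' : (d : ℚ) ≠ 0 := by positivity
  have hx : x = (z : ℚ) / ((d : ℤ) : ℚ) := by
    rw [eq_div_iff (by exact_mod_cast hd')]
    exact_mod_cast h1
  have hden : x.den ≤ d := by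
    have : (x.den : ℤ) ∣ (d : ℤ) := by
      rw [hx, ← Rat.divInt_eq_div]
      exact Rat.den_dvd z d
    exact Nat.le_of_dvd hd (by exact_mod_cast this)
  have hnum : x.num.natAbs ≤ z.natAbs := by
    -- Divisibility bounds the size of the numerator only if `z` is nonzero.
    rcases eq_or_ne z 0 with rfl | hz
    · simp [hx]
    · refine Nat.le_of_dvd (by omega) ?_
      rw [Int.natAbs_dvd_natAbs, hx, ← Rat.divInt_eq_div]
      exact Rat.num_dvd z (Int.natCast_ne_zero.2 hd.ne')
  unfold ratSize
  have h3 : Nat.size x.num.natAbs ≤ k + 1 := by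
    rw [Nat.size_le]
    calc x.num.natAbs ≤ 2 ^ k := hnum.trans h2
      _ < 2 ^ (k + 1) := Nat.pow_lt_pow_right (by norm_num) (by omega)
  have h4 : Nat.size x.den ≤ Nat.size d := Nat.size_le_size hden
  omega

/-- All natural numbers in the memory are at most `2 ^ b`, all rational numbers are fractions with
denominator `d` and numerators of absolute value at most `2 ^ b`. -/
structure Memory.IsBounded (d b : ℕ) (s : Memory ℚ) : Prop where
  nat_le : ∀ a i, s.nat a i ≤ 2 ^ b
  num_le : ∀ a i, IsFractionLe d (2 ^ b) (s.num a i)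

theorem Memory.IsBounded.mono {d b b' : ℕ} {s : Memory ℚ} (h : s.IsBounded d b) (hb : b ≤ b') :
    s.IsBounded d b' :=
  ⟨fun a i => (h.nat_le a i).trans (Nat.pow_le_pow_right (by norm_num) hb),
    fun a i => (h.num_le a i).mono (Nat.pow_le_pow_right (by norm_num) hb)⟩

/-- Here `k` and `l` are the costs of two operands. The cost `1` of the addition pays for the
doubling. -/
theorem two_pow_add_two_pow_le (b k l : ℕ) :
    2 ^ (b + k) + 2 ^ (b + l) ≤ 2 ^ (b + (k + l + 1)) := by
  have h1 : 2 ^ (b + k) ≤ 2 ^ (b + k + l) := Nat.pow_le_pow_right (by norm_num) (by omega)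
  have h2 : 2 ^ (b + l) ≤ 2 ^ (b + k + l) := Nat.pow_le_pow_right (by norm_num) (by omega)
  have h3 : 2 ^ (b + (k + l + 1)) = 2 * 2 ^ (b + k + l) := by
    rw [← add_assoc, pow_succ, ← add_assoc]; ring
  omega

/-- Cells are bounded by `2 ^ b`, and each addition, at cost one, at most doubles the larger
operand. The hypothesis on the constants enters through `c ≤ b < 2 ^ b`. -/
theorem NatExpr.eval_le {d b : ℕ} {s : Memory ℚ} (hs : s.IsBounded d b) (e : NatExpr)
    (he : e.consts ≤ b) : e.eval s ≤ 2 ^ (b + e.cost (unitCost ℚ) s) := by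
  induction e with
  | const c =>
    simp only [NatExpr.consts] at he
    simp only [NatExpr.eval]
    have h1 : b < 2 ^ b := Nat.lt_two_pow_self
    have h2 : 2 ^ b ≤ 2 ^ (b + (NatExpr.const c).cost (unitCost ℚ) s) :=
      Nat.pow_le_pow_right (by norm_num) (by omega)
    omega
  | get a i ih =>
    exact (hs.nat_le a _).trans (Nat.pow_le_pow_right (by norm_num) (by omega))
  | add e f ihe ihf =>
    simp only [NatExpr.consts] at he
    have h := two_pow_add_two_pow_le b (e.cost (unitCost ℚ) s) (f.cost (unitCost ℚ) s)
    have h1 := ihe (by omega)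
    have h2 := ihf (by omega)
    simp only [NatExpr.eval, NatExpr.cost, unitCost] at *
    omega
  | sub e f ihe ihf =>
    simp only [NatExpr.consts] at he
    have h := two_pow_add_two_pow_le b (e.cost (unitCost ℚ) s) (f.cost (unitCost ℚ) s)
    have h1 := ihe (by omega)
    have h2 := ihf (by omega)
    simp only [NatExpr.eval, NatExpr.cost, unitCost] at *
    omega

/-- Over a common denominator, addition and subtraction act on the numerators alone, so the
denominator never grows. -/
theorem NumExpr.eval_isFractionLe {d b : ℕ} {s : Memory ℚ} (hs : s.IsBounded d b) (x : NumExpr) :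
    IsFractionLe d (2 ^ (b + x.cost (unitCost ℚ) s)) (x.eval s) := by
  induction x with
  | get a i =>
    exact (hs.num_le a _).mono (Nat.pow_le_pow_right (by norm_num) (by omega))
  | add x y ihx ihy => exact (ihx.add ihy).mono (two_pow_add_two_pow_le _ _ _)
  | sub x y ihx ihy => exact (ihx.sub ihy).mono (two_pow_add_two_pow_le _ _ _)

theorem natSize_le_of_le_two_pow {m k : ℕ} (h : m ≤ 2 ^ k) : Nat.size m ≤ k + 1 := by
  rw [Nat.size_le]
  exact h.trans_lt (Nat.pow_lt_pow_right (by norm_num) (by omega))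

/-- Every charged value has at most `B + 1` bits and thus price at most `B + 2`. The summand
`d.size` is slack here; it makes the factor agree with the one for rational numbers. -/
theorem NatExpr.bitCost_le {d b B : ℕ} {s : Memory ℚ} (hs : s.IsBounded d b) (e : NatExpr)
    (he : e.consts ≤ b) (hB : b + e.cost (unitCost ℚ) s ≤ B) :
    e.cost bitCost s ≤ e.cost (unitCost ℚ) s * (B + d.size + 2) := by
  have hv : Nat.size (e.eval s) ≤ B + 1 :=
    (natSize_le_of_le_two_pow (e.eval_le hs he)).trans (by omega)
  induction e with
  | const c => simp only [NatExpr.cost, NatExpr.eval, unitCost, bitCost] at *; omega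
  | get a i ih =>
    simp only [NatExpr.cost, NatExpr.eval, NatExpr.consts, unitCost, bitCost] at *
    have := ih he (by omega) ((natSize_le_of_le_two_pow (i.eval_le hs he)).trans
      (by simp only [unitCost]; omega))
    rw [add_mul]
    omega
  | add e f ihe ihf =>
    simp only [NatExpr.cost, NatExpr.eval, NatExpr.consts, unitCost, bitCost] at *
    have h1 := ihe (by omega) (by omega)
      ((natSize_le_of_le_two_pow (e.eval_le hs (by omega))).trans (by simp only [unitCost]; omega))
    have h2 := ihf (by omega) (by omega)
      ((natSize_le_of_le_two_pow (f.eval_le hs (by omega))).trans (by simp only [unitCost]; omega))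
    rw [add_mul, add_mul]
    omega
  | sub e f ihe ihf =>
    simp only [NatExpr.cost, NatExpr.eval, NatExpr.consts, unitCost, bitCost] at *
    have h1 := ihe (by omega) (by omega)
      ((natSize_le_of_le_two_pow (e.eval_le hs (by omega))).trans (by simp only [unitCost]; omega))
    have h2 := ihf (by omega) (by omega)
      ((natSize_le_of_le_two_pow (f.eval_le hs (by omega))).trans (by simp only [unitCost]; omega))
    rw [add_mul, add_mul]
    omega

theorem NumExpr.bitCost_le {d b B : ℕ} {s : Memory ℚ} (hd : 0 < d) (hs : s.IsBounded d b)
    (x : NumExpr) (hx : x.consts ≤ b) (hB : b + x.cost (unitCost ℚ) s ≤ B) :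
    x.cost bitCost s ≤ x.cost (unitCost ℚ) s * (B + d.size + 2) := by
  have hv : ratSize (x.eval s) ≤ B + 1 + d.size :=
    ((x.eval_isFractionLe hs).ratSize_le hd).trans (by omega)
  induction x with
  | get a i =>
    have h := i.bitCost_le (B := B) hs hx (by
      simp only [NumExpr.cost] at hB
      omega)
    simp only [NumExpr.cost, NumExpr.eval, unitCost, bitCost] at *
    rw [add_mul]
    omega
  | add e f ihe ihf =>
    simp only [NumExpr.cost, NumExpr.eval, NumExpr.consts, unitCost, bitCost] at *
    have h1 := ihe (by omega) (by omega)
      (((e.eval_isFractionLe hs).ratSize_le hd).trans (by simp only [unitCost]; omega))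
    have h2 := ihf (by omega) (by omega)
      (((f.eval_isFractionLe hs).ratSize_le hd).trans (by simp only [unitCost]; omega))
    rw [add_mul, add_mul]
    omega
  | sub e f ihe ihf =>
    simp only [NumExpr.cost, NumExpr.eval, NumExpr.consts, unitCost, bitCost] at *
    have h1 := ihe (by omega) (by omega)
      (((e.eval_isFractionLe hs).ratSize_le hd).trans (by simp only [unitCost]; omega))
    have h2 := ihf (by omega) (by omega)
      (((f.eval_isFractionLe hs).ratSize_le hd).trans (by simp only [unitCost]; omega))
    rw [add_mul, add_mul]
    omega

theorem Test.bitCost_le {d b B : ℕ} {s : Memory ℚ} (hd : 0 < d) (hs : s.IsBounded d b)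
    (c : Test) (hc : c.consts ≤ b) (hB : b + c.cost (unitCost ℚ) s ≤ B) :
    c.cost bitCost s ≤ c.cost (unitCost ℚ) s * (B + d.size + 2) := by
  induction c with
  | natLt e f =>
    simp only [Test.consts, Test.cost] at *
    have h1 := e.bitCost_le (B := B) hs (by omega) (by omega)
    have h2 := f.bitCost_le (B := B) hs (by omega) (by omega)
    rw [add_mul, add_mul]
    omega
  | numLt x y =>
    simp only [Test.consts, Test.cost] at *
    have h1 := x.bitCost_le (B := B) hd hs (by omega) (by omega)
    have h2 := y.bitCost_le (B := B) hd hs (by omega) (by omega)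
    rw [add_mul, add_mul]
    omega
  | neg c ih =>
    simp only [Test.consts, Test.cost] at *
    have h1 := ih hc (by omega)
    rw [add_mul]
    omega

theorem Memory.IsBounded.writeNat {d b : ℕ} {s : Memory ℚ} (hs : s.IsBounded d b) {a i m : ℕ}
    (hm : m ≤ 2 ^ b) : (s.writeNat a i m).IsBounded d b := by
  refine ⟨fun a' i' => ?_, hs.num_le⟩
  simp only [Memory.writeNat, Function.update_apply]
  split_ifs
  · simp only [Function.update_apply]
    split_ifs
    · exact hm
    · exact hs.nat_le _ _
  · exact hs.nat_le _ _

theorem Memory.IsBounded.writeNum {d b : ℕ} {s : Memory ℚ} (hs : s.IsBounded d b) {a i : ℕ}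
    {x : ℚ} (hx : IsFractionLe d (2 ^ b) x) : (s.writeNum a i x).IsBounded d b := by
  refine ⟨hs.nat_le, fun a' i' => ?_⟩
  simp only [Memory.writeNum, Function.update_apply]
  split_ifs
  · simp only [Function.update_apply]
    split_ifs
    · exact hx
    · exact hs.num_le _ _
  · exact hs.num_le _ _

/-- Numbers at most double in each step, hence the logarithmic cost of a computation is bounded by
a polynomial in its number of steps and in the size of the initial memory contents. -/
theorem Run.exists_bitCost {d : ℕ} (hd : 0 < d) {P : Prog} {s s' : Memory ℚ} {t : ℕ}
    (h : Run (unitCost ℚ) P s s' t) {b : ℕ} (hP : P.consts ≤ b) (hs : s.IsBounded d b) :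
    s'.IsBounded d (b + t) ∧ ∀ B, b + t ≤ B →
      ∃ t', Run bitCost P s s' t' ∧ t' ≤ t * (B + d.size + 2) := by
  -- The bound `b` varies because the second part of a sequence starts from a memory bounded by `b +
  -- t₁`. In contrast `B` bounds the whole computation, so that a single factor serves all steps.
  induction h generalizing b with
  | skip s => exact ⟨hs.mono (by omega), fun B hB => ⟨1, .skip s, by omega⟩⟩
  | setNat a i e s =>
    simp only [Prog.consts] at hP
    refine ⟨(hs.mono (by omega)).writeNat ((e.eval_le hs (by omega)).trans
      (Nat.pow_le_pow_right (by norm_num) (by omega))), fun B hB => ⟨_, .setNat a i e s, ?_⟩⟩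
    have h1 := i.bitCost_le (B := B) hs (by omega) (by omega)
    have h2 := e.bitCost_le (B := B) hs (by omega) (by omega)
    rw [add_mul, add_mul]
    omega
  | setNum a i x s =>
    simp only [Prog.consts] at hP
    refine ⟨(hs.mono (by omega)).writeNum ((x.eval_isFractionLe hs).mono
      (Nat.pow_le_pow_right (by norm_num) (by omega))), fun B hB => ⟨_, .setNum a i x s, ?_⟩⟩
    have h1 := i.bitCost_le (B := B) hs (by omega) (by omega)
    have h2 := x.bitCost_le (B := B) hd hs (by omega) (by omega)
    rw [add_mul, add_mul]
    omega
  | @seq P Q s s₁ s₂ t₁ t₂ _ _ ihP ihQ =>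
    simp only [Prog.consts] at hP
    obtain ⟨hb1, h1⟩ := ihP (by omega) hs
    obtain ⟨hb2, h2⟩ := ihQ (by omega) hb1
    refine ⟨hb2.mono (by omega), fun B hB => ?_⟩
    obtain ⟨u1, r1, l1⟩ := h1 B (by omega)
    obtain ⟨u2, r2, l2⟩ := h2 B (by omega)
    refine ⟨_, .seq r1 r2, ?_⟩
    rw [add_mul, add_mul]
    omega
  | @branch_true c P Q s s₁ t hc _ ih =>
    simp only [Prog.consts] at hP
    obtain ⟨hb1, h1⟩ := ih (by omega) hs
    refine ⟨hb1.mono (by omega), fun B hB => ?_⟩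
    obtain ⟨u1, r1, l1⟩ := h1 B (by omega)
    have h2 := c.bitCost_le (B := B) hd hs (by omega) (by omega)
    refine ⟨_, .branch_true hc r1, ?_⟩
    rw [add_mul, add_mul]
    omega
  | @branch_false c P Q s s₁ t hc _ ih =>
    simp only [Prog.consts] at hP
    obtain ⟨hb1, h1⟩ := ih (by omega) hs
    refine ⟨hb1.mono (by omega), fun B hB => ?_⟩
    obtain ⟨u1, r1, l1⟩ := h1 B (by omega)
    have h2 := c.bitCost_le (B := B) hd hs (by omega) (by omega)
    refine ⟨_, .branch_false hc r1, ?_⟩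
    rw [add_mul, add_mul]
    omega
  | @loop_true c P s s₁ s₂ t₁ t₂ hc _ _ ihP ihL =>
    have hP' := hP
    simp only [Prog.consts] at hP
    obtain ⟨hb1, h1⟩ := ihP (by omega) hs
    obtain ⟨hb2, h2⟩ := ihL (by omega) hb1
    refine ⟨hb2.mono (by omega), fun B hB => ?_⟩
    obtain ⟨u1, r1, l1⟩ := h1 B (by omega)
    obtain ⟨u2, r2, l2⟩ := h2 B (by omega)
    have h3 := c.bitCost_le (B := B) hd hs (by omega) (by omega)
    refine ⟨_, .loop_true hc r1 r2, ?_⟩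
    rw [add_mul, add_mul, add_mul]
    omega
  | @loop_false c P s hc =>
    simp only [Prog.consts] at hP
    refine ⟨hs.mono (by omega), fun B hB => ⟨_, .loop_false hc, ?_⟩⟩
    have h3 := c.bitCost_le (B := B) hd hs (by omega) (by omega)
    rw [add_mul]
    omega

end RandomAccess

/-! ### Size of the initial memory and the polynomial bound for the logarithmic cost. -/

namespace BISInstance

open RandomAccess

variable {n : ℕ}

/-- The product of all denominators of the weights. -/
def commonDen (I : BISInstance (Fin n) ℚ) : ℕ :=
  ∏ v, ((I.wLeader v).den * (I.wFollower v).den)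

theorem commonDen_pos (I : BISInstance (Fin n) ℚ) : 0 < I.commonDen :=
  Finset.prod_pos fun v _ => Nat.mul_pos (I.wLeader v).den_pos (I.wFollower v).den_pos

theorem prod_le_two_pow_sum {ι : Type*} (s : Finset ι) (f g : ι → ℕ)
    (h : ∀ i ∈ s, f i ≤ 2 ^ g i) : ∏ i ∈ s, f i ≤ 2 ^ ∑ i ∈ s, g i := by
  rw [← Finset.prod_pow_eq_pow_sum]
  exact Finset.prod_le_prod' h

theorem commonDen_le (I : BISInstance (Fin n) ℚ) : I.commonDen ≤ 2 ^ I.bitSize := by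
  refine (prod_le_two_pow_sum _ _ (fun v => ratSize (I.wLeader v) + ratSize (I.wFollower v))
    fun v _ => ?_).trans (Nat.pow_le_pow_right (by norm_num) (by unfold bitSize; omega))
  rw [pow_add]
  refine Nat.mul_le_mul ?_ ?_
  · exact (Nat.lt_size_self _).le.trans
      (Nat.pow_le_pow_right (by norm_num) (by unfold ratSize; omega))
  · exact (Nat.lt_size_self _).le.trans
      (Nat.pow_le_pow_right (by norm_num) (by unfold ratSize; omega))

/-- The numerator over `d` is the reduced numerator, of at most `N` bits, times the cofactor of the
denominator in `d`, which is at most `2 ^ k`. -/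
theorem isFractionLe_of_den_dvd {d k N : ℕ} {x : ℚ} (hd : d ≤ 2 ^ k) (hx : x.den ∣ d)
    (hN : ratSize x ≤ N) : IsFractionLe d (2 ^ (N + k)) x := by
  obtain ⟨m, rfl⟩ := hx
  refine ⟨x.num * m, ?_, ?_⟩
  · push_cast
    rw [← mul_assoc, Rat.mul_den_eq_num]
  · rw [Int.natAbs_mul, Int.natAbs_natCast, pow_add]
    refine Nat.mul_le_mul ?_ ?_
    · exact (Nat.lt_size_self _).le.trans
        (Nat.pow_le_pow_right (by norm_num) (by unfold ratSize at hN; omega))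
    · exact (Nat.le_mul_of_pos_left m x.den_pos).trans hd

/-- One `bitSize` accounts for the reduced numerators, the other one for expanding the fractions to
the common denominator. -/
theorem isBounded_initialMemory (I : BISInstance (Fin n) ℚ) :
    I.initialMemory.IsBounded I.commonDen (2 * I.bitSize) := by
  have hsum : ∀ v, ratSize (I.wLeader v) + ratSize (I.wFollower v) ≤ I.bitSize := fun v =>
    (Finset.single_le_sum (f := fun v => ratSize (I.wLeader v) + ratSize (I.wFollower v))
      (fun _ _ => Nat.zero_le _) (Finset.mem_univ v)).trans (by unfold bitSize; omega)
  have hden : ∀ v, (I.wLeader v).den * (I.wFollower v).den ∣ I.commonDen := fun v =>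
    Finset.dvd_prod_of_mem (fun v => (I.wLeader v).den * (I.wFollower v).den) (Finset.mem_univ v)
  refine ⟨fun a i => ?_, fun a i => ?_⟩
  · have h1 : 1 ≤ 2 ^ (2 * I.bitSize) := Nat.one_le_two_pow
    have h2 : n ≤ 2 ^ (2 * I.bitSize) := by
      have h3 : 2 * I.bitSize < 2 ^ (2 * I.bitSize) := Nat.lt_two_pow_self
      have h4 : n ≤ I.bitSize := by unfold bitSize; omega
      omega
    simp only [initialMemory]
    split_ifs <;> omega
  · have h0 : IsFractionLe I.commonDen (2 ^ (2 * I.bitSize)) 0 := ⟨0, by simp, by simp⟩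
    rw [two_mul] at *
    simp only [initialMemory]
    split_ifs
    · exact isFractionLe_of_den_dvd I.commonDen_le ((Dvd.intro _ rfl).trans (hden _))
        ((Nat.le_add_right _ _).trans (hsum _))
    · exact isFractionLe_of_den_dvd I.commonDen_le ((Dvd.intro_left _ rfl).trans (hden _))
        ((Nat.le_add_left _ _).trans (hsum _))
    · exact h0
    · exact h0

theorem polynomial_eval_mono (p : Polynomial ℕ) {m k : ℕ} (h : m ≤ k) : p.eval m ≤ p.eval k := by
  rw [Polynomial.eval_eq_sum_range, Polynomial.eval_eq_sum_range]
  gcongr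

/-- The polynomial bound for the logarithmic cost of a program whose number of steps is bounded
by `p`. -/
noncomputable def bitCostBound (P : Prog) (p : Polynomial ℕ) : Polynomial ℕ :=
  -- The second factor bounds `B + d.size + 2`: here `B` is `2 * bitSize + consts` plus the number
  -- of steps, and the common denominator has at most `bitSize + 1` bits.
  p * (3 * Polynomial.X + Polynomial.C P.consts + p + 3)

theorem exists_bitCost_run {P : Prog} {p : Polynomial ℕ} (I : BISInstance (Fin n) ℚ)
    {s : Memory ℚ} {t : ℕ} (h : Run (unitCost ℚ) P I.initialMemory s t) (ht : t ≤ p.eval n) :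
    ∃ t', Run bitCost P I.initialMemory s t' ∧ t' ≤ (bitCostBound P p).eval I.bitSize := by
  have hp : p.eval n ≤ p.eval I.bitSize :=
    polynomial_eval_mono p (by unfold bitSize; omega)
  obtain ⟨-, h2⟩ := h.exists_bitCost I.commonDen_pos (b := 2 * I.bitSize + P.consts) (by omega)
    (I.isBounded_initialMemory.mono (by omega))
  obtain ⟨t', hr, ht'⟩ := h2 _ le_rfl
  refine ⟨t', hr, ht'.trans ?_⟩
  have hsz : I.commonDen.size ≤ I.bitSize + 1 := natSize_le_of_le_two_pow I.commonDen_le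
  simp only [bitCostBound, Polynomial.eval_mul, Polynomial.eval_add, Polynomial.eval_X,
    Polynomial.eval_C, Polynomial.eval_ofNat]
  exact Nat.mul_le_mul (by omega) (by omega)

end BISInstance

namespace RandomAccess

/-! # A structured language with bounded loops -/

/-- Structured programs. In `forLoop a b C` the cell at position `0` of the natural number array
`a` counts the rounds, and the cell at position `0` of array `b` is the number of rounds. -/
inductive Cmd where
  | skip
  | setNat (a : ℕ) (i e : NatExpr)
  | setNum (a : ℕ) (i : NatExpr) (x : NumExpr)
  | seq (C₁ C₂ : Cmd)
  | branch (b : Test) (C₁ C₂ : Cmd)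
  | forLoop (a b : ℕ) (C : Cmd)

namespace Cmd

/-- The cell at position `0` of the natural number array `a`. -/
abbrev cell (a : ℕ) : NatExpr :=
  .get a (.const 0)

/-- The translation of structured programs into programs. -/
def compile : Cmd → Prog
  | skip => .skip
  | setNat a i e => .setNat a i e
  | setNum a i x => .setNum a i x
  | seq C₁ C₂ => .seq C₁.compile C₂.compile
  | branch b C₁ C₂ => .branch b C₁.compile C₂.compile
  | forLoop a b C => .seq (.setNat a (.const 0) (.const 0))
      (.loop (.natLt (cell a) (cell b))
        (.seq C.compile (.setNat a (.const 0) (.add (cell a) (.const 1)))))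

/-- The natural number arrays a structured program writes to. -/
def natWrites : Cmd → List ℕ
  | skip => []
  | setNat a _ _ => [a]
  | setNum _ _ _ => []
  | seq C₁ C₂ => C₁.natWrites ++ C₂.natWrites
  | branch _ C₁ C₂ => C₁.natWrites ++ C₂.natWrites
  | forLoop a _ C => a :: C.natWrites

/-- The arrays of elements of `K` a structured program writes to. -/
def numWrites : Cmd → List ℕ
  | skip => []
  | setNat _ _ _ => []
  | setNum a _ _ => [a]
  | seq C₁ C₂ => C₁.numWrites ++ C₂.numWrites
  | branch _ C₁ C₂ => C₁.numWrites ++ C₂.numWrites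
  | forLoop _ _ C => C.numWrites

/-- The loop bounds are taken from the arrays in `bs`, which the program does not write to, and
the bodies of loops do not write to the loop counters. -/
def wellFormed (bs : List ℕ) : Cmd → Bool
  | skip => true
  | setNat a _ _ => decide (a ∉ bs)
  | setNum _ _ _ => true
  | seq C₁ C₂ => C₁.wellFormed bs && C₂.wellFormed bs
  | branch _ C₁ C₂ => C₁.wellFormed bs && C₂.wellFormed bs
  | forLoop a b C => decide (b ∈ bs) && (decide (a ∉ bs) &&
      (decide (a ∉ C.natWrites) && C.wellFormed bs))

section Semantics

variable {K : Type} [LinearOrder K] [AddCommGroup K]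

open Classical in
/-- The memory contents after running a structured program. -/
noncomputable def eval : Cmd → Memory K → Memory K
  | skip, s => s
  | setNat a i e, s => s.writeNat a (i.eval s) (e.eval s)
  | setNum a i x, s => s.writeNum a (i.eval s) (x.eval s)
  | seq C₁ C₂, s => C₂.eval (C₁.eval s)
  | branch b C₁ C₂, s => if b.Holds s then C₁.eval s else C₂.eval s
  | forLoop a b C, s =>
      -- The number of rounds is read once, at the start. That this agrees with the compiled `while`
      -- loop is shown for well-formed programs only.
      (fun s => (C.eval s).writeNat a 0 ((C.eval s).nat a 0 + 1))^[s.nat b 0] (s.writeNat a 0 0)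

end Semantics

end Cmd

/-! ### Reading after writing, and the arrays that a command leaves alone. -/

section Memory

variable {K : Type} (s : Memory K)

theorem Memory.writeNat_nat (a i m b j : ℕ) :
    (s.writeNat a i m).nat b j = if b = a ∧ j = i then m else s.nat b j := by
  simp only [Memory.writeNat, Function.update_apply]
  by_cases h : b = a
  · subst h; simp [Function.update_apply]
  · simp [h]

theorem Memory.writeNum_num (a i : ℕ) (x : K) (b j : ℕ) :
    (s.writeNum a i x).num b j = if b = a ∧ j = i then x else s.num b j := by
  simp only [Memory.writeNum, Function.update_apply]
  by_cases h : b = a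
  · subst h; simp [Function.update_apply]
  · simp [h]

theorem Memory.writeNat_nat_of_ne {a b : ℕ} (i m : ℕ) (h : b ≠ a) :
    (s.writeNat a i m).nat b = s.nat b := by
  funext j; simp [Memory.writeNat_nat, h]

theorem Memory.writeNum_num_of_ne {a b : ℕ} (i : ℕ) (x : K) (h : b ≠ a) :
    (s.writeNum a i x).num b = s.num b := by
  funext j; simp [Memory.writeNum_num, h]

@[simp]
theorem Memory.writeNat_num (a i m : ℕ) : (s.writeNat a i m).num = s.num := rfl

@[simp]
theorem Memory.writeNum_nat (a i : ℕ) (x : K) : (s.writeNum a i x).nat = s.nat := rfl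

end Memory

/-- The memories `s` and `s'` agree outside the natural number arrays in `l` and the arrays of
elements of `K` in `l'`. -/
structure Memory.EqOutside {K : Type} (l l' : List ℕ) (s s' : Memory K) : Prop where
  nat_eq : ∀ a, a ∉ l → s'.nat a = s.nat a
  num_eq : ∀ a, a ∉ l' → s'.num a = s.num a

namespace Cmd

variable {K : Type} [LinearOrder K] [AddCommGroup K]

/-- This frame property replaces case-by-case reasoning about unaffected arrays: for a concrete
program the lists of written arrays can be computed, so the side conditions are settled by `decide`.
-/
theorem eval_eqOutside (C : Cmd) (s : Memory K) :
    s.EqOutside C.natWrites C.numWrites (C.eval s) := by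
  induction C generalizing s with
  | skip => exact ⟨fun _ _ => rfl, fun _ _ => rfl⟩
  | setNat a i e =>
    refine ⟨fun b hb => ?_, fun _ _ => rfl⟩
    exact s.writeNat_nat_of_ne _ _ (by simpa [natWrites] using hb)
  | setNum a i x =>
    refine ⟨fun _ _ => rfl, fun b hb => ?_⟩
    exact s.writeNum_num_of_ne _ _ (by simpa [numWrites] using hb)
  | seq C₁ C₂ ih1 ih2 =>
    refine ⟨fun b hb => ?_, fun b hb => ?_⟩
    · simp only [natWrites, List.mem_append, not_or] at hb
      exact ((ih2 _).nat_eq b hb.2).trans ((ih1 s).nat_eq b hb.1)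
    · simp only [numWrites, List.mem_append, not_or] at hb
      exact ((ih2 _).num_eq b hb.2).trans ((ih1 s).num_eq b hb.1)
  | branch c C₁ C₂ ih1 ih2 =>
    refine ⟨fun b hb => ?_, fun b hb => ?_⟩
    · simp only [natWrites, List.mem_append, not_or] at hb
      simp only [eval]
      split_ifs
      · exact (ih1 s).nat_eq b hb.1
      · exact (ih2 s).nat_eq b hb.2
    · simp only [numWrites, List.mem_append, not_or] at hb
      simp only [eval]
      split_ifs
      · exact (ih1 s).num_eq b hb.1
      · exact (ih2 s).num_eq b hb.2
  | forLoop a b C ih =>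
    simp only [eval]
    generalize s.nat b 0 = m
    induction m with
    | zero =>
      refine ⟨fun c hc => ?_, fun _ _ => rfl⟩
      simp only [natWrites, List.mem_cons, not_or] at hc
      exact s.writeNat_nat_of_ne _ _ hc.1
    | succ m ihm =>
      rw [Function.iterate_succ_apply']
      refine ⟨fun c hc => ?_, fun c hc => ?_⟩
      · have hc' := hc
        simp only [natWrites, List.mem_cons, not_or] at hc
        rw [Memory.writeNat_nat_of_ne _ _ _ hc.1, (ih _).nat_eq c hc.2, ihm.nat_eq c hc']
      · rw [Memory.writeNat_num, (ih _).num_eq c hc, ihm.num_eq c hc]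

/-- The induction principle for loops. -/
theorem forLoop_induction {a b : ℕ} {C : Cmd} {s : Memory K} (ha : a ∉ C.natWrites)
    (Inv : ℕ → Memory K → Prop) (h0 : Inv 0 (s.writeNat a 0 0))
    (step : ∀ i < s.nat b 0, ∀ s', s'.nat a 0 = i →
      s.EqOutside (a :: C.natWrites) C.numWrites s' → Inv i s' →
      Inv (i + 1) ((C.eval s').writeNat a 0 (i + 1))) :
    Inv (s.nat b 0) ((forLoop a b C).eval s) := by
  simp only [eval]
  -- The value of the counter and the frame condition are carried along with `Inv`, since the
  -- induction step may use both.
  suffices h : ∀ m ≤ s.nat b 0, ∀ s', s' =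
      (fun s => (C.eval s).writeNat a 0 ((C.eval s).nat a 0 + 1))^[m] (s.writeNat a 0 0) →
      s'.nat a 0 = m ∧ s.EqOutside (a :: C.natWrites) C.numWrites s' ∧ Inv m s' from
    (h _ le_rfl _ rfl).2.2
  intro m hm
  induction m with
  | zero =>
    rintro s' rfl
    refine ⟨by simp [Memory.writeNat_nat], ⟨fun c hc => ?_, fun _ _ => rfl⟩, h0⟩
    simp only [List.mem_cons, not_or] at hc
    exact s.writeNat_nat_of_ne _ _ hc.1
  | succ m ih =>
    rintro s' rfl
    obtain ⟨h1, h2, h3⟩ := ih (by omega) _ rfl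
    rw [Function.iterate_succ_apply']
    generalize (fun s : Memory K => (C.eval s).writeNat a 0 ((C.eval s).nat a 0 + 1))^[m]
      (s.writeNat a 0 0) = s₁ at h1 h2 h3
    have h4 : (C.eval s₁).nat a 0 = m := by rw [(C.eval_eqOutside s₁).nat_eq a ha, h1]
    simp only [h4]
    refine ⟨by simp [Memory.writeNat_nat], ⟨fun c hc => ?_, fun c hc => ?_⟩,
      step m (by omega) s₁ h1 h2 h3⟩
    · have hc' := hc
      simp only [List.mem_cons, not_or] at hc
      rw [Memory.writeNat_nat_of_ne _ _ _ hc.1, (C.eval_eqOutside s₁).nat_eq c hc.2,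
        h2.nat_eq c hc']
    · rw [Memory.writeNat_num, (C.eval_eqOutside s₁).num_eq c hc, h2.num_eq c hc]

end Cmd

/-! ## Running times -/

/-- The number of subexpressions. -/
def NatExpr.size : NatExpr → ℕ
  | .const _ => 1
  | .get _ i => i.size + 1
  | .add e f => e.size + f.size + 1
  | .sub e f => e.size + f.size + 1

/-- The number of subexpressions. -/
def NumExpr.size : NumExpr → ℕ
  | .get _ i => i.size + 1
  | .add x y => x.size + y.size + 1
  | .sub x y => x.size + y.size + 1

/-- The number of subexpressions. -/
def Test.size : Test → ℕ
  | .natLt e f => e.size + f.size + 1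
  | .numLt x y => x.size + y.size + 1
  | .neg b => b.size + 1

/-- The running time as a polynomial in a common bound for the number of rounds of the loops. -/
noncomputable def Cmd.time : Cmd → Polynomial ℕ
  | .skip => 1
  | .setNat _ i e => Polynomial.C (i.size + e.size + 1)
  | .setNum _ i x => Polynomial.C (i.size + x.size + 1)
  | .seq C₁ C₂ => C₁.time + C₂.time + 1
  | .branch b C₁ C₂ => Polynomial.C b.size + C₁.time + C₂.time + 1
  -- Apart from its body, a round costs at most `14` for the test, the counter and the sequencing;
  -- the `10` pays for the initialization and the last, failing test.
  | .forLoop _ _ C => Polynomial.X * (C.time + 14) + 10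

section

variable {K : Type} [LinearOrder K] [AddCommGroup K]

omit [LinearOrder K] [AddCommGroup K] in
theorem NatExpr.cost_unitCost (s : Memory K) (e : NatExpr) : e.cost (unitCost K) s = e.size := by
  induction e <;> simp_all [NatExpr.cost, NatExpr.size, unitCost]

omit [LinearOrder K] in
theorem NumExpr.cost_unitCost (s : Memory K) (x : NumExpr) : x.cost (unitCost K) s = x.size := by
  have h := NatExpr.cost_unitCost s
  induction x <;> simp_all [NumExpr.cost, NumExpr.size, unitCost]

omit [LinearOrder K] in
theorem Test.cost_unitCost (s : Memory K) (b : Test) : b.cost (unitCost K) s = b.size := by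
  have h := NatExpr.cost_unitCost s
  have h' := NumExpr.cost_unitCost s
  induction b <;> simp_all [Test.cost, Test.size]

theorem Cmd.wellFormed_nat_eq {bs : List ℕ} {C : Cmd} (hC : C.wellFormed bs = true) {b : ℕ}
    (hb : b ∈ bs) : b ∉ C.natWrites := by
  induction C with
  | skip => simp [natWrites]
  | setNat a i e =>
    simp only [wellFormed, decide_eq_true_eq] at hC
    simp only [natWrites, List.mem_singleton]
    rintro rfl
    exact hC hb
  | setNum a i x => simp [natWrites]
  | seq C₁ C₂ ih1 ih2 =>
    simp only [wellFormed, Bool.and_eq_true] at hC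
    simp [natWrites, ih1 hC.1, ih2 hC.2]
  | branch c C₁ C₂ ih1 ih2 =>
    simp only [wellFormed, Bool.and_eq_true] at hC
    simp [natWrites, ih1 hC.1, ih2 hC.2]
  | forLoop a c C ih =>
    simp only [wellFormed, Bool.and_eq_true, decide_eq_true_eq] at hC
    simp only [natWrites, List.mem_cons, not_or]
    exact ⟨fun h => hC.2.1 (h ▸ hb), ih hC.2.2.2⟩

/-- No well-formed command writes to the arrays in `bs`, so the single bound `B` stays valid for all
loops, including nested ones. -/
theorem Cmd.exists_run {bs : List ℕ} {C : Cmd} (hC : C.wellFormed bs = true) {B : ℕ}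
    (s : Memory K) (hs : ∀ b ∈ bs, s.nat b 0 ≤ B) :
    ∃ t ≤ C.time.eval B, Run (unitCost K) C.compile s (C.eval s) t := by
  induction C generalizing s with
  | skip => exact ⟨1, by simp [time], .skip s⟩
  | setNat a i e =>
    exact ⟨_, by simp [time, NatExpr.cost_unitCost], .setNat a i e s⟩
  | setNum a i x =>
    exact ⟨_, by simp [time, NatExpr.cost_unitCost, NumExpr.cost_unitCost], .setNum a i x s⟩
  | seq C₁ C₂ ih1 ih2 =>
    simp only [wellFormed, Bool.and_eq_true] at hC
    obtain ⟨t1, h1, r1⟩ := ih1 hC.1 s hs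
    obtain ⟨t2, h2, r2⟩ := ih2 hC.2 (C₁.eval s) (fun b hb => by
      rw [(C₁.eval_eqOutside s).nat_eq b (wellFormed_nat_eq hC.1 hb)]; exact hs b hb)
    refine ⟨_, ?_, .seq r1 r2⟩
    simp only [time, Polynomial.eval_add, Polynomial.eval_one]
    omega
  | branch c C₁ C₂ ih1 ih2 =>
    simp only [wellFormed, Bool.and_eq_true] at hC
    simp only [time, Polynomial.eval_add, Polynomial.eval_one, Polynomial.eval_C, eval]
    split_ifs with h
    · obtain ⟨t1, h1, r1⟩ := ih1 hC.1 s hs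
      refine ⟨_, ?_, .branch_true h r1⟩
      rw [Test.cost_unitCost]; omega
    · obtain ⟨t1, h1, r1⟩ := ih2 hC.2 s hs
      refine ⟨_, ?_, .branch_false h r1⟩
      rw [Test.cost_unitCost]; omega
  | forLoop a b C ih =>
    have hab : b ≠ a := by
      rintro rfl
      simp only [wellFormed, Bool.and_eq_true, decide_eq_true_eq] at hC
      exact hC.2.1 hC.1
    have hbs := fun c hc => List.ne_of_not_mem_cons (wellFormed_nat_eq (b := c) hC hc)
    simp only [wellFormed, Bool.and_eq_true, decide_eq_true_eq] at hC
    -- Induction on the number `m` of remaining rounds, since `Run.loop_true` peels off the first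
    -- round.
    have key : ∀ m (s : Memory K), (∀ b ∈ bs, s.nat b 0 ≤ B) → s.nat a 0 + m = s.nat b 0 →
        ∃ t ≤ m * (C.time.eval B + 14) + 6, Run (unitCost K)
          (.loop (.natLt (cell a) (cell b))
            (.seq C.compile (.setNat a (.const 0) (.add (cell a) (.const 1))))) s
          ((fun s => (C.eval s).writeNat a 0 ((C.eval s).nat a 0 + 1))^[m] s) t := by
      intro m
      induction m with
      | zero =>
        intro s hs hm
        refine ⟨_, ?_, .loop_false (by simp only [Test.Holds, NatExpr.eval]; omega)⟩
        rw [Test.cost_unitCost]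
        simp [Test.size, NatExpr.size]
      | succ m ihm =>
        intro s hs hm
        obtain ⟨t1, h1, r1⟩ := ih hC.2.2.2 s hs
        have hf := C.eval_eqOutside s
        obtain ⟨t2, h2, r2⟩ := ihm ((C.eval s).writeNat a 0 ((C.eval s).nat a 0 + 1))
          (fun c hc => by
            rw [Memory.writeNat_nat_of_ne _ _ _ (hbs c hc),
              hf.nat_eq c (wellFormed_nat_eq hC.2.2.2 hc)]
            exact hs c hc)
          (by
            rw [Memory.writeNat_nat_of_ne _ _ _ hab,
              hf.nat_eq b (wellFormed_nat_eq hC.2.2.2 hC.1), hf.nat_eq a hC.2.2.1]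
            simp only [Memory.writeNat_nat]
            simp
            omega)
        refine ⟨_, ?_, .loop_true (by simp only [Test.Holds, NatExpr.eval]; omega)
          (.seq r1 (.setNat _ _ _ _)) r2⟩
        rw [Test.cost_unitCost, NatExpr.cost_unitCost, NatExpr.cost_unitCost, add_mul]
        simp only [Test.size, NatExpr.size]
        omega
    obtain ⟨t, ht, r⟩ := key (s.nat b 0) (s.writeNat a 0 0)
      (fun c hc => by
        rw [Memory.writeNat_nat_of_ne _ _ _ (hbs c hc)]
        exact hs c hc)
      (by rw [Memory.writeNat_nat_of_ne _ _ _ hab]; simp [Memory.writeNat_nat])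
    refine ⟨_, ?_, .seq (.setNat _ _ _ _) r⟩
    rw [NatExpr.cost_unitCost]
    have h1 : s.nat b 0 * (C.time.eval B + 14) ≤ B * (C.time.eval B + 14) :=
      Nat.mul_le_mul_right _ (hs b hC.1)
    simp only [time, NatExpr.size, Polynomial.eval_add, Polynomial.eval_mul, Polynomial.eval_X,
      Polynomial.eval_ofNat]
    omega

end

end RandomAccess

/-! # Preflows -/

namespace Preflow

variable {K : Type} [LinearOrder K] [AddCommGroup K] [IsOrderedAddMonoid K]

/-- A preflow in the network with nodes `0, …, N - 1`, sink `t`, arc capacities `r₀` and supplies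
`e₀`, given by the residual capacities `r` and the excesses `e`, with a valid labelling `d`. -/
structure IsPreflow (N D t : ℕ) (r₀ : ℕ → ℕ → K) (e₀ : ℕ → K) (r : ℕ → ℕ → K) (e : ℕ → K)
    (d : ℕ → ℕ) : Prop where
  r_nonneg : ∀ p < N, ∀ q < N, 0 ≤ r p q
  e_nonneg : ∀ p < N, 0 ≤ e p
  -- The flow from `p` to `q` is `r₀ p q - r p q` and is never stored. This condition says that it
  -- is antisymmetric, the next one that the excess is the supply minus the net outflow.
  antisymm : ∀ p < N, ∀ q < N, r p q + r q p = r₀ p q + r₀ q p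
  conserve : ∀ p < N, e p + ∑ q ∈ Finset.range N, r₀ p q = e₀ p + ∑ q ∈ Finset.range N, r p q
  valid : ∀ p < N, ∀ q < N, 0 < r p q → d p ≤ d q + 1
  d_le : ∀ p < N, d p ≤ D
  d_sink : d t = 0

/-- The residual capacities after pushing `δ` along the arc from `p` to `q`. -/
def pushArc (r : ℕ → ℕ → K) (p q : ℕ) (δ : K) (a b : ℕ) : K :=
  r a b - (if a = p ∧ b = q then δ else 0) + (if a = q ∧ b = p then δ else 0)

/-- The excesses after pushing `δ` along the arc from `p` to `q`. -/
def pushNode (e : ℕ → K) (p q : ℕ) (δ : K) (a : ℕ) : K :=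
  e a - (if a = p then δ else 0) + (if a = q then δ else 0)

/-- All nodes except the sink have no excess or the maximum label. -/
def Settled (N D t : ℕ) (e : ℕ → K) (d : ℕ → ℕ) : Prop :=
  ∀ p < N, p ≠ t → d p < D → e p = 0

/-- The node `p` has no excess, or no residual arc from `p` to a node `q < m` is admissible. -/
def Exhausted (m : ℕ) (r : ℕ → ℕ → K) (e : ℕ → K) (d : ℕ → ℕ) (p : ℕ) : Prop :=
  e p = 0 ∨ ∀ q < m, d p = d q + 1 → r p q = 0

variable {N D t : ℕ} {r₀ r r' : ℕ → ℕ → K} {e₀ e e' : ℕ → K} {d d' : ℕ → ℕ}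

-- Needed because the memory agrees with the abstract functions only at positions that belong to
-- nodes below `N`.
omit [IsOrderedAddMonoid K] in
theorem IsPreflow.congr (h : IsPreflow N D t r₀ e₀ r e d) (ht : t < N)
    (hr : ∀ p < N, ∀ q < N, r' p q = r p q) (he : ∀ p < N, e' p = e p)
    (hd : ∀ p < N, d' p = d p) : IsPreflow N D t r₀ e₀ r' e' d' where
  r_nonneg p hp q hq := by rw [hr p hp q hq]; exact h.r_nonneg p hp q hq
  e_nonneg p hp := by rw [he p hp]; exact h.e_nonneg p hp
  antisymm p hp q hq := by rw [hr p hp q hq, hr q hq p hp]; exact h.antisymm p hp q hq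
  conserve p hp := by
    rw [he p hp, h.conserve p hp]
    congr 1
    exact Finset.sum_congr rfl fun q hq => (hr p hp q (Finset.mem_range.1 hq)).symm
  valid p hp q hq := by rw [hr p hp q hq, hd p hp, hd q hq]; exact h.valid p hp q hq
  d_le p hp := by rw [hd p hp]; exact h.d_le p hp
  d_sink := by rw [hd t ht]; exact h.d_sink

/-- The only arc whose residual capacity grows is the reverse arc. It leads from the lower to the
higher label, so the labelling stays valid. -/
theorem IsPreflow.push (h : IsPreflow N D t r₀ e₀ r e d) {p q : ℕ} (hp : p < N) (hq : q < N)
    (hd : d p = d q + 1) : IsPreflow N D t r₀ e₀ (pushArc r p q (min (e p) (r p q)))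
      (pushNode e p q (min (e p) (r p q))) d := by
  have hpq : p ≠ q := by rintro rfl; omega
  have hδ : 0 ≤ min (e p) (r p q) := le_min (h.e_nonneg p hp) (h.r_nonneg p hp q hq)
  have hδe : min (e p) (r p q) ≤ e p := min_le_left _ _
  have hδr : min (e p) (r p q) ≤ r p q := min_le_right _ _
  generalize min (e p) (r p q) = δ at *
  refine ⟨fun a ha b hb => ?_, fun a ha => ?_, fun a ha b hb => ?_, fun a ha => ?_,
    fun a ha b hb hab => ?_, h.d_le, h.d_sink⟩
  · unfold pushArc
    have h1 := h.r_nonneg a ha b hb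
    by_cases h2 : a = p ∧ b = q
    · obtain ⟨rfl, rfl⟩ := h2
      simpa [hpq] using hδr
    · rw [if_neg h2, sub_zero]
      split_ifs
      · exact add_nonneg h1 hδ
      · simpa using h1
  · unfold pushNode
    have h1 := h.e_nonneg a ha
    by_cases h2 : a = p
    · subst h2
      simpa [hpq] using hδe
    · rw [if_neg h2, sub_zero]
      split_ifs
      · exact add_nonneg h1 hδ
      · simpa using h1
  · unfold pushArc
    rw [← h.antisymm a ha b hb]
    simp only [and_comm (a := b = p), and_comm (a := b = q)]
    abel
  · unfold pushArc pushNode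
    have h1 : ∑ b ∈ Finset.range N, (if a = p ∧ b = q then δ else 0) = if a = p then δ else 0 := by
      by_cases h2 : a = p <;> simp [h2, hq]
    have h2 : ∑ b ∈ Finset.range N, (if a = q ∧ b = p then δ else 0) = if a = q then δ else 0 := by
      by_cases h2 : a = q <;> simp [h2, hp]
    rw [Finset.sum_add_distrib, Finset.sum_sub_distrib, h1, h2]
    have h3 := h.conserve a ha
    calc _ = e a + ∑ q ∈ Finset.range N, r₀ a q - (if a = p then δ else 0)
          + (if a = q then δ else 0) := by abel
      _ = _ := by rw [h3]; abel
  · by_cases h2 : a = q ∧ b = p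
    · obtain ⟨rfl, rfl⟩ := h2
      omega
    · refine h.valid a ha b hb (hab.trans_le ?_)
      unfold pushArc
      rw [if_neg h2, add_zero]
      refine sub_le_self _ ?_
      split_ifs
      · exact hδ
      · exact le_rfl

/-- Invariant of the push phase at level `l`: the nodes of higher levels and the nodes below `p` at
level `l` are exhausted, and `p` is exhausted with respect to the nodes below `j`. -/
structure PushInvariant (N D t : ℕ) (r₀ : ℕ → ℕ → K) (e₀ : ℕ → K) (S : Prop) (l p j : ℕ)
    (r : ℕ → ℕ → K) (e : ℕ → K) (d : ℕ → ℕ) : Prop where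
  isPreflow : IsPreflow N D t r₀ e₀ r e d
  exhausted : ∀ a < N, d a < D → (l < d a ∨ d a = l ∧ a < p) → Exhausted N r e d a
  exhausted_node : d p = l → Exhausted j r e d p
  settled : S → Settled N D t e d

omit [IsOrderedAddMonoid K] in
theorem PushInvariant.congr {S : Prop} {l p j : ℕ} (h : PushInvariant N D t r₀ e₀ S l p j r e d)
    (ht : t < N) (hp : p < N) (hj : j ≤ N)
    (hr : ∀ p < N, ∀ q < N, r' p q = r p q) (he : ∀ p < N, e' p = e p)
    (hd : ∀ p < N, d' p = d p) : PushInvariant N D t r₀ e₀ S l p j r' e' d' := by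
  refine ⟨h.isPreflow.congr ht hr he hd, fun a ha ha' hl => ?_, fun hl => ?_,
    fun hS a ha hat had => ?_⟩
  · rw [hd a ha] at hl ha'
    refine (h.exhausted a ha ha' hl).imp (fun h1 => (he a ha).trans h1) fun h1 q hq h2 => ?_
    rw [hr a ha q hq]
    exact h1 q hq (by rwa [hd a ha, hd q hq] at h2)
  · rw [hd p hp] at hl
    refine (h.exhausted_node hl).imp (fun h1 => (he p hp).trans h1) fun h1 q hq h2 => ?_
    rw [hr p hp q (by omega)]
    exact h1 q hq (by rwa [hd p hp, hd q (by omega)] at h2)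
  · rw [he a ha]
    exact h.settled hS a ha hat (by rwa [hd a ha] at had)

/-- The push either saturates the arc or empties `p`. The excess moves to level `l - 1`, so the
nodes already treated, at level `l` or above, neither receive excess nor gain residual arcs. -/
theorem PushInvariant.push {S : Prop} {l p j : ℕ} (h : PushInvariant N D t r₀ e₀ S l p j r e d)
    (hl : l < D) (hp : p < N) (hj : j < N) (hpl : d p = l) (hd : d p = d j + 1) :
    PushInvariant N D t r₀ e₀ S l p (j + 1) (pushArc r p j (min (e p) (r p j)))
      (pushNode e p j (min (e p) (r p j))) d := by
  have hpj : p ≠ j := by rintro rfl; omega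
  refine ⟨h.isPreflow.push hp hj hd, fun a ha ha' hl => ?_, fun _ => ?_,
    fun hS a ha hat had => ?_⟩
  · have h1 : a ≠ p := by rintro rfl; omega
    have h2 : a ≠ j := by rintro rfl; omega
    refine (h.exhausted a ha ha' hl).imp (fun h3 => by simp [pushNode, h1, h2, h3])
      fun h3 q hq h4 => by simp [pushArc, h1, h2, h3 q hq h4]
  · rcases le_total (e p) (r p j) with h1 | h1
    · left
      simp [pushNode, h1, hpj]
    · rcases h.exhausted_node hpl with h2 | h2
      · left
        have h3 := h.isPreflow.r_nonneg p hp j hj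
        have h4 : r p j = 0 := le_antisymm (h1.trans h2.le) h3
        simp [pushNode, h2, h4]
      · right
        intro q hq hdq
        rcases Nat.lt_succ_iff_lt_or_eq.1 hq with h3 | rfl
        · simp [pushArc, h3.ne, hpj, h2 q h3 hdq]
        · simp [pushArc, h1, hpj]
  -- If the preflow was settled before, then `p`, which is not the sink because its label is
  -- positive, has no excess, and the push moves nothing.
  · have hpt : p ≠ t := by
      rintro rfl
      have := h.isPreflow.d_sink
      omega
    have h0 : e p = 0 := h.settled hS p hp hpt (by omega)
    have h1 : min (e p) (r p j) = 0 := by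
      rw [h0]; exact min_eq_left (h.isPreflow.r_nonneg p hp j hj)
    simp [pushNode, h1, h.settled hS a ha hat had]

omit [IsOrderedAddMonoid K] in
theorem PushInvariant.of_not_admissible {S : Prop} {l p j : ℕ}
    (h : PushInvariant N D t r₀ e₀ S l p j r e d) (hd : ¬ (d p = l ∧ d p = d j + 1)) :
    PushInvariant N D t r₀ e₀ S l p (j + 1) r e d := by
  refine ⟨h.isPreflow, h.exhausted, fun hl => ?_, h.settled⟩
  refine (h.exhausted_node hl).imp_right fun h1 q hq h2 => ?_
  rcases Nat.lt_succ_iff_lt_or_eq.1 hq with h3 | rfl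
  · exact h1 q h3 h2
  · exact absurd ⟨hl, h2⟩ hd

omit [IsOrderedAddMonoid K] in
theorem PushInvariant.next_node {S : Prop} {l p : ℕ}
    (h : PushInvariant N D t r₀ e₀ S l p N r e d) :
    PushInvariant N D t r₀ e₀ S l (p + 1) 0 r e d := by
  refine ⟨h.isPreflow, fun a ha ha' hl => ?_, fun _ => .inr fun q hq => absurd hq (by omega),
    h.settled⟩
  rcases hl with hl | ⟨hl, hap⟩
  · exact h.exhausted a ha ha' (.inl hl)
  · rcases Nat.lt_succ_iff_lt_or_eq.1 hap with h1 | rfl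
    · exact h.exhausted a ha ha' (.inr ⟨hl, h1⟩)
    · exact h.exhausted_node hl

omit [IsOrderedAddMonoid K] in
theorem PushInvariant.next_level {S : Prop} {l : ℕ}
    (h : PushInvariant N D t r₀ e₀ S (l + 1) N 0 r e d) :
    PushInvariant N D t r₀ e₀ S l 0 0 r e d := by
  refine ⟨h.isPreflow, fun a ha ha' hl => ?_, fun _ => .inr fun q hq => absurd hq (by omega),
    h.settled⟩
  rcases hl with hl | ⟨hl, hap⟩
  · exact h.exhausted a ha ha' (by omega)
  · omega

omit [IsOrderedAddMonoid K] in
theorem PushInvariant.first_level {S : Prop} {l : ℕ} (h : IsPreflow N D t r₀ e₀ r e d)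
    (hl : D ≤ l + 1) (hS : S → Settled N D t e d) :
    PushInvariant N D t r₀ e₀ S l 0 0 r e d :=
  ⟨h, fun a ha ha' hl => by omega, fun _ => .inr fun q hq => absurd hq (by omega), hS⟩

/-- Invariant of the relabelling phase, before the treatment of node `j`. -/
structure RelabelInvariant (N D t : ℕ) (r₀ : ℕ → ℕ → K) (e₀ : ℕ → K) (S : Prop) (m j : ℕ)
    (r : ℕ → ℕ → K) (e : ℕ → K) (d : ℕ → ℕ) : Prop where
  isPreflow : IsPreflow N D t r₀ e₀ r e d
  stuck : ∀ a < N, j ≤ a → d a < D → e a ≠ 0 → ∀ q < N, 0 < r a q → d a ≤ d q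
  settled : S → Settled N D t e d
  -- `m` is a lower bound for the label sum before the phase. Either it has been exceeded, or all
  -- nodes seen so far are inactive.
  progress : m ≤ ∑ a ∈ Finset.range N, d a
  progress_or : m + 1 ≤ ∑ a ∈ Finset.range N, d a ∨ ∀ a < j, a ≠ t → d a < D → e a = 0

-- Validity lets residual arcs go down by at most one level, and exhaustion of active nodes excludes
-- exactly one level. So no residual arc of an active node leads down.
omit [IsOrderedAddMonoid K] in
theorem RelabelInvariant.of_pushInvariant {S : Prop} {m : ℕ}
    (h : PushInvariant N D t r₀ e₀ S 0 N 0 r e d) (hm : m ≤ ∑ a ∈ Finset.range N, d a) :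
    RelabelInvariant N D t r₀ e₀ S m 0 r e d := by
  refine ⟨h.isPreflow, fun a ha _ ha' he q hq hr => ?_, h.settled, hm, .inr fun a ha => by omega⟩
  have h1 := h.isPreflow.valid a ha q hq hr
  rcases h.exhausted a ha ha' (by omega) with h2 | h2
  · exact absurd h2 he
  · have h3 : ¬ (d a = d q + 1) := fun h3 => hr.ne' (h2 q hq h3)
    omega

omit [IsOrderedAddMonoid K] in
theorem RelabelInvariant.congr {S : Prop} {m j : ℕ}
    (h : RelabelInvariant N D t r₀ e₀ S m j r e d) (ht : t < N) (hj : j ≤ N)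
    (hr : ∀ p < N, ∀ q < N, r' p q = r p q) (he : ∀ p < N, e' p = e p)
    (hd : ∀ p < N, d' p = d p) : RelabelInvariant N D t r₀ e₀ S m j r' e' d' := by
  have hsum : ∑ a ∈ Finset.range N, d' a = ∑ a ∈ Finset.range N, d a :=
    Finset.sum_congr rfl fun a ha => hd a (Finset.mem_range.1 ha)
  refine ⟨h.isPreflow.congr ht hr he hd, fun a ha hja ha' hne q hq hpos => ?_,
    fun hS a ha hat had => ?_, hsum ▸ h.progress, ?_⟩
  · rw [hd a ha] at ha' ⊢
    rw [he a ha] at hne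
    rw [hr a ha q hq] at hpos
    rw [hd q hq]
    exact h.stuck a ha hja ha' hne q hq hpos
  · rw [he a ha]
    exact h.settled hS a ha hat (by rwa [hd a ha] at had)
  · rw [hsum]
    refine h.progress_or.imp_right fun h1 a ha hat had => ?_
    rw [he a (by omega)]
    exact h1 a ha hat (by rwa [hd a (by omega)] at had)

-- Since no residual arc leads down from the active node `j`, its label can rise by one. For arcs
-- into `j` the conditions only become weaker, so the later nodes stay stuck.
omit [IsOrderedAddMonoid K] in
theorem RelabelInvariant.relabel {S : Prop} {m j : ℕ}
    (h : RelabelInvariant N D t r₀ e₀ S m j r e d) (hj : j < N) (hjt : j ≠ t) (he : 0 < e j)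
    (hd : d j < D) :
    RelabelInvariant N D t r₀ e₀ S m (j + 1) r e (fun a => if a = j then d j + 1 else d a) := by
  have hle : ∀ a, d a ≤ if a = j then d j + 1 else d a := fun a => by
    split_ifs with h1
    · subst h1; omega
    · exact le_rfl
  have hlt : ∑ a ∈ Finset.range N, d a <
      ∑ a ∈ Finset.range N, (if a = j then d j + 1 else d a) :=
    Finset.sum_lt_sum (fun a _ => hle a) ⟨j, Finset.mem_range.2 hj, by simp⟩
  have hpr := h.progress
  refine ⟨⟨h.isPreflow.r_nonneg, h.isPreflow.e_nonneg, h.isPreflow.antisymm, h.isPreflow.conserve,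
    fun p hp q hq hr => ?_, fun p hp => ?_, ?_⟩, fun a ha hja ha' hne q hq hr => ?_,
    fun hS => ?_, by omega, .inl (by omega)⟩
  · by_cases hpj : p = j
    · subst hpj
      have h1 := h.stuck p hp le_rfl hd he.ne' q hq hr
      have h2 := hle q
      simp only [if_true]
      omega
    · rw [if_neg hpj]
      exact (h.isPreflow.valid p hp q hq hr).trans (Nat.succ_le_succ (hle q))
  · have := h.isPreflow.d_le p hp
    split_ifs <;> omega
  · rw [if_neg (Ne.symm hjt)]
    exact h.isPreflow.d_sink
  · have haj : a ≠ j := by omega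
    rw [if_neg haj] at ha' ⊢
    exact (h.stuck a ha (by omega) ha' hne q hq hr).trans (hle q)
  · exact absurd (h.settled hS j hj hjt hd) he.ne'

omit [IsOrderedAddMonoid K] in
theorem RelabelInvariant.of_not_active {S : Prop} {m j : ℕ}
    (h : RelabelInvariant N D t r₀ e₀ S m j r e d) (hj : j < N)
    (ha : ¬ (j ≠ t ∧ 0 < e j ∧ d j < D)) : RelabelInvariant N D t r₀ e₀ S m (j + 1) r e d := by
  refine ⟨h.isPreflow, fun a ha hja => h.stuck a ha (by omega), h.settled, h.progress,
    h.progress_or.imp_right fun h1 a haj hat had => ?_⟩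
  rcases Nat.lt_succ_iff_lt_or_eq.1 haj with h2 | rfl
  · exact h1 a h2 hat had
  · by_contra hne
    exact ha ⟨hat, lt_of_le_of_ne (h.isPreflow.e_nonneg a hj) (Ne.symm hne), had⟩

omit [IsOrderedAddMonoid K] in
/-- After `N * D` rounds every preflow is settled. -/
theorem IsPreflow.settled_of_le (h : IsPreflow N D t r₀ e₀ r e d) (ht : t < N) (hD : 0 < D)
    (hs : N * D ≤ ∑ a ∈ Finset.range N, d a ∨ Settled N D t e d) : Settled N D t e d := by
  refine hs.resolve_left fun h1 => ?_
  -- The sink keeps the label zero, so the label sum is strictly less than `N * D`.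
  have h2 : ∑ a ∈ Finset.range N, d a < ∑ a ∈ Finset.range N, D :=
    Finset.sum_lt_sum (fun a ha => h.d_le a (Finset.mem_range.1 ha))
      ⟨t, Finset.mem_range.2 ht, by rw [h.d_sink]; exact hD⟩
  rw [Finset.sum_const, Finset.card_range, smul_eq_mul] at h2
  omega

/-- The capacity of the cut with source side `X`. -/
def cut (N : ℕ) (r₀ : ℕ → ℕ → K) (e₀ : ℕ → K) (X : Finset ℕ) : K :=
  -- The supplies act as arcs from an external source, so those of nodes on the sink side cross the
  -- cut.
  ∑ p ∈ Finset.range N \ X, e₀ p + ∑ p ∈ Finset.range N \ X, ∑ q ∈ X, r₀ q p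

/-- Sum the conservation law over the sink side: the flow inside cancels by antisymmetry, so the
total excess there is the capacity of the cut minus its residual capacity. -/
theorem IsPreflow.sum_excess_add (h : IsPreflow N D t r₀ e₀ r e d) {X : Finset ℕ}
    (hX : X ⊆ Finset.range N) :
    ∑ p ∈ Finset.range N \ X, e p + ∑ p ∈ Finset.range N \ X, ∑ q ∈ X, r q p =
      cut N r₀ e₀ X := by
  set Y := Finset.range N \ X with hY
  have hYN : ∀ p ∈ Y, p < N := fun p hp => Finset.mem_range.1 (Finset.mem_sdiff.1 hp).1
  have hXN : ∀ p ∈ X, p < N := fun p hp => Finset.mem_range.1 (hX hp)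
  have hsplit : ∀ f : ℕ → K, ∑ q ∈ Finset.range N, f q = ∑ q ∈ Y, f q + ∑ q ∈ X, f q :=
    fun f => (Finset.sum_sdiff hX).symm
  have h1 : ∑ p ∈ Y, (e p + (∑ q ∈ Y, r₀ p q + ∑ q ∈ X, r₀ p q)) =
      ∑ p ∈ Y, (e₀ p + (∑ q ∈ Y, r p q + ∑ q ∈ X, r p q)) :=
    Finset.sum_congr rfl fun p hp => by rw [← hsplit, ← hsplit]; exact h.conserve p (hYN p hp)
  have h2 : ∑ p ∈ Y, ∑ q ∈ Y, (r p q + r q p) = ∑ p ∈ Y, ∑ q ∈ Y, (r₀ p q + r₀ q p) :=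
    Finset.sum_congr rfl fun p hp => Finset.sum_congr rfl fun q hq =>
      h.antisymm p (hYN p hp) q (hYN q hq)
  have h3 : ∑ p ∈ Y, ∑ q ∈ X, (r p q + r q p) = ∑ p ∈ Y, ∑ q ∈ X, (r₀ p q + r₀ q p) :=
    Finset.sum_congr rfl fun p hp => Finset.sum_congr rfl fun q hq =>
      h.antisymm p (hYN p hp) q (hXN q hq)
  have h4 : ∑ p ∈ Y, ∑ q ∈ Y, r q p = ∑ p ∈ Y, ∑ q ∈ Y, r p q := Finset.sum_comm
  have h5 : ∑ p ∈ Y, ∑ q ∈ Y, r₀ q p = ∑ p ∈ Y, ∑ q ∈ Y, r₀ p q := Finset.sum_comm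
  simp only [Finset.sum_add_distrib] at h1 h2 h3
  -- Antisymmetry yields twice the capacities inside `Y`; the factor two can be cancelled because an
  -- ordered group is torsion free.
  rw [h4, h5, ← two_nsmul, ← two_nsmul] at h2
  have h6 : ∑ p ∈ Y, ∑ q ∈ Y, r p q = ∑ p ∈ Y, ∑ q ∈ Y, r₀ p q :=
    nsmul_right_injective two_ne_zero h2
  rw [h6] at h1
  unfold cut
  generalize ∑ p ∈ Y, ∑ q ∈ Y, r₀ p q = a at *
  generalize ∑ p ∈ Y, ∑ q ∈ X, r p q = b at *
  generalize ∑ p ∈ Y, ∑ q ∈ X, r₀ p q = b' at *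
  generalize ∑ p ∈ Y, ∑ q ∈ X, r q p = c at *
  generalize ∑ p ∈ Y, ∑ q ∈ X, r₀ q p = c' at *
  generalize ∑ p ∈ Y, e p = x at *
  generalize ∑ p ∈ Y, e₀ p = x' at *
  have e1 : b = x + b' - x' := by
    rw [eq_sub_iff_add_eq]
    apply add_right_cancel (b := a)
    calc b + x' + a = x' + (a + b) := by abel
      _ = x + (a + b') := h1.symm
      _ = x + b' + a := by abel
  rw [e1] at h3
  apply add_right_cancel (b := b' - x')
  calc x + c + (b' - x') = x + b' - x' + c := by abel
    _ = b' + c' := h3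
    _ = x' + c' + (b' - x') := by abel

/-- Weak duality: the other excesses and the residual capacities are nonnegative. -/
theorem IsPreflow.excess_sink_le (h : IsPreflow N D t r₀ e₀ r e d) (ht : t < N) {X : Finset ℕ}
    (hX : X ⊆ Finset.range N) (htX : t ∉ X) : e t ≤ cut N r₀ e₀ X := by
  rw [← h.sum_excess_add hX]
  have hXN : ∀ p ∈ X, p < N := fun p hp => Finset.mem_range.1 (hX hp)
  have h1 : e t ≤ ∑ p ∈ Finset.range N \ X, e p :=
    Finset.single_le_sum (f := e)
      (fun p hp => h.e_nonneg p (Finset.mem_range.1 (Finset.mem_sdiff.1 hp).1))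
      (Finset.mem_sdiff.2 ⟨Finset.mem_range.2 ht, htX⟩)
  have h2 : 0 ≤ ∑ p ∈ Finset.range N \ X, ∑ q ∈ X, r q p :=
    Finset.sum_nonneg fun p hp => Finset.sum_nonneg fun q hq =>
      h.r_nonneg q (hXN q hq) p (Finset.mem_range.1 (Finset.mem_sdiff.1 hp).1)
  exact h1.trans (le_add_of_nonneg_right h2)

/-- The excess of the sink in a settled preflow is the capacity of a cut. -/
theorem IsPreflow.exists_cut (h : IsPreflow N D t r₀ e₀ r e d) (ht : t < N) (hD : N < D)
    (hs : Settled N D t e d) : ∃ X ⊆ Finset.range N, t ∉ X ∧ e t = cut N r₀ e₀ X := by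
  -- The `N` nodes cannot use all labels `0, …, N`. No residual arc jumps down over the unused label
  -- `k`, and the nodes below it, except the sink, have labels less than `D` and hence no excess.
  obtain ⟨k, hk, hkd⟩ : ∃ k ∈ Finset.range (N + 1), k ∉ (Finset.range N).image d :=
    Finset.exists_mem_notMem_of_card_lt_card
      (Finset.card_image_le.trans_lt (by simp))
  have hkd' : ∀ p < N, d p ≠ k := fun p hp h1 =>
    hkd (Finset.mem_image.2 ⟨p, Finset.mem_range.2 hp, h1⟩)
  have hk := Finset.mem_range.1 hk
  have htk : ¬ k < d t := by rw [h.d_sink]; omega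
  refine ⟨(Finset.range N).filter fun p => k < d p, Finset.filter_subset _ _,
    fun h1 => htk (Finset.mem_filter.1 h1).2, ?_⟩
  have hYd : ∀ p ∈ Finset.range N \ (Finset.range N).filter (fun p => k < d p),
      p < N ∧ d p < k := by
    intro p hp
    simp only [Finset.mem_sdiff, Finset.mem_filter, Finset.mem_range, not_and, not_lt] at hp
    exact ⟨hp.1, lt_of_le_of_ne (hp.2 hp.1) (hkd' p hp.1)⟩
  rw [← h.sum_excess_add (Finset.filter_subset _ _), Finset.sum_eq_single t,
    Finset.sum_eq_zero, add_zero]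
  · intro p hp
    refine Finset.sum_eq_zero fun q hq => ?_
    obtain ⟨hp1, hp2⟩ := hYd p hp
    simp only [Finset.mem_filter, Finset.mem_range] at hq
    by_contra hne
    have := h.valid q hq.1 p hp1 (lt_of_le_of_ne (h.r_nonneg q hq.1 p hp1) (Ne.symm hne))
    omega
  · intro p hp hpt
    obtain ⟨hp1, hp2⟩ := hYd p hp
    exact hs p hp1 hpt (by omega)
  · intro h1
    exact absurd (Finset.mem_sdiff.2 ⟨Finset.mem_range.2 ht, fun h2 =>
      htk (Finset.mem_filter.1 h2).2⟩) h1

end Preflow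

/-! # The maximum flow program

The natural number arrays `5` and `6` hold the number `N` of nodes and the maximum label `D` at
position `0`, array `8` holds the multiples of `N`, and array `10` holds the labels. The arrays `3`
and `4` of elements of `K` hold the residual capacities and the excesses, array `8` holds zero. -/

namespace RandomAccess

open Cmd Preflow

/-- Run `C` if the values of `e` and `f` are equal. -/
def ifEq (e f : NatExpr) (C : Cmd) : Cmd :=
  .branch (.neg (.natLt e f)) (.branch (.neg (.natLt f e)) C .skip) .skip

/-- The position of the arc from `p` to `q`. -/
def arcExpr (p q : NatExpr) : NatExpr :=
  .add (.get 8 p) q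

/-- Push as much as possible along the arc given by the counters `25` and `26`. -/
def pushCmd : Cmd :=
  .seq (.branch (.numLt (.get 4 (cell 25)) (.get 3 (arcExpr (cell 25) (cell 26))))
    (.setNum 9 (.const 0) (.get 4 (cell 25)))
    (.setNum 9 (.const 0) (.get 3 (arcExpr (cell 25) (cell 26)))))
  (.seq (.setNum 3 (arcExpr (cell 25) (cell 26))
    (.sub (.get 3 (arcExpr (cell 25) (cell 26))) (.get 9 (.const 0))))
  (.seq (.setNum 3 (arcExpr (cell 26) (cell 25))
    (.add (.get 3 (arcExpr (cell 26) (cell 25))) (.get 9 (.const 0))))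
  (.seq (.setNum 4 (cell 25) (.sub (.get 4 (cell 25)) (.get 9 (.const 0))))
    (.setNum 4 (cell 26) (.add (.get 4 (cell 26)) (.get 9 (.const 0)))))))

/-- Push along the arc given by the counters `25` and `26` if it is admissible and starts at the
level given by the counter `24`. -/
def guardedPushCmd : Cmd :=
  -- Round `k` treats level `D - (k + 1)`, so the levels run down from `D - 1` to `0`.
  ifEq (.get 10 (cell 25)) (.sub (cell 6) (.add (cell 24) (.const 1)))
    (ifEq (.get 10 (cell 25)) (.add (.get 10 (cell 26)) (.const 1)) pushCmd)

/-- Treat all nodes in the order of decreasing labels and push along all admissible arcs. -/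
def pushPhase : Cmd :=
  .forLoop 24 6 (.forLoop 25 5 (.forLoop 26 5 guardedPushCmd))

/-- Relabel the node given by the counter `25` if it is active. -/
def relabelCmd : Cmd :=
  -- The sink is the last node and is not relabelled.
  .branch (.natLt (cell 25) (.sub (cell 5) (.const 1)))
    (.branch (.numLt (.get 8 (.const 0)) (.get 4 (cell 25)))
      (.branch (.natLt (.get 10 (cell 25)) (cell 6))
        (.setNat 10 (cell 25) (.add (.get 10 (cell 25)) (.const 1))) .skip) .skip) .skip

/-- Relabel all active nodes. -/
def relabelPhase : Cmd :=
  .forLoop 25 5 relabelCmd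

/-- The preflow push algorithm. -/
def flowLoop : Cmd :=
  -- Nested loops perform `N * D` rounds without a product being computed.
  .forLoop 22 5 (.forLoop 23 6 (.seq pushPhase relabelPhase))

variable {K : Type} [LinearOrder K] [AddCommGroup K]

theorem eval_ifEq (e f : NatExpr) (C : Cmd) (s : Memory K) :
    (ifEq e f C).eval s = if e.eval s = f.eval s then C.eval s else s := by
  simp only [ifEq, Cmd.eval, Test.Holds, not_lt]
  rcases lt_trichotomy (e.eval s) (f.eval s) with h | h | h
  · rw [if_neg (by omega), if_neg (by omega)]
  · rw [if_pos (by omega), if_pos (by omega), if_pos h]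
  · rw [if_pos (by omega), if_neg (by omega), if_neg (by omega)]

/-- The constants the maximum flow program uses. -/
structure FlowEnv (N D : ℕ) (s : Memory K) : Prop where
  nodes : s.nat 5 0 = N
  maxLabel : s.nat 6 0 = D
  row : ∀ p < N, s.nat 8 p = p * N
  zero : s.num 8 0 = 0

omit [LinearOrder K] in
theorem FlowEnv.of_eqOutside {N D : ℕ} {s s' : Memory K} (h : FlowEnv N D s) {l l' : List ℕ}
    (hs : s.EqOutside l l' s') (h5 : 5 ∉ l := by decide) (h6 : 6 ∉ l := by decide)
    (h8 : 8 ∉ l := by decide) (h8' : 8 ∉ l' := by decide) : FlowEnv N D s' := by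
  refine ⟨?_, ?_, fun p hp => ?_, ?_⟩
  · rw [hs.nat_eq 5 h5, h.nodes]
  · rw [hs.nat_eq 6 h6, h.maxLabel]
  · rw [hs.nat_eq 8 h8, h.row p hp]
  · rw [hs.num_eq 8 h8', h.zero]

/-- The residual capacities in the memory. -/
def residual (N : ℕ) (s : Memory K) (p q : ℕ) : K :=
  s.num 3 (p * N + q)

omit [LinearOrder K] [AddCommGroup K] in
theorem residual_writeNat (N : ℕ) (s : Memory K) (a i m : ℕ) :
    residual N (s.writeNat a i m) = residual N s := rfl

theorem mul_add_inj {N a b c d : ℕ} (hb : b < N) (hd : d < N) :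
    a * N + b = c * N + d ↔ a = c ∧ b = d := by
  refine ⟨fun h => ?_, fun ⟨h1, h2⟩ => by rw [h1, h2]⟩
  have hN : 0 < N := by omega
  have h1 : (a * N + b) / N = a := by
    rw [mul_comm, Nat.mul_add_div hN, Nat.div_eq_of_lt hb, add_zero]
  have h2 : (c * N + d) / N = c := by
    rw [mul_comm, Nat.mul_add_div hN, Nat.div_eq_of_lt hd, add_zero]
  have h3 : a = c := by rw [← h1, ← h2, h]
  subst h3
  exact ⟨rfl, by omega⟩

theorem eval_pushCmd {N D p q : ℕ} {s : Memory K} (hs : FlowEnv N D s) (hp : p < N) (hq : q < N)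
    (hpq : p ≠ q) (h25 : s.nat 25 0 = p) (h26 : s.nat 26 0 = q) :
    (∀ a < N, ∀ b < N, residual N (pushCmd.eval s) a b =
      pushArc (residual N s) p q (min (s.num 4 p) (residual N s p q)) a b) ∧
    ∀ a < N, (pushCmd.eval s).num 4 a =
      pushNode (s.num 4) p q (min (s.num 4 p) (residual N s p q)) a := by
  -- The amount is saved first, because the later writes change both numbers of which it is the
  -- minimum.
  have e1 : ∃ s', s' = (Cmd.branch
      (.numLt (.get 4 (cell 25)) (.get 3 (arcExpr (cell 25) (cell 26))))
      (.setNum 9 (.const 0) (.get 4 (cell 25)))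
      (.setNum 9 (.const 0) (.get 3 (arcExpr (cell 25) (cell 26))))).eval s ∧
      s' = s.writeNum 9 0 (min (s.num 4 p) (residual N s p q)) := by
    refine ⟨_, rfl, ?_⟩
    simp only [Cmd.eval, Test.Holds, NumExpr.eval, NatExpr.eval, arcExpr, h25, h26, hs.row p hp]
    unfold residual
    split_ifs with h
    · rw [min_eq_left h.le]
    · rw [min_eq_right (not_lt.1 h)]
  obtain ⟨s', hs', hs''⟩ := e1
  have hpush : pushCmd.eval s = ((((s'.writeNum 3 (p * N + q)
      (s.num 3 (p * N + q) - min (s.num 4 p) (residual N s p q))).writeNum 3 (q * N + p)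
      (s.num 3 (q * N + p) + min (s.num 4 p) (residual N s p q))).writeNum 4 p
      (s.num 4 p - min (s.num 4 p) (residual N s p q))).writeNum 4 q
      (s.num 4 q + min (s.num 4 p) (residual N s p q))) := by
    unfold pushCmd
    rw [Cmd.eval, ← hs', hs'']
    simp [Cmd.eval, NumExpr.eval, NatExpr.eval, arcExpr, h25, h26, hs.row p hp, hs.row q hq,
      Memory.writeNum_num, mul_add_inj hp hq, hpq, Ne.symm hpq]
  rw [hpush, hs'']
  refine ⟨fun a ha b hb => ?_, fun a ha => ?_⟩
  · simp only [residual, pushArc, Memory.writeNum_num, mul_add_inj hb hq, mul_add_inj hb hp]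
    by_cases h1 : a = p ∧ b = q
    · obtain ⟨rfl, rfl⟩ := h1
      simp [hpq]
    · by_cases h2 : a = q ∧ b = p
      · obtain ⟨rfl, rfl⟩ := h2
        simp [Ne.symm hpq]
      · simp [h1, h2]
  · simp only [pushNode, Memory.writeNum_num]
    by_cases h1 : a = p
    · subst h1; simp [hpq]
    · by_cases h2 : a = q
      · subst h2; simp [Ne.symm hpq]
      · simp [h1, h2]

variable [IsOrderedAddMonoid K]

theorem eval_guardedPushCmd {N D p q k : ℕ} {r₀ : ℕ → ℕ → K} {e₀ : ℕ → K} {S : Prop} {s : Memory K}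
    (hs : FlowEnv N D s) (hD : 0 < D) (hp : p < N) (hq : q < N)
    (h24 : s.nat 24 0 = k) (h25 : s.nat 25 0 = p) (h26 : s.nat 26 0 = q)
    (h : PushInvariant N D (N - 1) r₀ e₀ S (D - (k + 1)) p q (residual N s) (s.num 4) (s.nat 10)) :
    PushInvariant N D (N - 1) r₀ e₀ S (D - (k + 1)) p (q + 1) (residual N (guardedPushCmd.eval s))
      ((guardedPushCmd.eval s).num 4) ((guardedPushCmd.eval s).nat 10) := by
  simp only [guardedPushCmd, eval_ifEq]
  simp only [NatExpr.eval, h24, h25, h26, hs.maxLabel]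
  split_ifs with h1 h2
  · have hpq : p ≠ q := by rintro rfl; omega
    obtain ⟨e1, e2⟩ := eval_pushCmd hs hp hq hpq h25 h26
    refine (h.push (by omega) hp hq h1 h2).congr (by omega) hp (by omega) e1 e2 fun a ha => ?_
    rw [(pushCmd.eval_eqOutside s).nat_eq 10 (by decide)]
  · exact h.of_not_admissible (by tauto)
  · exact h.of_not_admissible (by tauto)

theorem eval_pushPhase {N D : ℕ} {r₀ : ℕ → ℕ → K} {e₀ : ℕ → K} {S : Prop} {s : Memory K}
    (hs : FlowEnv N D s) (hD : 0 < D)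
    (h : IsPreflow N D (N - 1) r₀ e₀ (residual N s) (s.num 4) (s.nat 10))
    (hS : S → Settled N D (N - 1) (s.num 4) (s.nat 10)) :
    PushInvariant N D (N - 1) r₀ e₀ S 0 N 0 (residual N (pushPhase.eval s))
      ((pushPhase.eval s).num 4) ((pushPhase.eval s).nat 10) := by
  let I : ℕ → ℕ → ℕ → Memory K → Prop := fun l p j s =>
    PushInvariant N D (N - 1) r₀ e₀ S l p j (residual N s) (s.num 4) (s.nat 10)
  have hI : ∀ {a m : ℕ} {s : Memory K} {l p j : ℕ}, 10 ≠ a → I l p j s →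
      I l p j (s.writeNat a 0 m) := fun ha h => by
    simpa only [I, residual_writeNat, Memory.writeNat_num, Memory.writeNat_nat_of_ne _ _ _ ha] using h
  have key := forLoop_induction (a := 24) (b := 6) (C := .forLoop 25 5 (.forLoop 26 5
    guardedPushCmd)) (s := s) (by decide)
    -- For `k = D` the truncated difference would again be level `0`, so the end of the loop is
    -- described separately: level `0` with all nodes treated.
    (fun k s => (k < D → I (D - (k + 1)) 0 0 s) ∧ (k = D → I 0 N 0 s))
    ⟨fun _ => hI (by decide) (PushInvariant.first_level h (by omega) hS), fun h0 => by omega⟩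
    (by
      intro k hk s₁ hk1 hs1 hI1
      rw [hs.maxLabel] at hk
      replace hI1 := hI1.1 hk
      replace hs1 := hs.of_eqOutside hs1
      have key1 := forLoop_induction (a := 25) (b := 5) (C := .forLoop 26 5 guardedPushCmd)
        (s := s₁) (by decide) (fun p s => I (D - (k + 1)) p 0 s) (hI (by decide) hI1)
        (by
          intro p hp s₂ hp2 hs2 hI2
          have h24 : s₂.nat 24 0 = k := by rw [hs2.nat_eq 24 (by decide), hk1]
          rw [hs1.nodes] at hp
          replace hs2 := hs1.of_eqOutside hs2
          have key2 := forLoop_induction (a := 26) (b := 5) (C := guardedPushCmd)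
            (s := s₂) (by decide) (fun j s => I (D - (k + 1)) p j s) (hI (by decide) hI2)
            (by
              intro j hj s₃ hj3 hs3 hI3
              have h24 : s₃.nat 24 0 = k := by rw [hs3.nat_eq 24 (by decide), h24]
              have h25 : s₃.nat 25 0 = p := by rw [hs3.nat_eq 25 (by decide), hp2]
              rw [hs2.nodes] at hj
              exact hI (by decide) (eval_guardedPushCmd (hs2.of_eqOutside hs3) hD hp hj h24 h25
                hj3 hI3))
          rw [hs2.nodes] at key2
          exact hI (by decide) (PushInvariant.next_node key2))
      rw [hs1.nodes] at key1
      refine ⟨fun hk' => hI (by decide) (PushInvariant.next_level ?_),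
        fun hk' => hI (by decide) ?_⟩
      · rwa [show D - (k + 1 + 1) + 1 = D - (k + 1) by omega]
      · rwa [show D - (k + 1) = 0 by omega] at key1)
  rw [hs.maxLabel] at key
  exact key.2 rfl

omit [IsOrderedAddMonoid K] in
theorem eval_relabelPhase {N D m : ℕ} {r₀ : ℕ → ℕ → K} {e₀ : ℕ → K} {S : Prop} {s : Memory K}
    (hs : FlowEnv N D s) (hN : 0 < N)
    (h : RelabelInvariant N D (N - 1) r₀ e₀ S m 0 (residual N s) (s.num 4) (s.nat 10)) :
    RelabelInvariant N D (N - 1) r₀ e₀ S m N (residual N (relabelPhase.eval s))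
      ((relabelPhase.eval s).num 4) ((relabelPhase.eval s).nat 10) := by
  let I : ℕ → Memory K → Prop := fun j s =>
    RelabelInvariant N D (N - 1) r₀ e₀ S m j (residual N s) (s.num 4) (s.nat 10)
  have hI : ∀ {m : ℕ} {s : Memory K} {j : ℕ}, I j s → I j (s.writeNat 25 0 m) := fun h => by
    simpa only [I, residual_writeNat, Memory.writeNat_num,
      Memory.writeNat_nat_of_ne _ _ _ (show 10 ≠ 25 by decide)] using h
  have key := forLoop_induction (a := 25) (b := 5) (C := relabelCmd) (s := s) (by decide) I (hI h)
    (by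
      intro j hj s₁ hj1 hs1 hI1
      refine hI ?_
      rw [hs.nodes] at hj
      replace hs1 := hs.of_eqOutside hs1
      simp only [relabelCmd, Cmd.eval, Test.Holds, NatExpr.eval, NumExpr.eval, hj1, hs1.nodes,
        hs1.maxLabel, hs1.zero]
      split_ifs with h1 h2 h3
      · refine (hI1.relabel hj (by omega) h2 h3).congr (by omega) (by omega)
          (fun _ _ _ _ => rfl) (fun _ _ => rfl) fun a ha => ?_
        simp [Memory.writeNat_nat]
      · exact hI1.of_not_active hj (by tauto)
      · exact hI1.of_not_active hj (by tauto)
      · exact hI1.of_not_active hj (by omega))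
  rwa [hs.nodes] at key

theorem eval_flowLoop {N D : ℕ} {r₀ : ℕ → ℕ → K} {e₀ : ℕ → K} {s : Memory K}
    (hs : FlowEnv N D s) (hD : 0 < D) (hN : 0 < N)
    (h : IsPreflow N D (N - 1) r₀ e₀ (residual N s) (s.num 4) (s.nat 10)) :
    IsPreflow N D (N - 1) r₀ e₀ (residual N (flowLoop.eval s)) ((flowLoop.eval s).num 4)
      ((flowLoop.eval s).nat 10) ∧
    Settled N D (N - 1) ((flowLoop.eval s).num 4) ((flowLoop.eval s).nat 10) := by
  let I : ℕ → Memory K → Prop := fun m s =>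
    IsPreflow N D (N - 1) r₀ e₀ (residual N s) (s.num 4) (s.nat 10) ∧
    (m ≤ ∑ a ∈ Finset.range N, s.nat 10 a ∨ Settled N D (N - 1) (s.num 4) (s.nat 10))
  have hI : ∀ {a k : ℕ} {s : Memory K} {m : ℕ}, 10 ≠ a → I m s → I m (s.writeNat a 0 k) :=
    fun ha h => by
    simpa only [I, residual_writeNat, Memory.writeNat_num, Memory.writeNat_nat_of_ne _ _ _ ha] using h
  have key := forLoop_induction (a := 22) (b := 5) (C := .forLoop 23 6 (.seq pushPhase
    relabelPhase)) (s := s) (by decide) (fun i s => I (i * D) s)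
    (hI (by decide) ⟨h, .inl (by omega)⟩)
    (by
      intro i hi s₁ _ hs1 hI1
      replace hs1 := hs.of_eqOutside hs1
      have key1 := forLoop_induction (a := 23) (b := 6) (C := .seq pushPhase relabelPhase)
        (s := s₁) (by decide) (fun j s => I (i * D + j) s) (hI (by decide) hI1)
        (by
          intro j hj s₂ _ hs2 hI2
          replace hs2 := hs1.of_eqOutside hs2
          refine hI (by decide) ?_
          rw [Cmd.eval]
          -- `S` is chosen as settledness at the start of this round: a settled preflow stays
          -- settled, otherwise the label sum grows or the preflow becomes settled.
          have hp := eval_pushPhase (S := Settled N D (N - 1) (s₂.num 4) (s₂.nat 10)) hs2 hD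
            hI2.1 id
          have hr := eval_relabelPhase (hs2.of_eqOutside (pushPhase.eval_eqOutside s₂)) hN
            (RelabelInvariant.of_pushInvariant hp le_rfl)
          refine ⟨hr.isPreflow, ?_⟩
          rcases hI2.2 with h1 | h1
          · rcases hr.progress_or with h2 | h2
            · left
              rw [(pushPhase.eval_eqOutside s₂).nat_eq 10 (by decide)] at h2
              omega
            · exact .inr fun p hp => h2 p hp
          · exact .inr (hr.settled h1))
      rw [hs1.maxLabel] at key1
      exact hI (by decide) (by rwa [add_mul, one_mul]))
  rw [hs.nodes] at key
  exact ⟨key.1, key.1.settled_of_le (by omega) hD key.2⟩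

end RandomAccess

/-! # Independent sets in bipartite graphs and cuts -/

namespace IndepCut

open Preflow

variable {K : Type} [LinearOrder K] [AddCommGroup K]

/-- No two vertices of `T` are adjacent. -/
def Indep (adj : ℕ → ℕ → Prop) (T : Finset ℕ) : Prop :=
  ∀ u ∈ T, ∀ v ∈ T, ¬ adj u v

/-- `T` is an independent subset of `A` of maximum weight. -/
structure IsMaxIndep (adj : ℕ → ℕ → Prop) (w : ℕ → K) (A T : Finset ℕ) : Prop where
  subset : T ⊆ A
  indep : Indep adj T
  le : ∀ T' ⊆ A, Indep adj T' → ∑ v ∈ T', w v ≤ ∑ v ∈ T, w v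

theorem exists_isMaxIndep (adj : ℕ → ℕ → Prop) (w : ℕ → K) (A : Finset ℕ) :
    ∃ T, IsMaxIndep adj w A T := by
  classical
  obtain ⟨T, hT, hmax⟩ := Finset.exists_max_image (A.powerset.filter (Indep adj))
    (fun T => ∑ v ∈ T, w v) ⟨∅, by simp [Indep]⟩
  simp only [Finset.mem_filter, Finset.mem_powerset] at hT hmax
  exact ⟨T, hT.1, hT.2, fun T' h1 h2 => hmax T' ⟨h1, h2⟩⟩

theorem IsMaxIndep.sum_eq {adj : ℕ → ℕ → Prop} {w : ℕ → K} {A T T' : Finset ℕ}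
    (h : IsMaxIndep adj w A T) (h' : IsMaxIndep adj w A T') : ∑ v ∈ T, w v = ∑ v ∈ T', w v :=
  le_antisymm (h'.le T h.subset h.indep) (h.le T' h'.subset h'.indep)

/-- The supplies in the network for the subgraph induced by `A`: the supply of the left copy of a
vertex is its weight. -/
def supply (n : ℕ) (w : ℕ → K) (A : Finset ℕ) (p : ℕ) : K :=
  if p < n then (if p ∈ A then w p else 0) else 0

open Classical in
/-- The capacities in the network for the subgraph induced by `A`: the left copy `p` of a vertex is
joined to the right copies `n + v` of its neighbours by arcs of capacity `M`, and there are arcs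
from the right copies to the sink `2 * n`, with the weights as capacities. -/
noncomputable def capacity (n : ℕ) (adj : ℕ → ℕ → Prop) (w : ℕ → K) (M : K) (A : Finset ℕ)
    (p q : ℕ) : K :=
  if p < n then
    (if p ∈ A then (if q < n then 0 else
      if q - n ∈ A then (if adj p (q - n) then M else 0) else 0) else 0)
  -- For the sink `p = 2 * n` the index `p - n` is `n`, which is outside `A` when `A ⊆ Finset.range
  -- n`; so no arc leaves the sink.
  else if q = n + n then (if p - n ∈ A then w (p - n) else 0) else 0

variable {n : ℕ} {adj : ℕ → ℕ → Prop} {w : ℕ → K} {M : K} {A : Finset ℕ}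

omit [LinearOrder K] in
theorem supply_of_mem (hA : A ⊆ Finset.range n) {p : ℕ} (hp : p ∈ A) : supply n w A p = w p := by
  have := Finset.mem_range.1 (hA hp)
  simp [supply, this, hp]

omit [LinearOrder K] in
theorem capacity_left (hA : A ⊆ Finset.range n) {u v : ℕ} (hu : u ∈ A) (hv : v ∈ A)
    (h : adj u v) : capacity n adj w M A u (v + n) = M := by
  have := Finset.mem_range.1 (hA hu)
  simp [capacity, this, hu, hv, h]

omit [LinearOrder K] in
theorem capacity_right {v : ℕ} (hv : v ∈ A) :
    capacity n adj w M A (v + n) (n + n) = w v := by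
  simp [capacity, hv]

theorem supply_nonneg (hw : ∀ v, 0 ≤ w v) (p : ℕ) : 0 ≤ supply n w A p := by
  unfold supply
  split_ifs <;> simp [hw]

theorem capacity_nonneg (hw : ∀ v, 0 ≤ w v) (hM : 0 ≤ M) (p q : ℕ) :
    0 ≤ capacity n adj w M A p q := by
  unfold capacity
  split_ifs <;> simp [hw, hM]

variable [IsOrderedAddMonoid K]

-- The source side consists of the left copies of `T₁` and the right copies of `A \ T₂`. No arc
-- between copies crosses; the cut pays the supplies of `A \ T₁` and the arcs from `A \ T₂` to the
-- sink.
omit [LinearOrder K] [IsOrderedAddMonoid K] in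
theorem cut_le (hA : A ⊆ Finset.range n) {T₁ T₂ : Finset ℕ} (h1 : T₁ ⊆ A)
    (h : ∀ u ∈ T₁, ∀ v ∈ T₂, ¬ adj u v) : ∃ X ⊆ Finset.range (2 * n + 1), 2 * n ∉ X ∧
      cut (2 * n + 1) (capacity n adj w M A) (supply n w A) X =
        ∑ v ∈ A \ T₁, w v + ∑ v ∈ A \ T₂, w v := by
  have hAn : ∀ v ∈ A, v < n := fun v hv => Finset.mem_range.1 (hA hv)
  have hmem : ∀ p, p ∈ T₁ ∪ (A \ T₂).image (· + n) ↔ p ∈ T₁ ∨ ∃ v ∈ A, v ∉ T₂ ∧ v + n = p := by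
    intro p
    simp [and_assoc]
  have hX : T₁ ∪ (A \ T₂).image (· + n) ⊆ Finset.range (2 * n + 1) := by
    intro p hp
    rw [hmem] at hp
    rw [Finset.mem_range]
    rcases hp with hp | ⟨v, hv, -, rfl⟩
    · have := hAn p (h1 hp); omega
    · have := hAn v hv; omega
  have ht : 2 * n ∉ T₁ ∪ (A \ T₂).image (· + n) := by
    rw [hmem]
    rintro (hp | ⟨v, hv, -, h3⟩)
    · have := hAn _ (h1 hp); omega
    · have := hAn v hv; omega
  refine ⟨_, hX, ht, ?_⟩
  unfold cut
  congr 1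
  · rw [← Finset.sum_congr rfl (fun p hp => supply_of_mem hA (Finset.mem_sdiff.1 hp).1)]
    symm
    refine Finset.sum_subset (fun p hp => ?_) fun p hp hp' => ?_
    · have h3 := Finset.mem_sdiff.1 hp
      have h4 := hAn p h3.1
      rw [Finset.mem_sdiff, hmem, Finset.mem_range]
      refine ⟨by omega, ?_⟩
      rintro (h5 | ⟨v, -, -, h5⟩)
      · exact h3.2 h5
      · omega
    · rw [Finset.mem_sdiff, hmem] at hp
      have h3 : p ∉ A := fun h3 => hp' (Finset.mem_sdiff.2 ⟨h3, fun h4 => hp.2 (.inl h4)⟩)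
      simp [supply, h3]
  · rw [Finset.sum_comm, Finset.sum_union]
    · rw [Finset.sum_eq_zero, zero_add, Finset.sum_image (fun a _ b _ => Nat.add_right_cancel)]
      · refine Finset.sum_congr rfl fun v hv => ?_
        rw [Finset.sum_eq_single (n + n)]
        · exact capacity_right (Finset.mem_sdiff.1 hv).1
        · intro p _ hp
          simp [capacity, hp]
        · intro h3
          exact absurd (Finset.mem_sdiff.2 ⟨Finset.mem_range.2 (by omega),
            by rwa [← two_mul]⟩) h3
      · intro u hu
        refine Finset.sum_eq_zero fun p hp => ?_
        rw [Finset.mem_sdiff, hmem] at hp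
        unfold capacity
        have hun := hAn u (h1 hu)
        split_ifs with h3 h4 h5 h6
        · rfl
        · refine absurd h6 (h u hu _ ?_)
          by_contra h8
          exact hp.2 (.inr ⟨_, h5, h8, by omega⟩)
        all_goals rfl
    · rw [Finset.disjoint_left]
      intro p hp hp'
      obtain ⟨v, hv, hvp⟩ := Finset.mem_image.1 hp'
      have := hAn p (h1 hp)
      omega

/-- Let `T₁` be the vertices with left copy in `X` and `T₂` those with right copy outside `X`. If
there is an edge between them, an arc of capacity `M` crosses the cut, and then the pair `(A, ∅)`,
which costs only the weight of `A`, will do. -/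
theorem le_cut (hA : A ⊆ Finset.range n) (hw : ∀ v, 0 ≤ w v) (hM : ∑ v ∈ A, w v ≤ M)
    {X : Finset ℕ} (ht : 2 * n ∉ X) :
    ∃ T₁ ⊆ A, ∃ T₂ ⊆ A, (∀ u ∈ T₁, ∀ v ∈ T₂, ¬ adj u v) ∧
      ∑ v ∈ A \ T₁, w v + ∑ v ∈ A \ T₂, w v ≤
        cut (2 * n + 1) (capacity n adj w M A) (supply n w A) X := by
  have hAn : ∀ v ∈ A, v < n := fun v hv => Finset.mem_range.1 (hA hv)
  have hM0 : 0 ≤ M := (Finset.sum_nonneg fun v _ => hw v).trans hM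
  have hc := capacity_nonneg (n := n) (adj := adj) (A := A) hw hM0
  have hs := supply_nonneg (n := n) (A := A) hw
  by_cases h : ∀ u ∈ A.filter (· ∈ X), ∀ v ∈ A.filter (fun v => v + n ∉ X), ¬ adj u v
  · refine ⟨_, Finset.filter_subset _ _, _, Finset.filter_subset _ _, h, ?_⟩
    refine add_le_add ?_ ?_
    · rw [← Finset.sum_congr rfl (fun p hp => supply_of_mem hA (Finset.mem_sdiff.1 hp).1)]
      refine Finset.sum_le_sum_of_subset_of_nonneg (fun p hp => ?_) fun p _ _ => hs p
      simp only [Finset.mem_sdiff, Finset.mem_filter, not_and] at hp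
      have := hAn p hp.1
      exact Finset.mem_sdiff.2 ⟨Finset.mem_range.2 (by omega), hp.2 hp.1⟩
    · have h1 : ∑ q ∈ X, capacity n adj w M A q (n + n) ≤
          ∑ p ∈ Finset.range (2 * n + 1) \ X, ∑ q ∈ X, capacity n adj w M A q p :=
        Finset.single_le_sum (f := fun p => ∑ q ∈ X, capacity n adj w M A q p)
          (fun p _ => Finset.sum_nonneg fun q _ => hc q p)
          (Finset.mem_sdiff.2 ⟨Finset.mem_range.2 (by omega), by rwa [← two_mul]⟩)
      refine le_trans ?_ h1
      rw [← Finset.sum_congr rfl (fun v hv => capacity_right (n := n) (adj := adj) (M := M)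
        (Finset.mem_sdiff.1 hv).1),
        ← Finset.sum_image (s := A \ A.filter fun v => v + n ∉ X) (g := (· + n))
          (f := fun q => capacity n adj w M A q (n + n)) (fun a _ b _ => Nat.add_right_cancel)]
      refine Finset.sum_le_sum_of_subset_of_nonneg (fun p hp => ?_) fun p _ _ => hc _ _
      obtain ⟨v, hv, rfl⟩ := Finset.mem_image.1 hp
      simp only [Finset.mem_sdiff, Finset.mem_filter, not_and, not_not] at hv
      exact hv.2 hv.1
  · push Not at h
    obtain ⟨u, hu, v, hv, huv⟩ := h
    rw [Finset.mem_filter] at hu hv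
    refine ⟨A, subset_rfl, ∅, Finset.empty_subset _, by simp, ?_⟩
    rw [Finset.sdiff_self, Finset.sum_empty, zero_add, Finset.sdiff_empty]
    refine hM.trans ?_
    have hvn := hAn v hv.1
    have hvm : v + n ∈ Finset.range (2 * n + 1) \ X :=
      Finset.mem_sdiff.2 ⟨Finset.mem_range.2 (by omega), hv.2⟩
    calc M = capacity n adj w M A u (v + n) := (capacity_left hA hu.1 hv.1 huv).symm
      _ ≤ ∑ q ∈ X, capacity n adj w M A q (v + n) :=
        Finset.single_le_sum (f := fun q => capacity n adj w M A q (v + n)) (fun q _ => hc q _) hu.2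
      _ ≤ ∑ p ∈ Finset.range (2 * n + 1) \ X, ∑ q ∈ X, capacity n adj w M A q p :=
        Finset.single_le_sum (f := fun p => ∑ q ∈ X, capacity n adj w M A q p)
          (fun p _ => Finset.sum_nonneg fun q _ => hc q p) hvm
      _ ≤ _ := le_add_of_nonneg_left (Finset.sum_nonneg fun p _ => hs p)

/-- In a bipartite graph, two sets without edges between them have together at most twice the
maximum weight of an independent set. -/
theorem sum_add_sum_le (hsymm : ∀ u v, adj u v → adj v u) (c : ℕ → Bool)
    (hc : ∀ u v, adj u v → c u ≠ c v) {T T₁ T₂ : Finset ℕ} (hT : IsMaxIndep adj w A T)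
    (h1 : T₁ ⊆ A) (h2 : T₂ ⊆ A) (h : ∀ u ∈ T₁, ∀ v ∈ T₂, ¬ adj u v) :
    ∑ v ∈ T₁, w v + ∑ v ∈ T₂, w v ≤ ∑ v ∈ T, w v + ∑ v ∈ T, w v := by
  -- Vertices of `T₁` of one colour and vertices of `T₂` of the other colour form an independent
  -- set. The two choices of `b` use every vertex of `T₁` and of `T₂` once.
  have key : ∀ b : Bool, ∑ v ∈ T₁.filter (fun v => c v = b), w v +
      ∑ v ∈ T₂.filter (fun v => ¬ c v = b), w v ≤ ∑ v ∈ T, w v := by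
    intro b
    rw [← Finset.sum_union]
    · refine hT.le _ ?_ ?_
      · exact Finset.union_subset ((Finset.filter_subset _ _).trans h1)
          ((Finset.filter_subset _ _).trans h2)
      · intro u hu v hv huv
        have h3 := hc u v huv
        simp only [Finset.mem_union, Finset.mem_filter] at hu hv
        rcases hu with hu | hu <;> rcases hv with hv | hv
        · exact h3 (hu.2.trans hv.2.symm)
        · exact h u hu.1 v hv.1 huv
        · exact h v hv.1 u hu.1 (hsymm _ _ huv)
        · exact h3 (by
            have h4 := hu.2
            have h5 := hv.2
            cases c u <;> cases c v <;> cases b <;> simp_all)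
    · rw [Finset.disjoint_left]
      intro v hv hv'
      exact (Finset.mem_filter.1 hv').2 (Finset.mem_filter.1 hv).2
  have e1 := Finset.sum_filter_add_sum_filter_not T₁ (fun v => c v = true) w
  have e2 := Finset.sum_filter_add_sum_filter_not T₂ (fun v => c v = true) w
  have k1 := key true
  have k2 := key false
  simp only [Bool.not_eq_true, Bool.not_eq_false] at e1 e2 k1 k2
  rw [← e1, ← e2]
  calc _ = _ := by abel
    _ ≤ _ := add_le_add k1 k2

/-- The maximum weight of an independent set of a bipartite graph is determined by the maximum
flow in the bipartite double cover. -/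
theorem sum_sub_excess {D : ℕ} {r : ℕ → ℕ → K} {e : ℕ → K} {d : ℕ → ℕ}
    (hsymm : ∀ u v, adj u v → adj v u) (c : ℕ → Bool) (hc : ∀ u v, adj u v → c u ≠ c v)
    (hA : A ⊆ Finset.range n) (hw : ∀ v, 0 ≤ w v) (hM : ∑ v ∈ A, w v ≤ M)
    (h : IsPreflow (2 * n + 1) D (2 * n) (capacity n adj w M A) (supply n w A) r e d)
    (hs : Settled (2 * n + 1) D (2 * n) e d) (hD : 2 * n + 1 < D) {T : Finset ℕ}
    (hT : IsMaxIndep adj w A T) :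
    ∑ v ∈ A, (w v + w v) - e (2 * n) = ∑ v ∈ T, w v + ∑ v ∈ T, w v := by
  have hsd : ∀ S ⊆ A, ∑ v ∈ A \ S, w v = ∑ v ∈ A, w v - ∑ v ∈ S, w v := fun S hS =>
    eq_sub_of_add_eq (Finset.sum_sdiff hS)
  rw [Finset.sum_add_distrib]
  refine le_antisymm ?_ ?_
  · obtain ⟨X, -, htX, hcut⟩ := h.exists_cut (by omega) hD hs
    obtain ⟨T₁, h1, T₂, h2, hcr, hle⟩ := le_cut (adj := adj) hA hw hM htX
    rw [← hcut, hsd T₁ h1, hsd T₂ h2] at hle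
    refine le_trans ?_ (sum_add_sum_le hsymm c hc hT h1 h2 hcr)
    rw [sub_le_iff_le_add, ← sub_le_iff_le_add']
    calc _ = _ := by abel
      _ ≤ _ := hle
  -- Weak duality for the cut that belongs to the pair `(T, T)`.
  · obtain ⟨X, hX, htX, hcut⟩ := cut_le (adj := adj) (w := w) (M := M) hA hT.subset hT.indep
    have hle := h.excess_sink_le (by omega) hX htX
    rw [hcut, hsd T hT.subset] at hle
    rw [le_sub_iff_add_le, ← le_sub_iff_add_le']
    calc _ ≤ _ := hle
      _ = _ := by abel

end IndepCut

/-! # The independent set program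

The natural number array `0` holds the number `n` of vertices at position `0`, array `1` the
adjacency matrix, array `7` the multiples of `n`, and array `9` the indicator function of a set of
vertices. The array `0` of elements of `K` holds the weights, array `6` the total weight at
position `0`. -/

namespace RandomAccess

open Cmd Preflow IndepCut

/-- Compute the capacity of the arc given by the counters `22` and `23`. -/
def capacityCmd : Cmd :=
  .seq (.setNum 3 (arcExpr (cell 22) (cell 23)) (.get 8 (.const 0)))
  (.branch (.natLt (cell 22) (cell 0))
    (ifEq (.get 9 (cell 22)) (.const 1)
      (.branch (.natLt (cell 23) (cell 0)) .skip
        (ifEq (.get 9 (.sub (cell 23) (cell 0))) (.const 1)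
          (.branch (.natLt (.const 0) (.get 1 (.add (.get 7 (cell 22)) (.sub (cell 23) (cell 0)))))
            (.setNum 3 (arcExpr (cell 22) (cell 23)) (.get 6 (.const 0))) .skip))))
    (ifEq (cell 23) (.add (cell 0) (cell 0))
      (ifEq (.get 9 (.sub (cell 22) (cell 0))) (.const 1)
        (.setNum 3 (arcExpr (cell 22) (cell 23)) (.get 0 (.sub (cell 22) (cell 0)))))))

/-- Set the label and compute the supply of the node given by the counter `22`. -/
def supplyCmd : Cmd :=
  .seq (.setNat 10 (cell 22) (.const 0))
  (.seq (.setNum 4 (cell 22) (.get 8 (.const 0)))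
  (.branch (.natLt (cell 22) (cell 0))
    (ifEq (.get 9 (cell 22)) (.const 1) (.setNum 4 (cell 22) (.get 0 (cell 22)))) .skip))

/-- Set up the network. -/
def networkCmd : Cmd :=
  .forLoop 22 5 (.seq supplyCmd (.forLoop 23 5 capacityCmd))

/-- Compute twice the total weight of the set of vertices. -/
def doubleWeightCmd : Cmd :=
  .seq (.setNum 7 (.const 0) (.get 8 (.const 0)))
  (.forLoop 22 0 (ifEq (.get 9 (cell 22)) (.const 1) (.setNum 7 (.const 0)
    (.add (.get 7 (.const 0)) (.add (.get 0 (cell 22)) (.get 0 (cell 22)))))))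

/-- Compute twice the maximum weight of an independent subset of the set of vertices. -/
def measureCmd : Cmd :=
  .seq networkCmd (.seq flowLoop (.seq doubleWeightCmd
    (.setNum 7 (.const 0) (.sub (.get 7 (.const 0)) (.get 4 (.add (cell 0) (cell 0)))))))

/-- Remove the vertex given by the counter `21` if this does not decrease the maximum weight of an
independent subset. -/
def removeCmd : Cmd :=
  ifEq (.get 9 (cell 21)) (.const 1)
    (.seq (.setNat 9 (cell 21) (.const 0))
    (.seq measureCmd
    -- Array `5` keeps the doubled maximum for the original set. Doubled values are compared
    -- throughout, so no halving is needed.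
    (.branch (.numLt (.get 7 (.const 0)) (.get 5 (.const 0)))
      (.setNat 9 (cell 21) (.const 1)) .skip)))

/-- Replace the set of vertices by an independent subset of maximum weight. -/
def indepCmd : Cmd :=
  .seq measureCmd (.seq (.setNum 5 (.const 0) (.get 7 (.const 0))) (.forLoop 21 0 removeCmd))

variable {K : Type} [LinearOrder K] [AddCommGroup K]

/-- The constants the independent set program uses. -/
structure GraphEnv (n : ℕ) (adj : ℕ → ℕ → Prop) (w : ℕ → K) (s : Memory K) : Prop where
  flow : FlowEnv (2 * n + 1) (2 * n + 2) s
  vertices : s.nat 0 0 = n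
  row : ∀ p < n, s.nat 7 p = p * n
  adj_iff : ∀ u < n, ∀ v < n, 0 < s.nat 1 (u * n + v) ↔ adj u v
  weight : ∀ v < n, s.num 0 v = w v
  total : s.num 6 0 = ∑ v ∈ Finset.range n, w v

omit [LinearOrder K] in
theorem GraphEnv.of_eqOutside {n : ℕ} {adj : ℕ → ℕ → Prop} {w : ℕ → K} {s s' : Memory K}
    (h : GraphEnv n adj w s) {l l' : List ℕ} (hs : s.EqOutside l l' s')
    (h0 : 0 ∉ l := by decide) (h1 : 1 ∉ l := by decide) (h5 : 5 ∉ l := by decide)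
    (h6 : 6 ∉ l := by decide) (h7 : 7 ∉ l := by decide) (h8 : 8 ∉ l := by decide)
    (h0' : 0 ∉ l' := by decide) (h6' : 6 ∉ l' := by decide) (h8' : 8 ∉ l' := by decide) :
    GraphEnv n adj w s' := by
  refine ⟨h.flow.of_eqOutside hs h5 h6 h8 h8', ?_, fun p hp => ?_, fun u hu v hv => ?_,
    fun v hv => ?_, ?_⟩
  · rw [hs.nat_eq 0 h0, h.vertices]
  · rw [hs.nat_eq 7 h7, h.row p hp]
  · rw [hs.nat_eq 1 h1, h.adj_iff u hu v hv]
  · rw [hs.num_eq 0 h0', h.weight v hv]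
  · rw [hs.num_eq 6 h6', h.total]

/-- The natural number array `9` holds the indicator function of `A`. -/
def HasSet (s : Memory K) (A : Finset ℕ) : Prop :=
  ∀ v, s.nat 9 v = if v ∈ A then 1 else 0

omit [LinearOrder K] [AddCommGroup K] in
theorem HasSet.eq_one_iff {s : Memory K} {A : Finset ℕ} (h : HasSet s A) (v : ℕ) :
    s.nat 9 v = 1 ↔ v ∈ A := by
  rw [h v]; split_ifs with h1 <;> simp [h1]

omit [LinearOrder K] [AddCommGroup K] in
theorem HasSet.of_eqOutside {s s' : Memory K} {A : Finset ℕ} (h : HasSet s A) {l l' : List ℕ}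
    (hs : s.EqOutside l l' s') (h9 : 9 ∉ l := by decide) : HasSet s' A := fun v => by
  rw [hs.nat_eq 9 h9, h v]

variable {n : ℕ} {adj : ℕ → ℕ → Prop} {w : ℕ → K} {A : Finset ℕ}

/-- The cell is first cleared and then possibly overwritten, hence the two forms; they have the same
effect on the residual capacities. -/
theorem eval_capacityCmd {s : Memory K} {p q : ℕ} (hs : GraphEnv n adj w s) (hA : HasSet s A)
    (hAn : A ⊆ Finset.range n) (hp : p < 2 * n + 1) (h22 : s.nat 22 0 = p)
    (h23 : s.nat 23 0 = q) :
    capacityCmd.eval s = s.writeNum 3 (p * (2 * n + 1) + q)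
      (capacity n adj w (∑ v ∈ Finset.range n, w v) A p q) ∨
    ∃ x, capacityCmd.eval s = (s.writeNum 3 (p * (2 * n + 1) + q) x).writeNum 3
      (p * (2 * n + 1) + q) (capacity n adj w (∑ v ∈ Finset.range n, w v) A p q) := by
  have hAn' : ∀ v ∈ A, v < n := fun v hv => Finset.mem_range.1 (hAn hv)
  simp only [capacityCmd, Cmd.eval, eval_ifEq, Test.Holds, NatExpr.eval, NumExpr.eval, arcExpr,
    h22, h23, hs.vertices, hs.flow.zero, hs.flow.row p hp, Memory.writeNum_nat, hA.eq_one_iff]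
  unfold capacity
  by_cases h1 : p < n
  · rw [if_pos h1, if_pos h1, hs.row p h1]
    by_cases h2 : p ∈ A
    · rw [if_pos h2, if_pos h2]
      by_cases h3 : q < n
      · rw [if_pos h3, if_pos h3]; exact .inl rfl
      · rw [if_neg h3, if_neg h3]
        by_cases h4 : q - n ∈ A
        · rw [if_pos h4, if_pos h4]
          have hadj := hs.adj_iff p h1 (q - n) (hAn' _ h4)
          by_cases h5 : adj p (q - n)
          · rw [if_pos (hadj.2 h5), if_pos h5]
            right
            refine ⟨0, ?_⟩
            rw [Memory.writeNum_num_of_ne _ _ _ (by decide), hs.total]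
          · rw [if_neg fun h6 => h5 (hadj.1 h6), if_neg h5]; exact .inl rfl
        · rw [if_neg h4, if_neg h4]; exact .inl rfl
    · rw [if_neg h2, if_neg h2]; exact .inl rfl
  · rw [if_neg h1, if_neg h1]
    by_cases h2 : q = n + n
    · rw [if_pos h2, if_pos h2]
      by_cases h3 : p - n ∈ A
      · rw [if_pos h3, if_pos h3]
        right
        refine ⟨0, ?_⟩
        rw [Memory.writeNum_num_of_ne _ _ _ (by decide), hs.weight _ (hAn' _ h3)]
      · rw [if_neg h3, if_neg h3]; exact .inl rfl
    · rw [if_neg h2, if_neg h2]; exact .inl rfl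

theorem residual_eval_capacityCmd {s : Memory K} {p q : ℕ} (hs : GraphEnv n adj w s)
    (hA : HasSet s A) (hAn : A ⊆ Finset.range n) (hp : p < 2 * n + 1) (hq : q < 2 * n + 1)
    (h22 : s.nat 22 0 = p) (h23 : s.nat 23 0 = q) (a b : ℕ) (hb : b < 2 * n + 1) :
    residual (2 * n + 1) (capacityCmd.eval s) a b =
      if a = p ∧ b = q then capacity n adj w (∑ v ∈ Finset.range n, w v) A p q
      else residual (2 * n + 1) s a b := by
  rcases eval_capacityCmd hs hA hAn hp h22 h23 with h | ⟨x, h⟩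
  · rw [h]
    simp [residual, Memory.writeNum_num, mul_add_inj hb hq]
  · rw [h]
    simp only [residual, Memory.writeNum_num, mul_add_inj hb hq, true_and]
    split_ifs <;> rfl

theorem eval_supplyCmd {s : Memory K} {p : ℕ} (hs : GraphEnv n adj w s) (hA : HasSet s A)
    (h22 : s.nat 22 0 = p) (a : ℕ) :
    (supplyCmd.eval s).nat 10 a = (if a = p then 0 else s.nat 10 a) ∧
    (supplyCmd.eval s).num 4 a = (if a = p then supply n w A p else s.num 4 a) := by
  simp only [supplyCmd, Cmd.eval, eval_ifEq, Test.Holds, NatExpr.eval, NumExpr.eval,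
    Memory.writeNum_nat, Memory.writeNat_num, Memory.writeNat_nat, h22, hs.vertices,
    hs.flow.zero]
  simp only [Nat.reduceEqDiff, false_and, if_false, hA.eq_one_iff, OfNat.zero_ne_ofNat]
  unfold supply
  split_ifs with h1 h2 h3 h4 h5 <;>
    simp [Memory.writeNum_num, Memory.writeNat_nat, *]
  exact hs.weight _ (by assumption)

theorem eval_networkCmd {s : Memory K} (hs : GraphEnv n adj w s) (hA : HasSet s A)
    (hAn : A ⊆ Finset.range n) :
    ∀ a < 2 * n + 1, (networkCmd.eval s).nat 10 a = 0 ∧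
      (networkCmd.eval s).num 4 a = supply n w A a ∧
      ∀ b < 2 * n + 1, residual (2 * n + 1) (networkCmd.eval s) a b =
        capacity n adj w (∑ v ∈ Finset.range n, w v) A a b := by
  let I : ℕ → Memory K → Prop := fun p s => ∀ a < p, s.nat 10 a = 0 ∧
    s.num 4 a = supply n w A a ∧ ∀ b < 2 * n + 1, residual (2 * n + 1) s a b =
        capacity n adj w (∑ v ∈ Finset.range n, w v) A a b
  have key := forLoop_induction (a := 22) (b := 5) (C := .seq supplyCmd (.forLoop 23 5
    capacityCmd)) (s := s) (by decide) I (fun a ha => absurd ha (by omega))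
    (by
      intro p hp s₁ h22 hs1 hI1
      rw [hs.flow.nodes] at hp
      replace hA := hA.of_eqOutside hs1
      replace hs1 := hs.of_eqOutside hs1
      rw [Cmd.eval]
      have hsup := eval_supplyCmd hs1 hA h22
      have hf := supplyCmd.eval_eqOutside s₁
      generalize supplyCmd.eval s₁ = s₂ at *
      have hf' := (Cmd.forLoop 23 5 capacityCmd).eval_eqOutside s₂
      have hs2 := hs1.of_eqOutside hf
      replace hA := hA.of_eqOutside hf
      have h22' : s₂.nat 22 0 = p := by rw [hf.nat_eq 22 (by decide), h22]
      have hr : residual (2 * n + 1) s₂ = residual (2 * n + 1) s₁ := by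
        funext a b
        unfold residual
        rw [hf.num_eq 3 (by decide)]
      have key1 := forLoop_induction (a := 23) (b := 5) (C := capacityCmd) (s := s₂) (by decide)
        (fun q s => ∀ a b, b < 2 * n + 1 → (a < p ∨ a = p ∧ b < q) →
          residual (2 * n + 1) s a b = capacity n adj w (∑ v ∈ Finset.range n, w v) A a b)
        (fun a b hb hab => by
          rw [residual_writeNat, hr]
          exact (hI1 a (by omega)).2.2 b hb)
        (by
          intro q hq s₃ h23 hs3 hI3 a b hb hab
          rw [hs2.flow.nodes] at hq
          have h22 : s₃.nat 22 0 = p := by rw [hs3.nat_eq 22 (by decide), h22']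
          rw [residual_writeNat, residual_eval_capacityCmd (hs2.of_eqOutside hs3)
            (hA.of_eqOutside hs3) hAn hp hq h22 h23 a b hb]
          split_ifs with h1
          · rw [h1.1, h1.2]
          · exact hI3 a b hb (by omega))
      rw [hs2.flow.nodes] at key1
      generalize (Cmd.forLoop 23 5 capacityCmd).eval s₂ = s₃ at *
      intro a ha
      rw [Memory.writeNat_nat_of_ne _ _ _ (by decide), Memory.writeNat_num, residual_writeNat,
        hf'.nat_eq 10 (by decide), hf'.num_eq 4 (by decide), (hsup a).1, (hsup a).2]
      refine ⟨?_, ?_, fun b hb => key1 a b hb (by omega)⟩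
      · split_ifs with h1
        · rfl
        · exact (hI1 a (by omega)).1
      · split_ifs with h1
        · rw [h1]
        · exact (hI1 a (by omega)).2.1)
  rw [hs.flow.nodes] at key
  exact key

theorem eval_doubleWeightCmd {s : Memory K} (hs : GraphEnv n adj w s) (hA : HasSet s A)
    (hAn : A ⊆ Finset.range n) :
    (doubleWeightCmd.eval s).num 7 0 = ∑ v ∈ A, (w v + w v) := by
  unfold doubleWeightCmd
  rw [Cmd.eval]
  have hf := (Cmd.setNum 7 (.const 0) (.get 8 (.const 0))).eval_eqOutside s
  have h7 : ((Cmd.setNum 7 (.const 0) (.get 8 (.const 0))).eval s).num 7 0 = 0 := by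
    simp [Cmd.eval, Memory.writeNum_num, NatExpr.eval, NumExpr.eval, hs.flow.zero]
  generalize (Cmd.setNum 7 (.const 0) (.get 8 (.const 0))).eval s = s₁ at *
  replace hs := hs.of_eqOutside hf
  replace hA := hA.of_eqOutside hf
  have key := forLoop_induction (a := 22) (b := 0) (C := ifEq (.get 9 (cell 22)) (.const 1)
    (.setNum 7 (.const 0) (.add (.get 7 (.const 0)) (.add (.get 0 (cell 22)) (.get 0 (cell 22))))))
    (s := s₁) (by decide)
    (fun i s => s.num 7 0 = ∑ v ∈ Finset.range i, if v ∈ A then w v + w v else 0) (by simpa using h7)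
    (by
      intro i hi s₂ h22 hf2 hI
      rw [hs.vertices] at hi
      replace hA := hA.of_eqOutside hf2
      replace hs := hs.of_eqOutside hf2
      rw [Memory.writeNat_num, Finset.sum_range_succ, eval_ifEq]
      simp only [NatExpr.eval, h22, hA.eq_one_iff]
      split_ifs
      · simp [Cmd.eval, Memory.writeNum_num, NatExpr.eval, NumExpr.eval, h22, hs.weight i hi, hI]
      · rw [hI, add_zero])
  rw [hs.vertices] at key
  rw [key, Finset.sum_ite_mem, Finset.inter_eq_right.2 hAn]

variable [IsOrderedAddMonoid K]

/-- The graph is bipartite and the weights are nonnegative. -/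
structure IsBipartiteWeighted (adj : ℕ → ℕ → Prop) (w : ℕ → K) : Prop where
  symm : ∀ u v, adj u v → adj v u
  weight_nonneg : ∀ v, 0 ≤ w v
  exists_coloring : ∃ c : ℕ → Bool, ∀ u v, adj u v → c u ≠ c v

theorem eval_measureCmd {s : Memory K} (hg : IsBipartiteWeighted adj w) (hs : GraphEnv n adj w s)
    (hA : HasSet s A) (hAn : A ⊆ Finset.range n) {T : Finset ℕ} (hT : IsMaxIndep adj w A T) :
    (measureCmd.eval s).num 7 0 = ∑ v ∈ T, w v + ∑ v ∈ T, w v := by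
  obtain ⟨c, hc⟩ := hg.exists_coloring
  unfold measureCmd
  rw [Cmd.eval, Cmd.eval, Cmd.eval]
  have hnet := eval_networkCmd hs hA hAn
  have hf1 := networkCmd.eval_eqOutside s
  generalize networkCmd.eval s = s₁ at *
  replace hs := hs.of_eqOutside hf1
  replace hA := hA.of_eqOutside hf1
  have hle : ∑ v ∈ A, w v ≤ ∑ v ∈ Finset.range n, w v :=
    Finset.sum_le_sum_of_subset_of_nonneg hAn fun v _ _ => hg.weight_nonneg v
  have hM : 0 ≤ ∑ v ∈ Finset.range n, w v := Finset.sum_nonneg fun v _ => hg.weight_nonneg v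
  -- Before any push, capacities and supplies form a preflow, and the zero labelling is valid for
  -- every set of residual arcs.
  have hpre : IsPreflow (2 * n + 1) (2 * n + 2) (2 * n + 1 - 1)
      (capacity n adj w (∑ v ∈ Finset.range n, w v) A) (supply n w A) (residual (2 * n + 1) s₁)
      (s₁.num 4) (s₁.nat 10) := by
    refine IsPreflow.congr (r := capacity n adj w (∑ v ∈ Finset.range n, w v) A)
      (e := supply n w A) (d := fun _ => 0) ?_ (by omega)
      (fun p hp q hq => (hnet p hp).2.2 q hq) (fun p hp => (hnet p hp).2.1)
      (fun p hp => (hnet p hp).1)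
    exact ⟨fun p _ q _ => capacity_nonneg hg.weight_nonneg hM p q,
      fun p _ => supply_nonneg hg.weight_nonneg p, fun _ _ _ _ => rfl, fun _ _ => rfl,
      fun _ _ _ _ _ => by omega, fun _ _ => by omega, rfl⟩
  obtain ⟨hpre2, hset⟩ := eval_flowLoop hs.flow (by omega) (by omega) hpre
  have hf2 := flowLoop.eval_eqOutside s₁
  generalize flowLoop.eval s₁ = s₂ at *
  replace hs := hs.of_eqOutside hf2
  replace hA := hA.of_eqOutside hf2
  have hdw := eval_doubleWeightCmd hs hA hAn
  have hf3 := doubleWeightCmd.eval_eqOutside s₂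
  generalize doubleWeightCmd.eval s₂ = s₃ at *
  replace hs := hs.of_eqOutside hf3
  rw [Nat.add_sub_cancel] at hpre2 hset
  rw [← sum_sub_excess hg.symm c hc hAn hg.weight_nonneg hle hpre2 hset (by omega) hT, ← hdw,
    ← hf3.num_eq 4 (by decide)]
  simp [Cmd.eval, Memory.writeNum_num, NatExpr.eval, NumExpr.eval, hs.vertices, two_mul]

/-! ### Extraction of a maximum independent set by deleting vertices. -/

/-- Invariant for removing vertices from the set `A₀`: the remaining set `A` contains a maximum
independent subset of `A₀`, and every such subset contains all vertices below `i` in `A`. -/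
structure RemoveInvariant (adj : ℕ → ℕ → Prop) (w : ℕ → K) (A₀ : Finset ℕ) (i : ℕ)
    (A : Finset ℕ) : Prop where
  subset : A ⊆ A₀
  exists_max : ∃ T ⊆ A, IsMaxIndep adj w A₀ T
  necessary : ∀ u < i, u ∈ A → ∀ T ⊆ A.erase u, ¬ IsMaxIndep adj w A₀ T

-- A maximum set `T ⊆ A` that misses a vertex `u` of `A` would be contained in `A.erase u`, against
-- the necessity of `u`. So `A` equals `T`.
omit [IsOrderedAddMonoid K] in
theorem RemoveInvariant.isMaxIndep {A₀ : Finset ℕ} (h : RemoveInvariant adj w A₀ n A)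
    (hA : A₀ ⊆ Finset.range n) : IsMaxIndep adj w A₀ A := by
  obtain ⟨T, hT, hmax⟩ := h.exists_max
  suffices h1 : A ⊆ T by rwa [← hT.antisymm h1] at *
  intro u hu
  by_contra hu'
  exact h.necessary u (Finset.mem_range.1 (hA (h.subset hu))) hu T
    (fun v hv => Finset.mem_erase.2 ⟨fun h2 => hu' (h2 ▸ hv), hT hv⟩) hmax

omit [IsOrderedAddMonoid K] in
theorem RemoveInvariant.skip {A₀ : Finset ℕ} {i : ℕ} (h : RemoveInvariant adj w A₀ i A)
    (hi : i ∈ A → ∀ T ⊆ A.erase i, ¬ IsMaxIndep adj w A₀ T) :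
    RemoveInvariant adj w A₀ (i + 1) A := by
  refine ⟨h.subset, h.exists_max, fun u hu => ?_⟩
  rcases Nat.lt_succ_iff_lt_or_eq.1 hu with h1 | rfl
  · exact h.necessary u h1
  · exact hi

omit [IsOrderedAddMonoid K] in
theorem RemoveInvariant.remove {A₀ : Finset ℕ} {i : ℕ} (h : RemoveInvariant adj w A₀ i A)
    (hi : ∃ T ⊆ A.erase i, IsMaxIndep adj w A₀ T) :
    RemoveInvariant adj w A₀ (i + 1) (A.erase i) := by
  refine ⟨(Finset.erase_subset _ _).trans h.subset, hi, fun u hu hui T hT => ?_⟩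
  rw [Finset.mem_erase] at hui
  exact h.necessary u (by omega) hui.2 T
    (hT.trans (Finset.erase_subset_erase _ (Finset.erase_subset _ _)))

omit [LinearOrder K] [AddCommGroup K] [IsOrderedAddMonoid K] in
theorem HasSet.erase {s : Memory K} (h : HasSet s A) (i : ℕ) :
    HasSet (s.writeNat 9 i 0) (A.erase i) := fun v => by
  rw [Memory.writeNat_nat, h v]
  by_cases h1 : v = i <;> simp [h1]

omit [LinearOrder K] [AddCommGroup K] [IsOrderedAddMonoid K] in
theorem HasSet.insert {s : Memory K} (h : HasSet s A) (i : ℕ) :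
    HasSet (s.writeNat 9 i 1) (insert i A) := fun v => by
  rw [Memory.writeNat_nat, h v]
  by_cases h1 : v = i <;> simp [h1]

theorem eval_removeCmd {s : Memory K} {A₀ T₀ : Finset ℕ} {i : ℕ} (hg : IsBipartiteWeighted adj w)
    (hs : GraphEnv n adj w s) (hA₀ : A₀ ⊆ Finset.range n) (h21 : s.nat 21 0 = i)
    (hT₀ : IsMaxIndep adj w A₀ T₀) (h5 : s.num 5 0 = ∑ v ∈ T₀, w v + ∑ v ∈ T₀, w v)
    (h : ∃ A, HasSet s A ∧ RemoveInvariant adj w A₀ i A) :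
    ∃ A, HasSet (removeCmd.eval s) A ∧ RemoveInvariant adj w A₀ (i + 1) A := by
  obtain ⟨A, hA, hI⟩ := h
  unfold removeCmd
  simp only [eval_ifEq, NatExpr.eval, h21, hA.eq_one_iff]
  by_cases hi : i ∈ A
  · rw [if_pos hi, Cmd.eval]
    obtain ⟨s₁, hs₁⟩ : ∃ s₁, s₁ = s.writeNat 9 i 0 := ⟨_, rfl⟩
    have e1 : (Cmd.setNat 9 (cell 21) (.const 0)).eval s = s₁ := by
      rw [hs₁]; simp [Cmd.eval, NatExpr.eval, h21]
    have hf1 := (Cmd.setNat 9 (cell 21) (.const 0)).eval_eqOutside s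
    rw [e1] at hf1 ⊢
    rw [Cmd.eval]
    have hs1 := hs.of_eqOutside hf1
    have hA1 : HasSet s₁ (A.erase i) := hs₁ ▸ hA.erase i
    obtain ⟨T, hT⟩ := exists_isMaxIndep adj w (A.erase i)
    have hm := eval_measureCmd hg hs1 hA1
      ((Finset.erase_subset _ _).trans (hI.subset.trans hA₀)) hT
    have hf2 := measureCmd.eval_eqOutside s₁
    generalize measureCmd.eval s₁ = s₂ at *
    have h5' : s₂.num 5 0 = ∑ v ∈ T₀, w v + ∑ v ∈ T₀, w v := by
      rw [hf2.num_eq 5 (by decide), hf1.num_eq 5 (by decide), h5]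
    have hA2 := hA1.of_eqOutside hf2
    have h21' : s₂.nat 21 0 = i := by
      rw [hf2.nat_eq 21 (by decide), hf1.nat_eq 21 (by decide), h21]
    simp only [Cmd.eval, Test.Holds, NumExpr.eval, NatExpr.eval, h21', hm, h5']
    -- If the maximum drops, the vertex is necessary and is put back. Otherwise a maximum set for
    -- the smaller set is still maximum for `A₀`.
    split_ifs with hlt
    · refine ⟨A, by simpa [Finset.insert_erase hi] using hA2.insert i, hI.skip fun _ T' hT' hmax => ?_⟩
      have h1 := hT.le T' hT' hmax.indep
      rw [hmax.sum_eq hT₀] at h1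
      exact absurd hlt (not_lt.2 (add_le_add h1 h1))
    · refine ⟨A.erase i, hA2, hI.remove ⟨T, hT.subset, hT.subset.trans
        ((Finset.erase_subset _ _).trans hI.subset), hT.indep, fun T' h1 h2 => ?_⟩⟩
      refine (hT₀.le T' h1 h2).trans ?_
      by_contra h3
      exact hlt (add_lt_add (not_le.1 h3) (not_le.1 h3))
  · rw [if_neg hi]
    exact ⟨A, hA, hI.skip fun h1 => absurd h1 hi⟩

theorem eval_indepCmd {s : Memory K} (hg : IsBipartiteWeighted adj w) (hs : GraphEnv n adj w s)
    (hA : HasSet s A) (hAn : A ⊆ Finset.range n) :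
    ∃ T, HasSet (indepCmd.eval s) T ∧ IsMaxIndep adj w A T := by
  obtain ⟨T₀, hT₀⟩ := exists_isMaxIndep adj w A
  unfold indepCmd
  rw [Cmd.eval, Cmd.eval]
  have hm := eval_measureCmd hg hs hA hAn hT₀
  have hf1 := measureCmd.eval_eqOutside s
  generalize measureCmd.eval s = s₁ at *
  have hf2 := (Cmd.setNum 5 (.const 0) (.get 7 (.const 0))).eval_eqOutside s₁
  have h5 : ((Cmd.setNum 5 (.const 0) (.get 7 (.const 0))).eval s₁).num 5 0 =
      ∑ v ∈ T₀, w v + ∑ v ∈ T₀, w v := by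
    simp [Cmd.eval, Memory.writeNum_num, NatExpr.eval, NumExpr.eval, hm]
  generalize (Cmd.setNum 5 (.const 0) (.get 7 (.const 0))).eval s₁ = s₂ at *
  replace hs := (hs.of_eqOutside hf1).of_eqOutside hf2
  replace hA := (hA.of_eqOutside hf1).of_eqOutside hf2
  have key := forLoop_induction (a := 21) (b := 0) (C := removeCmd) (s := s₂) (by decide)
    (fun i s => ∃ A', HasSet s A' ∧ RemoveInvariant adj w A i A')
    ⟨A, hA, subset_rfl, ⟨T₀, hT₀.subset, hT₀⟩, fun u hu => by omega⟩
    (by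
      intro i _ s₃ h21 hf3 hI
      exact eval_removeCmd hg (hs.of_eqOutside hf3) hAn h21 hT₀
        (by rw [hf3.num_eq 5 (by decide), h5]) hI)
  rw [hs.vertices] at key
  obtain ⟨T, hT, hI⟩ := key
  exact ⟨T, hT, hI.isMaxIndep hAn⟩

end RandomAccess

/-! # Optimal solutions of the bilevel problem -/

namespace BISInstance

section Optimality

variable {V K : Type} [Fintype V] [DecidableEq V] [LinearOrder K] [AddCommGroup K]

/-- No follower vertex is better for the follower than the follower vertex `u`; there is no
condition on leader vertices `u`. -/
def IsValidMinimum (I : BISInstance V K) (u : V) : Prop :=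
  u ∉ I.leaderVertices → ∀ v ∉ I.leaderVertices, I.wFollower v ≤ I.wFollower u

/-- `S` is an independent set whose minimum follower weight is attained at `u`, and if `u` is a
follower vertex, then `S` consists of follower vertices. -/
structure IsCandidate (I : BISInstance V K) (u : V) (S : Finset V) : Prop where
  mem : u ∈ S
  indep : I.graph.IsIndepSet (S : Set V)
  le : ∀ v ∈ S, I.wFollower u ≤ I.wFollower v
  follower : u ∉ I.leaderVertices → ∀ v ∈ S, v ∉ I.leaderVertices

omit [Fintype V] [DecidableEq V] [AddCommGroup K] in
theorem bottleneckObjective_le {w : V → K} {S : Finset V} {v : V} (hv : v ∈ S) :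
    bottleneckObjective w S ≤ w v :=
  Finset.inf_le hv

omit [Fintype V] [DecidableEq V] [AddCommGroup K] in
theorem le_bottleneckObjective {w : V → K} {S : Finset V} {x : K} (h : ∀ v ∈ S, x ≤ w v) :
    (x : WithTop K) ≤ bottleneckObjective w S :=
  Finset.le_inf fun v hv => WithTop.coe_le_coe.2 (h v hv)

/-- If `u` is a leader vertex, it belongs to the action and caps the bottleneck of every reaction.
If `u` is a follower vertex, the action is empty, every reaction uses follower vertices only, and
validity caps their weights. -/
theorem IsCandidate.isPossibleReaction {I : BISInstance V K} {u : V} {S : Finset V}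
    (hu : I.IsValidMinimum u) (hS : I.IsCandidate u S) :
    I.IsPossibleReaction (S ∩ I.leaderVertices) (S \ I.leaderVertices) := by
  have hunion : S ∩ I.leaderVertices ∪ S \ I.leaderVertices = S := by
    rw [Finset.union_comm]; exact Finset.sdiff_union_inter S I.leaderVertices
  refine ⟨⟨Finset.inter_subset_right, fun v hv => ?_, ?_, ?_⟩, fun F' hF' => ?_⟩
  · rw [followerVertices, Finset.mem_compl]
    exact (Finset.mem_sdiff.1 hv).2
  · rw [hunion]; exact hS.indep
  · rw [hunion]; exact ⟨u, hS.mem⟩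
  · rw [hunion]
    refine le_trans ?_ (le_bottleneckObjective hS.le)
    by_cases h : u ∈ I.leaderVertices
    · exact bottleneckObjective_le
        (Finset.mem_union_left _ (Finset.mem_inter.2 ⟨hS.mem, h⟩))
    · obtain ⟨v, hv⟩ := hF'.2.2.2
      refine (bottleneckObjective_le hv).trans (WithTop.coe_le_coe.2 (hu h v ?_))
      rcases Finset.mem_union.1 hv with h1 | h1
      · exact hS.follower h v (Finset.mem_inter.1 h1).1
      · have := hF'.2.1 h1
        rwa [followerVertices, Finset.mem_compl] at this

/-- For nonempty `L` take `u` minimal in `L`: comparison with the reaction `∅` shows that `F` does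
not go below it. For empty `L`, comparison with single follower vertices shows that all vertices of
`F` have maximum follower weight, so any of them serves as `u`. -/
theorem IsPossibleReaction.exists_isCandidate {I : BISInstance V K} {L F : Finset V}
    (h : I.IsPossibleReaction L F) : ∃ u, I.IsValidMinimum u ∧ I.IsCandidate u (L ∪ F) := by
  obtain ⟨⟨hL, hF, hind, hne⟩, hmax⟩ := h
  have hF' : ∀ v ∈ F, v ∉ I.leaderVertices := fun v hv => by
    have := hF hv
    rwa [followerVertices, Finset.mem_compl] at this
  rcases L.eq_empty_or_nonempty with rfl | hLne
  · rw [Finset.empty_union] at *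
    obtain ⟨u, hu⟩ := hne
    have key : ∀ v ∈ F, ∀ x ∉ I.leaderVertices, I.wFollower x ≤ I.wFollower v := by
      intro v hv x hx
      have h1 := hmax {x} ⟨hL, by simpa [followerVertices] using hx, by simp, by simp⟩
      have h2 := h1.trans (bottleneckObjective_le hv)
      simpa [bottleneckObjective] using h2
    exact ⟨u, fun _ v hv => key u hu v hv, hu, hind, fun v hv => key v hv u (hF' u hu),
      fun _ => hF'⟩
  · obtain ⟨u, hu, hmin⟩ := L.exists_min_image I.wFollower hLne
    refine ⟨u, fun h1 => absurd (hL hu) h1, Finset.mem_union_left _ hu, hind, fun v hv => ?_,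
      fun h1 => absurd (hL hu) h1⟩
    have h1 := hmax ∅ ⟨hL, by simp, by
      rw [Finset.union_empty]
      exact hind.mono (by simp), by simpa using hLne⟩
    rw [Finset.union_empty] at h1
    exact WithTop.coe_le_coe.1
      (((le_bottleneckObjective hmin).trans h1).trans (bottleneckObjective_le hv))

/-- A candidate of maximum weight is an optimal solution. -/
theorem IsCandidate.isOptimalSolution {I : BISInstance V K} {u : V} {S : Finset V}
    (hu : I.IsValidMinimum u) (hS : I.IsCandidate u S)
    (hmax : ∀ u' S', I.IsValidMinimum u' → I.IsCandidate u' S' →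
      sumObjective I.wLeader S' ≤ sumObjective I.wLeader S) :
    I.IsOptimalSolution (S ∩ I.leaderVertices) (S \ I.leaderVertices) := by
  have hunion : S ∩ I.leaderVertices ∪ S \ I.leaderVertices = S := by
    rw [Finset.union_comm]; exact Finset.sdiff_union_inter S I.leaderVertices
  -- Leader and optimistic follower maximize the same objective, so one bound over all possible
  -- reactions to all actions settles both levels.
  have key : ∀ L' F', I.IsPossibleReaction L' F' → sumObjective I.wLeader (L' ∪ F') ≤
      sumObjective I.wLeader (S ∩ I.leaderVertices ∪ S \ I.leaderVertices) := by
    intro L' F' h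
    obtain ⟨u', hu', hS'⟩ := h.exists_isCandidate
    rw [hunion]
    exact hmax u' _ hu' hS'
  exact ⟨⟨hS.isPossibleReaction hu, fun F' => key _ F'⟩, fun L' F' h => key L' F' h.1⟩

end Optimality

end BISInstance

/-! # The program for the bilevel problem

The natural number array `2` holds the indicator function of the set of leader vertices, the array
`1` of elements of `K` holds the weights of the follower. -/

namespace RandomAccess

open Cmd Preflow IndepCut

/-- Decide whether the vertex given by the counter `21` may be added to a candidate whose minimum is
attained at the vertex given by the counter `20`. -/
def allowCmd : Cmd :=
  .branch (.numLt (.get 1 (cell 21)) (.get 1 (cell 20))) (.setNat 9 (cell 21) (.const 0))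
  -- The comparison of the indicators says that `u` is a follower vertex and `v` is a leader vertex.
  (.branch (.natLt (.get 2 (cell 20)) (.get 2 (cell 21))) (.setNat 9 (cell 21) (.const 0))
  (.branch (.natLt (.const 0) (.get 1 (.add (.get 7 (cell 20)) (cell 21))))
    (.setNat 9 (cell 21) (.const 0)) (.setNat 9 (cell 21) (.const 1))))

/-- Detect that the vertex given by the counter `21` shows that the vertex given by the counter
`20` is no valid minimum. -/
def validCmd : Cmd :=
  .branch (.natLt (.add (.get 2 (cell 20)) (.get 2 (cell 21))) (.const 1))
    (.branch (.numLt (.get 1 (cell 20)) (.get 1 (cell 21)))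
      (.setNat 11 (.const 0) (.const 0)) .skip) .skip

/-- Compute the set of vertices that may be added to a candidate, and decide whether the minimum is
valid. -/
def allowLoop : Cmd :=
  .seq (.setNat 11 (.const 0) (.const 1)) (.forLoop 21 0 (.seq allowCmd validCmd))

/-- Compute the weight of the set of vertices. -/
def weightCmd : Cmd :=
  .seq (.setNum 7 (.const 0) (.get 8 (.const 0)))
  (.forLoop 22 0 (ifEq (.get 9 (cell 22)) (.const 1) (.setNum 7 (.const 0)
    (.add (.get 7 (.const 0)) (.get 0 (cell 22))))))

/-- Store the set of vertices and its weight. -/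
def storeCmd : Cmd :=
  .seq (.setNum 2 (.const 0) (.get 7 (.const 0)))
  (.forLoop 22 0
    (.seq (.setNat 3 (cell 22) (.const 0))
    (.seq (.setNat 4 (cell 22) (.const 0))
    (ifEq (.get 9 (cell 22)) (.const 1)
      (.branch (.natLt (.const 0) (.get 2 (cell 22)))
        (.setNat 3 (cell 22) (.const 1)) (.setNat 4 (cell 22) (.const 1)))))))

/-- Compute the best candidate whose minimum is attained at the vertex given by the counter `20`,
and store it if it is better than all candidates found before. -/
def candidateCmd : Cmd :=
  -- A maximum independent set may miss `u` if `u` has weight zero, so `u` is added afterwards.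
  .seq (.seq allowLoop (.seq indepCmd (.seq (.setNat 9 (cell 20) (.const 1)) weightCmd)))
    (ifEq (cell 11) (.const 1)
      -- Ties are stored too. As the best value starts at zero and weights are nonnegative, the
      -- first valid candidate is stored even if its weight is zero.
      (.branch (.numLt (.get 7 (.const 0)) (.get 2 (.const 0))) .skip storeCmd))

/-- Compute the bounds for the loops. -/
def boundsCmd : Cmd :=
  .seq (.setNat 5 (.const 0) (.add (.add (cell 0) (cell 0)) (.const 1)))
    (.setNat 6 (.const 0) (.add (.add (cell 0) (cell 0)) (.const 2)))

/-- Compute the multiples of the cell `b` in array `a`. -/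
def multiplesCmd (a b : ℕ) : Cmd :=
  .forLoop 22 b (.setNat a (.add (cell 22) (.const 1)) (.add (.get a (cell 22)) (cell b)))

/-- Compute the total weight. -/
def totalCmd : Cmd :=
  .forLoop 22 0 (.setNum 6 (.const 0) (.add (.get 6 (.const 0)) (.get 0 (cell 22))))

/-- Compute the constants. -/
def constantsCmd : Cmd :=
  .seq (multiplesCmd 7 0) (.seq (multiplesCmd 8 5) totalCmd)

/-- The main part of the program. -/
def solveCmd : Cmd :=
  .seq constantsCmd (.forLoop 20 0 candidateCmd)

/-- The program for the bilevel independent set problem. -/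
def solveProg : Prog :=
  -- The bounds are computed separately, because `solveCmd` uses the arrays `5` and `6` as loop
  -- bounds and so must not write to them.
  .seq boundsCmd.compile solveCmd.compile

/-- The number of steps of the program in terms of the number of vertices. -/
noncomputable def solveTime : Polynomial ℕ :=
  -- The loop bounds `n`, `2 * n + 1` and `2 * n + 2` are all at most `2 * n + 2`.
  (boundsCmd.time + solveCmd.time + 1).comp (2 * Polynomial.X + 2)

/-! ### Correctness and running time of the program for the bilevel problem. -/

section

variable {K : Type} [LinearOrder K] [AddCommGroup K]

theorem exists_solveProg_run {n : ℕ} (s : Memory K) (hs : s.nat 0 0 = n) :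
    ∃ t ≤ solveTime.eval n, Run (unitCost K) solveProg s (solveCmd.eval (boundsCmd.eval s)) t := by
  obtain ⟨t1, h1, r1⟩ := Cmd.exists_run (K := K) (bs := []) (C := boundsCmd) (B := 2 * n + 2)
    (by decide) s (by simp)
  obtain ⟨t2, h2, r2⟩ := Cmd.exists_run (K := K) (bs := [0, 5, 6]) (C := solveCmd)
    (B := 2 * n + 2) (by decide) (boundsCmd.eval s) (by
      simp [boundsCmd, Cmd.eval, NatExpr.eval, Memory.writeNat_nat, hs]
      omega)
  refine ⟨_, ?_, .seq r1 r2⟩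
  simp only [solveTime, Polynomial.eval_comp, Polynomial.eval_add, Polynomial.eval_mul,
    Polynomial.eval_X, Polynomial.eval_one, Polynomial.eval_ofNat]
  omega

/-- The constants the program for the bilevel problem uses. -/
structure BilevelEnv (n : ℕ) (adj : ℕ → ℕ → Prop) (w f : ℕ → K) (Ld : Finset ℕ) (s : Memory K) :
    Prop where
  graph : GraphEnv n adj w s
  leader : ∀ v < n, s.nat 2 v = if v ∈ Ld then 1 else 0
  follower : ∀ v < n, s.num 1 v = f v

omit [LinearOrder K] in
theorem BilevelEnv.of_eqOutside {n : ℕ} {adj : ℕ → ℕ → Prop} {w f : ℕ → K} {Ld : Finset ℕ}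
    {s s' : Memory K} (h : BilevelEnv n adj w f Ld s) {l l' : List ℕ} (hs : s.EqOutside l l' s')
    (h0 : 0 ∉ l := by decide) (h1 : 1 ∉ l := by decide) (h2 : 2 ∉ l := by decide)
    (h5 : 5 ∉ l := by decide) (h6 : 6 ∉ l := by decide) (h7 : 7 ∉ l := by decide)
    (h8 : 8 ∉ l := by decide) (h0' : 0 ∉ l' := by decide) (h1' : 1 ∉ l' := by decide)
    (h6' : 6 ∉ l' := by decide) (h8' : 8 ∉ l' := by decide) : BilevelEnv n adj w f Ld s' := by
  refine ⟨h.graph.of_eqOutside hs h0 h1 h5 h6 h7 h8 h0' h6' h8', fun v hv => ?_, fun v hv => ?_⟩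
  · rw [hs.nat_eq 2 h2, h.leader v hv]
  · rw [hs.num_eq 1 h1', h.follower v hv]

open Classical in
/-- The vertices that may belong to a candidate whose minimum is attained at `u`. -/
noncomputable def allowed (n : ℕ) (adj : ℕ → ℕ → Prop) (f : ℕ → K) (Ld : Finset ℕ) (u : ℕ) :
    Finset ℕ :=
  (Finset.range n).filter fun v => f u ≤ f v ∧ (u ∉ Ld → v ∉ Ld) ∧ ¬ adj u v

omit [AddCommGroup K] in
theorem mem_allowed {n : ℕ} {adj : ℕ → ℕ → Prop} {f : ℕ → K} {Ld : Finset ℕ} {u v : ℕ} :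
    v ∈ allowed n adj f Ld u ↔ v < n ∧ f u ≤ f v ∧ (u ∉ Ld → v ∉ Ld) ∧ ¬ adj u v := by
  simp only [allowed, Finset.mem_filter, Finset.mem_range]

omit [AddCommGroup K] in
theorem allowed_subset {n : ℕ} {adj : ℕ → ℕ → Prop} {f : ℕ → K} {Ld : Finset ℕ} {u : ℕ} :
    allowed n adj f Ld u ⊆ Finset.range n :=
  fun _ hv => Finset.mem_range.2 (mem_allowed.1 hv).1

/-- No follower vertex is better for the follower than the follower vertex `u`. -/
def IsValid (n : ℕ) (f : ℕ → K) (Ld : Finset ℕ) (u : ℕ) : Prop :=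
  u ∉ Ld → ∀ v < n, v ∉ Ld → f v ≤ f u

/-- `S` is a candidate whose minimum is attained at `u`. -/
structure IsNatCandidate (n : ℕ) (adj : ℕ → ℕ → Prop) (f : ℕ → K) (Ld : Finset ℕ) (u : ℕ)
    (S : Finset ℕ) : Prop where
  mem : u ∈ S
  subset : S ⊆ allowed n adj f Ld u
  indep : Indep adj S

variable {n : ℕ} {adj : ℕ → ℕ → Prop} {w f : ℕ → K} {Ld : Finset ℕ}

theorem eval_allowCmd {s : Memory K} {u v : ℕ} (hs : BilevelEnv n adj w f Ld s) (hu : u < n)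
    (hv : v < n) (h20 : s.nat 20 0 = u) (h21 : s.nat 21 0 = v) (a : ℕ) :
    (allowCmd.eval s).nat 9 a =
      if a = v then (if v ∈ allowed n adj f Ld u then 1 else 0) else s.nat 9 a := by
  have hadj := hs.graph.adj_iff u hu v hv
  have hlead : s.nat 2 u < s.nat 2 v ↔ ¬ (u ∉ Ld → v ∉ Ld) := by
    rw [hs.leader u hu, hs.leader v hv]
    by_cases h1 : u ∈ Ld <;> by_cases h2 : v ∈ Ld <;> simp [h1, h2]
  have hmem : v ∈ allowed n adj f Ld u ↔ ¬ f v < f u ∧ (u ∉ Ld → v ∉ Ld) ∧ ¬ adj u v := by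
    rw [mem_allowed, not_lt]
    exact and_iff_right hv
  simp only [allowCmd, Cmd.eval, Test.Holds, NatExpr.eval, NumExpr.eval, h20, h21,
    hs.follower u hu, hs.follower v hv, hs.graph.row u hu, hmem]
  split_ifs with h1 h2 h3 h4 <;> simp_all [Memory.writeNat_nat]

theorem eval_validCmd {s : Memory K} {u v : ℕ} (hs : BilevelEnv n adj w f Ld s) (hu : u < n)
    (hv : v < n) (h20 : s.nat 20 0 = u) (h21 : s.nat 21 0 = v) {P : Prop}
    (h : s.nat 11 0 = 1 ↔ P) :
    (validCmd.eval s).nat 11 0 = 1 ↔ P ∧ (u ∉ Ld → v ∉ Ld → f v ≤ f u) := by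
  have hlead : s.nat 2 u + s.nat 2 v < 1 ↔ u ∉ Ld ∧ v ∉ Ld := by
    rw [hs.leader u hu, hs.leader v hv]
    by_cases h1 : u ∈ Ld <;> by_cases h2 : v ∈ Ld <;> simp [h1, h2]
  simp only [validCmd, Cmd.eval, Test.Holds, NatExpr.eval, NumExpr.eval, h20, h21,
    hs.follower u hu, hs.follower v hv, hlead]
  split_ifs with h1 h2
  · simp [Memory.writeNat_nat, h1, h2]
  · simp [h, not_lt.1 h2]
  · rw [h]
    exact ⟨fun h2 => ⟨h2, fun h3 h4 => absurd ⟨h3, h4⟩ h1⟩, fun h2 => h2.1⟩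

/-- `HasSet` concerns all positions of the array, whereas the loop writes only below `n`; this is
why the remaining cells are required to vanish. -/
theorem eval_allowLoop {s : Memory K} {u : ℕ} (hs : BilevelEnv n adj w f Ld s) (hu : u < n)
    (h20 : s.nat 20 0 = u) (h9 : ∀ a, n ≤ a → s.nat 9 a = 0) :
    HasSet (allowLoop.eval s) (allowed n adj f Ld u) ∧
      ((allowLoop.eval s).nat 11 0 = 1 ↔ IsValid n f Ld u) := by
  unfold allowLoop
  rw [Cmd.eval]
  have hf := (Cmd.setNat 11 (.const 0) (.const 1)).eval_eqOutside s
  have h11 : ((Cmd.setNat 11 (.const 0) (.const 1)).eval s).nat 11 0 = 1 := by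
    simp [Cmd.eval, NatExpr.eval, Memory.writeNat_nat]
  generalize (Cmd.setNat 11 (.const 0) (.const 1)).eval s = s₁ at *
  replace hs := hs.of_eqOutside hf
  rw [← hf.nat_eq 9 (by decide)] at h9
  rw [← hf.nat_eq 20 (by decide)] at h20
  have key := forLoop_induction (a := 21) (b := 0) (C := .seq allowCmd validCmd) (s := s₁)
    (by decide)
    (fun i s => (∀ a, n ≤ a → s.nat 9 a = 0) ∧
      (∀ a < i, s.nat 9 a = if a ∈ allowed n adj f Ld u then 1 else 0) ∧
      (s.nat 11 0 = 1 ↔ ∀ v < i, u ∉ Ld → v ∉ Ld → f v ≤ f u))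
    (by
      rw [Memory.writeNat_nat_of_ne _ _ _ (by decide), Memory.writeNat_nat_of_ne _ _ _ (by decide)]
      exact ⟨h9, fun a ha => absurd ha (by omega), by simp [h11]⟩)
    (by
      intro i hi s₂ h21 hf2 ⟨hI1, hI2, hI3⟩
      rw [hs.graph.vertices] at hi
      replace hs := hs.of_eqOutside hf2
      replace h20 : s₂.nat 20 0 = u := by rw [hf2.nat_eq 20 (by decide), h20]
      have h1 := eval_allowCmd hs hu hi h20 h21
      have hf3 := allowCmd.eval_eqOutside s₂
      rw [Cmd.eval, Memory.writeNat_nat_of_ne _ _ _ (by decide),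
        Memory.writeNat_nat_of_ne _ _ _ (by decide)]
      generalize allowCmd.eval s₂ = s₃ at *
      have hf4 := validCmd.eval_eqOutside s₃
      rw [← hf3.nat_eq 11 (by decide)] at hI3
      have h2 := eval_validCmd (hs.of_eqOutside hf3) hu hi
        (by rw [hf3.nat_eq 20 (by decide), h20]) (by rw [hf3.nat_eq 21 (by decide), h21]) hI3
      rw [h2, hf4.nat_eq 9 (by decide)]
      refine ⟨fun a ha => ?_, fun a ha => ?_, ?_⟩
      · rw [h1, if_neg (by omega), hI1 a ha]
      · rw [h1]
        by_cases h3 : a = i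
        · rw [if_pos h3, h3]
        · rw [if_neg h3, hI2 a (by omega)]
      · rw [Nat.forall_lt_succ_right])
  rw [hs.graph.vertices] at key
  refine ⟨fun v => ?_, ?_⟩
  · by_cases hv : v < n
    · exact key.2.1 v hv
    · rw [key.1 v (by omega), if_neg]
      exact fun h => hv (mem_allowed.1 h).1
  · rw [key.2.2]
    exact ⟨fun h h1 v hv => h v hv h1, fun h v hv h1 => h h1 v hv⟩

theorem eval_weightCmd {s : Memory K} {A : Finset ℕ} (hs : GraphEnv n adj w s) (hA : HasSet s A)
    (hAn : A ⊆ Finset.range n) : (weightCmd.eval s).num 7 0 = ∑ v ∈ A, w v := by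
  unfold weightCmd
  rw [Cmd.eval]
  have hf := (Cmd.setNum 7 (.const 0) (.get 8 (.const 0))).eval_eqOutside s
  have h7 : ((Cmd.setNum 7 (.const 0) (.get 8 (.const 0))).eval s).num 7 0 = 0 := by
    simp [Cmd.eval, Memory.writeNum_num, NatExpr.eval, NumExpr.eval, hs.flow.zero]
  generalize (Cmd.setNum 7 (.const 0) (.get 8 (.const 0))).eval s = s₁ at *
  replace hs := hs.of_eqOutside hf
  replace hA := hA.of_eqOutside hf
  have key := forLoop_induction (a := 22) (b := 0) (C := ifEq (.get 9 (cell 22)) (.const 1)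
    (.setNum 7 (.const 0) (.add (.get 7 (.const 0)) (.get 0 (cell 22)))))
    (s := s₁) (by decide)
    (fun i s => s.num 7 0 = ∑ v ∈ Finset.range i, if v ∈ A then w v else 0) (by simpa using h7)
    (by
      intro i hi s₂ h22 hf2 hI
      rw [hs.vertices] at hi
      replace hA := hA.of_eqOutside hf2
      replace hs := hs.of_eqOutside hf2
      rw [Memory.writeNat_num, Finset.sum_range_succ, eval_ifEq]
      simp only [NatExpr.eval, h22, hA.eq_one_iff]
      split_ifs
      · simp [Cmd.eval, Memory.writeNum_num, NatExpr.eval, NumExpr.eval, h22, hs.weight i hi, hI]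
      · rw [hI, add_zero])
  rw [hs.vertices] at key
  rw [key, Finset.sum_ite_mem, Finset.inter_eq_right.2 hAn]

/-- The output arrays describe the set `S` and its weight. -/
structure IsOutput (n : ℕ) (w : ℕ → K) (Ld : Finset ℕ) (S : Finset ℕ) (s : Memory K) : Prop where
  leader : ∀ v < n, s.nat 3 v = if v ∈ S ∧ v ∈ Ld then 1 else 0
  follower : ∀ v < n, s.nat 4 v = if v ∈ S ∧ v ∉ Ld then 1 else 0
  value : s.num 2 0 = ∑ v ∈ S, w v

theorem eval_storeCmd {s : Memory K} {S : Finset ℕ} (hs : BilevelEnv n adj w f Ld s)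
    (hS : HasSet s S) (h7 : s.num 7 0 = ∑ v ∈ S, w v) : IsOutput n w Ld S (storeCmd.eval s) := by
  unfold storeCmd
  rw [Cmd.eval]
  have hf := (Cmd.setNum 2 (.const 0) (.get 7 (.const 0))).eval_eqOutside s
  have h2 : ((Cmd.setNum 2 (.const 0) (.get 7 (.const 0))).eval s).num 2 0 = ∑ v ∈ S, w v := by
    simp [Cmd.eval, Memory.writeNum_num, NatExpr.eval, NumExpr.eval, h7]
  generalize (Cmd.setNum 2 (.const 0) (.get 7 (.const 0))).eval s = s₁ at *
  replace hs := hs.of_eqOutside hf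
  replace hS := hS.of_eqOutside hf
  have key := forLoop_induction (a := 22) (b := 0) (C :=
    (.seq (.setNat 3 (cell 22) (.const 0))
    (.seq (.setNat 4 (cell 22) (.const 0))
    (ifEq (.get 9 (cell 22)) (.const 1)
      (.branch (.natLt (.const 0) (.get 2 (cell 22)))
        (.setNat 3 (cell 22) (.const 1)) (.setNat 4 (cell 22) (.const 1)))))))
    (s := s₁) (by decide)
    (fun i s => s.num 2 0 = ∑ v ∈ S, w v ∧
      ∀ v < i, (s.nat 3 v = if v ∈ S ∧ v ∈ Ld then 1 else 0) ∧
        s.nat 4 v = if v ∈ S ∧ v ∉ Ld then 1 else 0)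
    ⟨by simpa using h2, fun v hv => by omega⟩
    (by
      intro i hi s₂ h22 hf2 ⟨hI1, hI2⟩
      rw [hs.graph.vertices] at hi
      replace hS := hS.of_eqOutside hf2
      replace hs := hs.of_eqOutside hf2
      have h9 : s₂.nat 9 i = 1 ↔ i ∈ S := hS.eq_one_iff i
      have hl : 0 < s₂.nat 2 i ↔ i ∈ Ld := by
        rw [hs.leader i hi]; split_ifs with h <;> simp [h]
      simp only [Cmd.eval, eval_ifEq, Test.Holds, NatExpr.eval, Memory.writeNat_nat, h22,
        Nat.reduceEqDiff, false_and, if_false, h9, hl, Memory.writeNat_num]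
      constructor
      · split_ifs <;> exact hI1
      · intro v hv
        rcases Nat.lt_succ_iff_lt_or_eq.1 hv with h1 | rfl
        · have h2 := hI2 v h1
          split_ifs <;> simp_all [Memory.writeNat_nat, h1.ne]
        · split_ifs <;> simp_all [Memory.writeNat_nat])
  rw [hs.graph.vertices] at key
  exact ⟨fun v hv => (key.2 v hv).1, fun v hv => (key.2 v hv).2, key.1⟩

variable [IsOrderedAddMonoid K]

/-- The memory contents after the treatment of the candidates whose minimum is attained at a vertex
below `i`. -/
def BestInvariant (n : ℕ) (adj : ℕ → ℕ → Prop) (w f : ℕ → K) (Ld : Finset ℕ) (i : ℕ)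
    (s : Memory K) : Prop :=
  (∃ u < i, ∃ S, IsValid n f Ld u ∧ IsNatCandidate n adj f Ld u S ∧ IsOutput n w Ld S s ∧
    ∀ u' < i, ∀ S', IsValid n f Ld u' → IsNatCandidate n adj f Ld u' S' →
      ∑ v ∈ S', w v ≤ ∑ v ∈ S, w v) ∨
  (∀ u < i, ¬ IsValid n f Ld u) ∧ s.num 2 0 = 0

omit [IsOrderedAddMonoid K] in
theorem BestInvariant.of_eqOutside {i : ℕ} {s s' : Memory K}
    (h : BestInvariant n adj w f Ld i s) {l l' : List ℕ} (hs : s.EqOutside l l' s')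
    (h3 : 3 ∉ l := by decide) (h4 : 4 ∉ l := by decide) (h2 : 2 ∉ l' := by decide) :
    BestInvariant n adj w f Ld i s' := by
  rcases h with ⟨u, hu, S, hS1, hS2, hS3, hS4⟩ | h
  · refine .inl ⟨u, hu, S, hS1, hS2, ⟨fun v hv => ?_, fun v hv => ?_, ?_⟩, hS4⟩
    · rw [hs.nat_eq 3 h3, hS3.leader v hv]
    · rw [hs.nat_eq 4 h4, hS3.follower v hv]
    · rw [hs.num_eq 2 h2, hS3.value]
  · exact .inr ⟨h.1, by rw [hs.num_eq 2 h2, h.2]⟩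

/-- Allowed vertices are not adjacent to `u`, so adding `u` keeps independence, and it does not
decrease the weight. Every candidate is an independent set of allowed vertices and thus no heavier
than `T`. -/
theorem isNatCandidate_insert (hg : IsBipartiteWeighted adj w) {u : ℕ} (hu : u < n) {T : Finset ℕ}
    (hT : IsMaxIndep adj w (allowed n adj f Ld u) T) :
    IsNatCandidate n adj f Ld u (insert u T) ∧
      ∀ S, IsNatCandidate n adj f Ld u S → ∑ v ∈ S, w v ≤ ∑ v ∈ insert u T, w v := by
  obtain ⟨c, hc⟩ := hg.exists_coloring
  have hirr : ∀ v, ¬ adj v v := fun v hv => hc v v hv rfl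
  have hu' : u ∈ allowed n adj f Ld u :=
    mem_allowed.2 ⟨hu, le_rfl, id, hirr u⟩
  have hTu : ∀ v ∈ T, ¬ adj u v := fun v hv => (mem_allowed.1 (hT.subset hv)).2.2.2
  refine ⟨⟨Finset.mem_insert_self _ _, Finset.insert_subset hu' hT.subset, ?_⟩, fun S hS => ?_⟩
  · intro x hx y hy hxy
    rcases Finset.mem_insert.1 hx with rfl | hx'
    · rcases Finset.mem_insert.1 hy with rfl | hy'
      · exact hirr _ hxy
      · exact hTu y hy' hxy
    · rcases Finset.mem_insert.1 hy with rfl | hy'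
      · exact hTu x hx' (hg.symm _ _ hxy)
      · exact hT.indep x hx' y hy' hxy
  · exact (hT.le S hS.subset hS.indep).trans
      (Finset.sum_le_sum_of_subset_of_nonneg (Finset.subset_insert _ _)
        fun v _ _ => hg.weight_nonneg v)

theorem eval_candidateCmd {s : Memory K} {u : ℕ} (hg : IsBipartiteWeighted adj w)
    (hs : BilevelEnv n adj w f Ld s) (hu : u < n) (h20 : s.nat 20 0 = u)
    (h9 : ∀ a, n ≤ a → s.nat 9 a = 0) (h : BestInvariant n adj w f Ld u s) :
    (∀ a, n ≤ a → (candidateCmd.eval s).nat 9 a = 0) ∧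
      BestInvariant n adj w f Ld (u + 1) (candidateCmd.eval s) := by
  have hpre : ∃ s', s' = (Cmd.seq allowLoop (.seq indepCmd
      (.seq (.setNat 9 (cell 20) (.const 1)) weightCmd))).eval s ∧
      BilevelEnv n adj w f Ld s' ∧ BestInvariant n adj w f Ld u s' ∧
      (s'.nat 11 0 = 1 ↔ IsValid n f Ld u) ∧
      ∃ T, IsMaxIndep adj w (allowed n adj f Ld u) T ∧ HasSet s' (insert u T) ∧
        s'.num 7 0 = ∑ v ∈ insert u T, w v := by
    refine ⟨_, rfl, hs.of_eqOutside (Cmd.eval_eqOutside _ s),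
      h.of_eqOutside (Cmd.eval_eqOutside _ s), ?_⟩
    rw [Cmd.eval]
    obtain ⟨h1, h2⟩ := eval_allowLoop hs hu h20 h9
    have hf1 := allowLoop.eval_eqOutside s
    generalize allowLoop.eval s = s₁ at *
    replace hs := hs.of_eqOutside hf1
    rw [← hf1.nat_eq 20 (by decide)] at h20
    rw [Cmd.eval]
    obtain ⟨T, hT, hmax⟩ := eval_indepCmd hg hs.graph h1 allowed_subset
    have hf2 := indepCmd.eval_eqOutside s₁
    generalize indepCmd.eval s₁ = s₂ at *
    replace hs := hs.of_eqOutside hf2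
    rw [← hf2.nat_eq 20 (by decide)] at h20
    rw [← hf2.nat_eq 11 (by decide)] at h2
    rw [Cmd.eval]
    have hf3 := (Cmd.setNat 9 (cell 20) (.const 1)).eval_eqOutside s₂
    have hins : HasSet ((Cmd.setNat 9 (cell 20) (.const 1)).eval s₂) (insert u T) := by
      simpa [Cmd.eval, NatExpr.eval, h20] using hT.insert u
    generalize (Cmd.setNat 9 (cell 20) (.const 1)).eval s₂ = s₃ at *
    replace hs := hs.of_eqOutside hf3
    rw [← hf3.nat_eq 11 (by decide)] at h2
    have hsub : insert u T ⊆ Finset.range n :=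
      (isNatCandidate_insert hg hu hmax).1.subset.trans allowed_subset
    have hf4 := weightCmd.eval_eqOutside s₃
    refine ⟨by rw [hf4.nat_eq 11 (by decide), h2], T, hmax, hins.of_eqOutside hf4,
      eval_weightCmd hs.graph hins hsub⟩
  obtain ⟨s', hs', hs1, hb, hv, T, hmax, hset, h7⟩ := hpre
  obtain ⟨hcand, hbest⟩ := isNatCandidate_insert hg hu hmax
  have hsub : insert u T ⊆ Finset.range n := hcand.subset.trans allowed_subset
  have h9' : ∀ a, n ≤ a → s'.nat 9 a = 0 := fun a ha => by
    rw [hset a, if_neg fun h => ?_]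
    have := Finset.mem_range.1 (hsub h)
    omega
  unfold candidateCmd
  rw [Cmd.eval, ← hs', eval_ifEq]
  change (cell 11).eval s' = (NatExpr.const 1).eval s' ↔ _ at hv
  by_cases hval : IsValid n f Ld u
  · rw [if_pos (hv.2 hval)]
    simp only [Cmd.eval, Test.Holds, NumExpr.eval, NatExpr.eval, h7]
    split_ifs with hlt
    · refine ⟨h9', ?_⟩
      rcases hb with ⟨u₀, hu₀, S, hS1, hS2, hS3, hS4⟩ | hb
      · refine .inl ⟨u₀, by omega, S, hS1, hS2, hS3, fun u' hu' S' hv' hS' => ?_⟩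
        rcases Nat.lt_succ_iff_lt_or_eq.1 hu' with h1 | rfl
        · exact hS4 u' h1 S' hv' hS'
        · rw [hS3.value] at hlt
          exact (hbest S' hS').trans hlt.le
      · rw [hb.2] at hlt
        exact absurd hlt (not_lt.2 (Finset.sum_nonneg fun v _ => hg.weight_nonneg v))
    · have hout := eval_storeCmd hs1 hset h7
      have hf := storeCmd.eval_eqOutside s'
      refine ⟨by rwa [hf.nat_eq 9 (by decide)], .inl ⟨u, by omega, _, hval, hcand, hout,
        fun u' hu' S' hv' hS' => ?_⟩⟩
      rcases Nat.lt_succ_iff_lt_or_eq.1 hu' with h1 | rfl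
      · rcases hb with ⟨u₀, hu₀, S, hS1, hS2, hS3, hS4⟩ | hb
        · rw [hS3.value] at hlt
          exact (hS4 u' h1 S' hv' hS').trans (not_lt.1 hlt)
        · exact absurd hv' (hb.1 u' h1)
      · exact hbest S' hS'
  · rw [if_neg fun h1 => hval (hv.1 h1)]
    refine ⟨h9', ?_⟩
    rcases hb with ⟨u₀, hu₀, S, hS1, hS2, hS3, hS4⟩ | hb
    · refine .inl ⟨u₀, by omega, S, hS1, hS2, hS3, fun u' hu' S' hv' hS' => ?_⟩
      rcases Nat.lt_succ_iff_lt_or_eq.1 hu' with h1 | rfl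
      · exact hS4 u' h1 S' hv' hS'
      · exact absurd hv' hval
    · refine .inr ⟨fun u' hu' => ?_, hb.2⟩
      rcases Nat.lt_succ_iff_lt_or_eq.1 hu' with h1 | rfl
      · exact hb.1 u' h1
      · exact hval

omit [AddCommGroup K] [IsOrderedAddMonoid K] in
/-- There is a valid minimum. -/
theorem exists_isValid (hn : 0 < n) (f : ℕ → K) (Ld : Finset ℕ) : ∃ u < n, IsValid n f Ld u := by
  by_cases h : ∃ u < n, u ∈ Ld
  · obtain ⟨u, hu, hL⟩ := h
    exact ⟨u, hu, fun h1 => absurd hL h1⟩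
  · obtain ⟨u, hu, hmax⟩ := (Finset.range n).exists_max_image f ⟨0, Finset.mem_range.2 hn⟩
    exact ⟨u, Finset.mem_range.1 hu, fun _ v hv _ => hmax v (Finset.mem_range.2 hv)⟩

omit [IsOrderedAddMonoid K] in
theorem eval_multiplesCmd {s : Memory K} {a b m : ℕ} (hb : s.nat b 0 = m) (ha : a ≠ 22)
    (hab : b ≠ a) (hb' : b ≠ 22) (h0 : s.nat a 0 = 0) :
    ∀ p < m, ((multiplesCmd a b).eval s).nat a p = p * m := by
  have key := forLoop_induction (a := 22) (b := b) (C := .setNat a (.add (cell 22) (.const 1))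
    (.add (.get a (cell 22)) (cell b))) (s := s) (by simpa [natWrites] using ha.symm)
    (fun i s => ∀ p ≤ i, s.nat a p = p * m)
    (fun p hp => by
      rw [Memory.writeNat_nat_of_ne _ _ _ ha, show p = 0 by omega, h0, zero_mul])
    (by
      intro i _ s' h22 hf hI p hp
      have hb1 : s'.nat b 0 = m := by
        rw [hf.nat_eq b (by simp [natWrites, hab, hb']), hb]
      rw [Memory.writeNat_nat_of_ne _ _ _ ha]
      simp only [Cmd.eval, NatExpr.eval, h22, Memory.writeNat_nat, hb1, true_and]
      split_ifs with h1
      · rw [h1, hI i le_rfl, add_mul, one_mul]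
      · exact hI p (by omega))
  rw [hb] at key
  exact fun p hp => key p hp.le

omit [IsOrderedAddMonoid K] in
theorem eval_totalCmd {s : Memory K} (h0 : s.nat 0 0 = n) (h6 : s.num 6 0 = 0)
    (hw : ∀ v < n, s.num 0 v = w v) :
    (totalCmd.eval s).num 6 0 = ∑ v ∈ Finset.range n, w v := by
  have key := forLoop_induction (a := 22) (b := 0) (C := .setNum 6 (.const 0)
    (.add (.get 6 (.const 0)) (.get 0 (cell 22)))) (s := s) (by decide)
    (fun i s => s.num 6 0 = ∑ v ∈ Finset.range i, w v) (by simpa using h6)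
    (by
      intro i hi s' h22 hf hI
      rw [h0] at hi
      simp [Cmd.eval, NatExpr.eval, NumExpr.eval, Memory.writeNum_num, h22, hI,
        hf.num_eq 0 (by decide), hw i hi, Finset.sum_range_succ])
  rwa [h0] at key

theorem eval_solveCmd {s : Memory K} (hn : 0 < n) (hg : IsBipartiteWeighted adj w)
    (h0 : s.nat 0 0 = n) (h1 : ∀ u < n, ∀ v < n, 0 < s.nat 1 (u * n + v) ↔ adj u v)
    (h2 : ∀ v < n, s.nat 2 v = if v ∈ Ld then 1 else 0)
    (hnat : ∀ a, 7 ≤ a → ∀ i, s.nat a i = 0)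
    (hw : ∀ v < n, s.num 0 v = w v) (hwf : ∀ v < n, s.num 1 v = f v)
    (hnum : ∀ a, 2 ≤ a → ∀ i, s.num a i = 0) :
    ∃ u < n, ∃ S, IsValid n f Ld u ∧ IsNatCandidate n adj f Ld u S ∧
      IsOutput n w Ld S (solveCmd.eval (boundsCmd.eval s)) ∧
      ∀ u' < n, ∀ S', IsValid n f Ld u' → IsNatCandidate n adj f Ld u' S' →
        ∑ v ∈ S', w v ≤ ∑ v ∈ S, w v := by
  have hf := boundsCmd.eval_eqOutside s
  have h5 : (boundsCmd.eval s).nat 5 0 = 2 * n + 1 := by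
    simp [boundsCmd, Cmd.eval, NatExpr.eval, Memory.writeNat_nat, h0]
    omega
  have h6 : (boundsCmd.eval s).nat 6 0 = 2 * n + 2 := by
    simp [boundsCmd, Cmd.eval, NatExpr.eval, Memory.writeNat_nat, h0]
    omega
  rw [← hf.nat_eq 0 (by decide)] at h0
  rw [← hf.nat_eq 1 (by decide)] at h1
  rw [← hf.nat_eq 2 (by decide)] at h2
  rw [← hf.num_eq 0 (by decide)] at hw
  rw [← hf.num_eq 1 (by decide)] at hwf
  have h7 : ∀ i, (boundsCmd.eval s).nat 7 i = 0 := by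
    rw [hf.nat_eq 7 (by decide)]; exact hnat 7 (by omega)
  have h8 : ∀ i, (boundsCmd.eval s).nat 8 i = 0 := by
    rw [hf.nat_eq 8 (by decide)]; exact hnat 8 (by omega)
  have h9 : ∀ i, (boundsCmd.eval s).nat 9 i = 0 := by
    rw [hf.nat_eq 9 (by decide)]; exact hnat 9 (by omega)
  replace hnum : ∀ a, 2 ≤ a → ∀ i, (boundsCmd.eval s).num a i = 0 := fun a ha => by
    rw [hf.num_eq a (by simp [boundsCmd, numWrites])]; exact hnum a ha
  generalize boundsCmd.eval s = s₀ at *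
  have henv : BilevelEnv n adj w f Ld (constantsCmd.eval s₀) := by
    unfold constantsCmd
    rw [Cmd.eval, Cmd.eval]
    have hr7 := eval_multiplesCmd h0 (show 7 ≠ 22 by decide) (by decide) (by decide) (h7 0)
    have hf1 := (multiplesCmd 7 0).eval_eqOutside s₀
    generalize (multiplesCmd 7 0).eval s₀ = s₁ at *
    have hr8 := eval_multiplesCmd (s := s₁) (b := 5) (m := 2 * n + 1)
      (by rw [hf1.nat_eq 5 (by decide), h5]) (show 8 ≠ 22 by decide) (by decide) (by decide)
      (by rw [hf1.nat_eq 8 (by decide), h8])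
    have hf2 := (multiplesCmd 8 5).eval_eqOutside s₁
    generalize (multiplesCmd 8 5).eval s₁ = s₂ at *
    have ht := eval_totalCmd (s := s₂) (n := n) (w := w)
      (by rw [hf2.nat_eq 0 (by decide), hf1.nat_eq 0 (by decide), h0])
      (by rw [hf2.num_eq 6 (by decide), hf1.num_eq 6 (by decide), hnum 6 (by decide)])
      (by rwa [hf2.num_eq 0 (by decide), hf1.num_eq 0 (by decide)])
    have hf3 := totalCmd.eval_eqOutside s₂
    refine ⟨⟨⟨?_, ?_, ?_, ?_⟩, ?_, ?_, ?_, ?_, ht⟩, ?_, ?_⟩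
    · rw [hf3.nat_eq 5 (by decide), hf2.nat_eq 5 (by decide), hf1.nat_eq 5 (by decide), h5]
    · rw [hf3.nat_eq 6 (by decide), hf2.nat_eq 6 (by decide), hf1.nat_eq 6 (by decide), h6]
    · rwa [hf3.nat_eq 8 (by decide)]
    · rw [hf3.num_eq 8 (by decide), hf2.num_eq 8 (by decide), hf1.num_eq 8 (by decide),
        hnum 8 (by decide)]
    · rw [hf3.nat_eq 0 (by decide), hf2.nat_eq 0 (by decide), hf1.nat_eq 0 (by decide), h0]
    · rwa [hf3.nat_eq 7 (by decide), hf2.nat_eq 7 (by decide)]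
    · rwa [hf3.nat_eq 1 (by decide), hf2.nat_eq 1 (by decide), hf1.nat_eq 1 (by decide)]
    · rwa [hf3.num_eq 0 (by decide), hf2.num_eq 0 (by decide), hf1.num_eq 0 (by decide)]
    · rwa [hf3.nat_eq 2 (by decide), hf2.nat_eq 2 (by decide), hf1.nat_eq 2 (by decide)]
    · rwa [hf3.num_eq 1 (by decide), hf2.num_eq 1 (by decide), hf1.num_eq 1 (by decide)]
  have hf1 := constantsCmd.eval_eqOutside s₀
  unfold solveCmd
  rw [Cmd.eval]
  have h9' : ∀ i, (constantsCmd.eval s₀).nat 9 i = 0 := by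
    rwa [hf1.nat_eq 9 (by decide)]
  have h2' : (constantsCmd.eval s₀).num 2 0 = 0 := by
    rw [hf1.num_eq 2 (by decide), hnum 2 le_rfl]
  generalize constantsCmd.eval s₀ = s₁ at *
  have hwrite : ∀ (s : Memory K) (i : ℕ), s.EqOutside [20] [] (s.writeNat 20 0 i) := fun s i =>
    ⟨fun a ha => s.writeNat_nat_of_ne _ _ (by simpa using ha), fun _ _ => rfl⟩
  have key := forLoop_induction (a := 20) (b := 0) (C := candidateCmd) (s := s₁) (by decide)
    (fun i s => (∀ a, n ≤ a → s.nat 9 a = 0) ∧ BestInvariant n adj w f Ld i s)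
    ⟨fun a _ => by rw [(hwrite _ _).nat_eq 9 (by decide), h9'],
      .inr ⟨fun u hu => by omega, h2'⟩⟩
    (by
      intro i hi s₂ h20 hf2 hI
      rw [henv.graph.vertices] at hi
      obtain ⟨k1, k2⟩ := eval_candidateCmd hg (henv.of_eqOutside hf2) hi h20 hI.1 hI.2
      exact ⟨by rwa [(hwrite _ _).nat_eq 9 (by decide)], k2.of_eqOutside (hwrite _ _)⟩)
  rw [henv.graph.vertices] at key
  rcases key.2 with h | h
  · exact h
  -- The alternative that nothing was stored is impossible, since a nonempty vertex set has a valid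
  -- minimum.
  · obtain ⟨u, hu, hv⟩ := exists_isValid hn f Ld
    exact absurd hv (h.1 u hu)

end

end RandomAccess

/-! ### Transfer between vertices in `Fin n` and natural numbers. -/

namespace BISInstance

open RandomAccess IndepCut

variable {n : ℕ} {K : Type} [LinearOrder K] [AddCommGroup K]

/-- The adjacency relation on natural numbers. -/
def natAdj (I : BISInstance (Fin n) K) (u v : ℕ) : Prop :=
  ∃ (hu : u < n) (hv : v < n), I.graph.Adj ⟨u, hu⟩ ⟨v, hv⟩

/-- The extension of a weight function to the natural numbers by zero. -/
def natWeight (w : Fin n → K) (v : ℕ) : K :=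
  if h : v < n then w ⟨v, h⟩ else 0

/-- The leader vertices as natural numbers. -/
def natLeader (I : BISInstance (Fin n) K) : Finset ℕ :=
  I.leaderVertices.map Fin.valEmbedding

omit [LinearOrder K] in
theorem natWeight_val (w : Fin n → K) (v : Fin n) : natWeight w v = w v := by
  simp [natWeight]

theorem val_mem_natLeader (I : BISInstance (Fin n) K) (v : Fin n) :
    (v : ℕ) ∈ I.natLeader ↔ v ∈ I.leaderVertices :=
  Finset.mem_map' Fin.valEmbedding

theorem natAdj_val (I : BISInstance (Fin n) K) (u v : Fin n) :
    I.natAdj u v ↔ I.graph.Adj u v := by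
  simp [natAdj]

theorem isBipartiteWeighted (I : BISInstance (Fin n) K) (hI : I.graph.IsBipartite) :
    IsBipartiteWeighted I.natAdj (natWeight I.wLeader) := by
  refine ⟨fun u v ⟨hu, hv, h⟩ => ⟨hv, hu, h.symm⟩, fun v => ?_, ?_⟩
  · unfold natWeight
    split_ifs
    · exact I.wLeader_nonneg _
    · exact le_rfl
  · obtain ⟨c⟩ := hI
    refine ⟨fun v => if h : v < n then decide (c ⟨v, h⟩ = 0) else false, ?_⟩
    rintro u v ⟨hu, hv, h⟩ heq
    have h1 := c.valid h
    simp only [hu, hv, dif_pos, decide_eq_decide] at heq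
    generalize c ⟨u, hu⟩ = a at *
    generalize c ⟨v, hv⟩ = b at *
    fin_cases a <;> fin_cases b <;> simp_all

theorem isValid_iff (I : BISInstance (Fin n) K) (u : Fin n) :
    IsValid n (natWeight I.wFollower) I.natLeader u ↔ I.IsValidMinimum u := by
  unfold IsValid IsValidMinimum
  rw [val_mem_natLeader]
  refine imp_congr_right fun _ => ⟨fun h v hv => ?_, fun h v hv hvL => ?_⟩
  · have := h v v.2 (by rwa [val_mem_natLeader])
    rwa [natWeight_val, natWeight_val] at this
  · have := h ⟨v, hv⟩ (by rwa [← val_mem_natLeader])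
    rwa [← natWeight_val I.wFollower ⟨v, hv⟩, ← natWeight_val I.wFollower u] at this

theorem isNatCandidate_map_iff (I : BISInstance (Fin n) K) (u : Fin n) (S : Finset (Fin n)) :
    IsNatCandidate n I.natAdj (natWeight I.wFollower) I.natLeader u (S.map Fin.valEmbedding) ↔
      I.IsCandidate u S := by
  constructor
  · intro h
    have hall : ∀ v ∈ S, _ := fun v hv =>
      mem_allowed.1 (h.subset (Finset.mem_map_of_mem Fin.valEmbedding hv))
    refine ⟨(Finset.mem_map' Fin.valEmbedding).1 h.mem, fun x hx y hy _ hxy => ?_,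
      fun v hv => ?_, fun hu v hv => ?_⟩
    · exact h.indep x (Finset.mem_map_of_mem Fin.valEmbedding hx) y
        (Finset.mem_map_of_mem Fin.valEmbedding hy) ((I.natAdj_val x y).2 hxy)
    · have := (hall v hv).2.1
      rwa [Fin.valEmbedding_apply, natWeight_val, natWeight_val] at this
    · have := (hall v hv).2.2.1
      rw [Fin.valEmbedding_apply, val_mem_natLeader, val_mem_natLeader] at this
      exact this hu
  · intro h
    -- `IsIndepSet` speaks of distinct vertices and `Indep` of all pairs; the two agree because the
    -- graph has no loops.
    have hind : ∀ x ∈ S, ∀ y ∈ S, ¬ I.graph.Adj x y := fun x hx y hy hxy =>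
      h.indep hx hy hxy.ne hxy
    refine ⟨Finset.mem_map_of_mem Fin.valEmbedding h.mem, fun v hv => ?_, fun x hx y hy => ?_⟩
    · obtain ⟨v, hv', rfl⟩ := Finset.mem_map.1 hv
      rw [mem_allowed, Fin.valEmbedding_apply, natWeight_val, natWeight_val, val_mem_natLeader,
        val_mem_natLeader, natAdj_val]
      exact ⟨v.2, h.le v hv', fun hu => h.follower hu v hv', hind u h.mem v hv'⟩
    · obtain ⟨x, hx', rfl⟩ := Finset.mem_map.1 hx
      obtain ⟨y, hy', rfl⟩ := Finset.mem_map.1 hy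
      exact fun hxy => hind x hx' y hy' ((I.natAdj_val x y).1 hxy)

omit [LinearOrder K] in
theorem sum_natWeight_map (w : Fin n → K) (S : Finset (Fin n)) :
    ∑ v ∈ S.map Fin.valEmbedding, natWeight w v = sumObjective w S := by
  rw [Finset.sum_map]
  exact Finset.sum_congr rfl fun v _ => natWeight_val w v

theorem exists_map_eq {S : Finset ℕ} (h : S ⊆ Finset.range n) :
    ∃ T : Finset (Fin n), T.map Fin.valEmbedding = S := by
  refine ⟨Finset.univ.filter fun v => (v : ℕ) ∈ S, ?_⟩
  ext v
  simp only [Finset.mem_map, Finset.mem_filter, Finset.mem_univ, true_and,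
    Fin.valEmbedding_apply]
  exact ⟨fun ⟨u, hu, h1⟩ => h1 ▸ hu, fun hv => ⟨⟨v, Finset.mem_range.1 (h hv)⟩, hv, rfl⟩⟩

theorem initialMemory_adj (I : BISInstance (Fin n) K) {u v : ℕ} (hu : u < n) (hv : v < n) :
    0 < I.initialMemory.nat 1 (u * n + v) ↔ I.natAdj u v := by
  have h : (∃ u' v' : Fin n, I.graph.Adj u' v' ∧ u * n + v = u' * n + v') ↔ I.natAdj u v := by
    constructor
    · rintro ⟨u', v', h, heq⟩
      obtain ⟨rfl, rfl⟩ := (mul_add_inj hv v'.2).1 heq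
      exact (I.natAdj_val u' v').2 h
    · rintro ⟨hu, hv, h⟩
      exact ⟨_, _, h, rfl⟩
  rw [← h]
  simp only [initialMemory, one_ne_zero, if_false, if_true]
  split_ifs with h1 <;> simp [h1]

theorem initialMemory_leader (I : BISInstance (Fin n) K) (v : ℕ) :
    I.initialMemory.nat 2 v = if v ∈ I.natLeader then 1 else 0 := by
  have h : (∃ u ∈ I.leaderVertices, v = (u : ℕ)) ↔ v ∈ I.natLeader := by
    simp only [natLeader, Finset.mem_map, Fin.valEmbedding_apply, eq_comm]
  simp only [initialMemory, OfNat.ofNat_ne_zero, OfNat.ofNat_ne_one, if_false, if_true]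
  by_cases h1 : v ∈ I.natLeader
  · rw [if_pos h1, if_pos (h.2 h1)]
  · rw [if_neg h1, if_neg fun h2 => h1 (h.1 h2)]

variable [IsOrderedAddMonoid K]

theorem isSolvedBy_eval_solveCmd (I : BISInstance (Fin n) K) (hn : 0 < n)
    (hI : I.graph.IsBipartite) :
    I.IsSolvedBy (solveCmd.eval (boundsCmd.eval I.initialMemory)) := by
  obtain ⟨u, hu, S, hval, hcand, hout, hmax⟩ := eval_solveCmd (s := I.initialMemory)
    (f := natWeight I.wFollower) (Ld := I.natLeader) hn (I.isBipartiteWeighted hI)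
    (by simp [initialMemory]) (fun u hu v hv => I.initialMemory_adj hu hv)
    (fun v _ => I.initialMemory_leader v)
    (fun a ha i => by
      simp only [initialMemory]
      rw [if_neg (by omega), if_neg (by omega), if_neg (by omega)])
    (fun v hv => by simp [initialMemory, natWeight])
    (fun v hv => by simp [initialMemory, natWeight])
    (fun a ha i => by
      simp only [initialMemory]
      split_ifs <;> first | rfl | omega)
  obtain ⟨T, rfl⟩ := exists_map_eq (hcand.subset.trans allowed_subset)
  lift u to Fin n using hu
  rw [isValid_iff] at hval
  rw [isNatCandidate_map_iff] at hcand
  have hunion : T ∩ I.leaderVertices ∪ T \ I.leaderVertices = T := by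
    rw [Finset.union_comm]; exact Finset.sdiff_union_inter T I.leaderVertices
  have hmem : ∀ v : Fin n, (v : ℕ) ∈ T.map Fin.valEmbedding ↔ v ∈ T := fun v =>
    Finset.mem_map' Fin.valEmbedding
  refine ⟨_, _, hcand.isOptimalSolution hval fun u' S' hu' hS' => ?_, fun v => ?_, fun v => ?_, ?_⟩
  · rw [← sum_natWeight_map, ← sum_natWeight_map]
    exact hmax u' u'.2 _ ((I.isValid_iff u').2 hu') ((I.isNatCandidate_map_iff u' S').2 hS')
  · rw [hout.leader v v.2]
    exact if_congr (by rw [hmem, val_mem_natLeader, Finset.mem_inter]) rfl rfl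
  · rw [hout.follower v v.2]
    exact if_congr (by rw [hmem, val_mem_natLeader, Finset.mem_sdiff]) rfl rfl
  · rw [hunion, hout.value, sum_natWeight_map]

theorem exists_run (I : BISInstance (Fin n) K) (hn : 0 < n) (hI : I.graph.IsBipartite) :
    ∃ (s : Memory K) (t : ℕ), Run (unitCost K) solveProg I.initialMemory s t ∧
      t ≤ solveTime.eval n ∧ I.IsSolvedBy s := by
  obtain ⟨t, ht, hr⟩ := exists_solveProg_run I.initialMemory (n := n) (by simp [initialMemory])
  exact ⟨_, t, hr, ht, I.isSolvedBy_eval_solveCmd hn hI⟩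

end BISInstance

/-- On bipartite graphs, Bilevel Independent Set with sum objective for the leader, bottleneck
objective for the follower and an optimistic follower is solvable in polynomial time: there are one
program and one polynomial `p` such that the program solves every nonempty instance with real
weights in at most `p n` elementary operations, where `n` is the number of vertices, and every
nonempty instance with rational weights at logarithmic cost at most `p N`, where `N` is the binary
input length. -/
theorem mainTheorem7 :
    ∃ (P : RandomAccess.Prog) (p : Polynomial ℕ),
      (∀ (n : ℕ) (I : BISInstance (Fin n) ℝ), 0 < n → I.graph.IsBipartite →
        ∃ (s : RandomAccess.Memory ℝ) (t : ℕ),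
          RandomAccess.Run (RandomAccess.unitCost ℝ) P I.initialMemory s t ∧
            t ≤ p.eval n ∧ I.IsSolvedBy s) ∧
      (∀ (n : ℕ) (I : BISInstance (Fin n) ℚ), 0 < n → I.graph.IsBipartite →
        ∃ (s : RandomAccess.Memory ℚ) (t : ℕ),
          RandomAccess.Run RandomAccess.bitCost P I.initialMemory s t ∧
            t ≤ p.eval I.bitSize ∧ I.IsSolvedBy s) := by
  -- The sum of the two bounds dominates each of them, as the coefficients are natural numbers.
  refine ⟨RandomAccess.solveProg, RandomAccess.solveTime +
    BISInstance.bitCostBound RandomAccess.solveProg RandomAccess.solveTime,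
    fun n I hn hI => ?_, fun n I hn hI => ?_⟩
  · obtain ⟨s, t, hr, ht, hs⟩ := I.exists_run hn hI
    exact ⟨s, t, hr, by rw [Polynomial.eval_add]; omega, hs⟩
  · obtain ⟨s, t, hr, ht, hs⟩ := I.exists_run hn hI
    obtain ⟨t', hr', ht'⟩ := I.exists_bitCost_run hr ht
    exact ⟨s, t', hr', by rw [Polynomial.eval_add]; omega, hs⟩
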